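/- Fix an integer $D\ge 1$. Let $\mathcal S^D$ be the space of real symmetric $D\times D$ matrices with inner product $a\cdot b=\mathrm{tr}(ab)$, and $\mathcal S^D_+$ its cone of positive semidefinite matrices; write $a\ge b$ if $a-b\in\mathcal S^D_+$. Let $\mathcal H=L^2([0,1);\mathcal S^D)$ and let $\mathcal C\subset\mathcal H$ be the cone of (classes of) square-integrable, right-continuous with left limits, increasing paths $\mu:[0,1)\to\mathcal S^D_+$. For a subset $A$ of a Hilbert space, $A^*=\{x:\langle x,y\rangle\ge 0\ \forall y\in A\}$, and a function $g$ on a set $B$ is $A^*$-increasing if $g(x)\ge g(x')$ whenever $x,x'\in B$ and $x-x'\in A^*$. $\|\cdot\|_{\mathrm{Lip}}\in[0,\infty]$ denotes the best Lipschitz constant. For a partition $j=(0=t_0<t_1<\dots<t_n=1)$, $|j|=n$, let $\mathcal H^j=(\mathcal S^D)^{n}$ with $\langle x,y\rangle=\sum_k (t_k-t_{k-1})\,x_k\cdot y_k$, $\mathcal C^j=\{x:0\le x_1\le\dots\le x_{n}\}$, $\mathrm p_j\iota=\big(\frac1{t_k-t_{k-1}}\int_{t_{k-1}}^{t_k}\iota\big)_k$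 for $\iota\in\mathcal H$, and $\mathrm l_jx=\sum_k x_k\mathbf 1_{[t_{k-1},t_k)}$. A collection $\mathfrak J$ of partitions is good if its members are uniform partitions ($t_k=k/n$), it is directed under inclusion of the sets of partition points, and the $\sigma$-algebras generated by the cells $[t_{k-1},t_k)$ of its members together generate the Borel $\sigma$-algebra of $[0,1)$. Let $H:\mathcal H\to\mathbb R$ be locally Lipschitz and $\mathcal C^*$-increasing, and let $\psi:\mathcal C\to\mathbb R$ be $\mathcal C^*$-increasing and satisfy, for some $C>0$ and $p\in[1,2)$, $|\psi(\mu)-\psi(\nu)|\le C|\mu-\nu|_{L^p}$ for all $\mu,\nu\in\mathcal C$. For a partition $j$ let $f_j:[0,\infty)\times\mathcal C^j\to\mathbb R$ denote the viscosity solution of $\partial_tf=H(\mathrm l_j\nabla f)$ on $[0,\infty)\times\mathcal C^j$ with $f_j(0,\cdot)=\psi\circ\mathrm l_j$, in the class of functions $f$ such that $\sup_{t\ge0}\|f(t,\cdot)\|_{\mathrm{Lip}}<\infty$, $\sup_{t>0,x}|f(t,x)-f(0,x)|/t<\infty$, and every $f(t,\cdot)$ is $(\mathcal C^j)^*$-increasing.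 (Here sub- and supersolutions are continuous functions tested, at every point of $(0,\infty)\times\mathcal C^j$ including boundary points, by functions on $(0,\infty)\times\mathcal C^j$ that have a first-order expansion with quadratic error at every point and a continuous differential; extrema are local relative to $(0,\infty)\times\mathcal C^j$.) Then: (1) For every good collection $\mathfrak J$, the net of lifts $(t,\mu)\mapsto f_j(t,\mathrm p_j\mu)$, $j\in\mathfrak J$, converges, uniformly on every closed ball of $[0,\infty)\times\mathcal C$ of finite radius, to a Lipschitz function $f:[0,\infty)\times\mathcal C\to\mathbb R$ with $f(0,\cdot)=\psi$, $$\sup_{t\ge0}\|f(t,\cdot)\|_{\mathrm{Lip}}\le\|\psi\|_{\mathrm{Lip}},\qquad \sup_{\mu\in\mathcal C}\|f(\cdot,\mu)\|_{\mathrm{Lip}}\le\sup_{\iota\in\mathcal H,\ |\iota|\le\|\psi\|_{\mathrm{Lip}}}|H(\iota)|,$$ the Lipschitz constants of $\psi$ and $f(t,\cdot)$ being taken with respect to the norm of $\mathcal H$. (2) There is a constant $K$, depending only on $D,H,\psi,p,C$, such that for all uniform partitions $j\subset j'$, $$|f_j(t,\mathrm p_j\mathrm l_{j'}x)-f_{j'}(t,x)|\le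 K\,|j|^{-\frac{2-p}{2p}}\,(t+|x|_{\mathcal H^{j'}})\qquad\text{for all }t\ge0,\ x\in\mathcal C^{j'}.$$ -/

import Mathlib

open MeasureTheory Filter Topology Set
open scoped ENNReal NNReal

/-! ### Monotonicity along a cone and Lipschitz constants -/

/-- `g` is `K`-increasing over `A`: `g x' ≤ g x` whenever `x, x' ∈ A` and `x - x' ∈ K`. -/
def ConeIncreasingOn {E : Type*} [AddCommGroup E] (K A : Set E) (g : E → ℝ) : Prop :=
  ∀ x ∈ A, ∀ x' ∈ A, x - x' ∈ K → g x' ≤ g x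

/-- The dual cone `{x | ⟨x, y⟩ ≥ 0 for all y ∈ A}`. -/
def dualCone {E : Type*} [NormedAddCommGroup E] [InnerProductSpace ℝ E] (A : Set E) : Set E :=
  {x | ∀ y ∈ A, 0 ≤ inner ℝ x y}

/-- The best Lipschitz constant of `g` over `A`, as an element of `[0, ∞]`
(pairs `x = y` contribute `0 / 0 = 0`). -/
noncomputable def lipConst {E : Type*} [PseudoEMetricSpace E] (A : Set E) (g : E → ℝ) : ℝ≥0∞ :=
  ⨆ x ∈ A, ⨆ y ∈ A, edist (g x) (g y) / edist x y

/-! ### Viscosity solutions of `∂ₜ f = H (∇ f)` on `[0, ∞) × A` -/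

section Viscosity

variable {E : Type*} [NormedAddCommGroup E] [InnerProductSpace ℝ E]

/-- `φ` is a smooth test function on `(0, ∞) × A` with time derivative `a` and gradient `g`:
the first order expansion of `φ` holds at every point with an error
`O(|s - t|² + |y - x|²)`, along `(0, ∞) × A`, and `a`, `g` are continuous.
(The differential is unique as soon as `A` is a closed convex cone whose span is dense.) -/
structure IsSmoothTest (A : Set E) (φ : ℝ × E → ℝ) (a : ℝ × E → ℝ) (g : ℝ × E → E) : Prop where
  expansion : ∀ z ∈ Ioi (0 : ℝ) ×ˢ A,
    (fun w : ℝ × E => φ w - φ z - (a z * (w.1 - z.1) + inner ℝ (g z) (w.2 - z.2)))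
      =O[𝓝[Ioi (0 : ℝ) ×ˢ A] z] (fun w : ℝ × E => |w.1 - z.1| ^ 2 + ‖w.2 - z.2‖ ^ 2)
  continuousOn_time : ContinuousOn a (Ioi (0 : ℝ) ×ˢ A)
  continuousOn_grad : ContinuousOn g (Ioi (0 : ℝ) ×ˢ A)

/-- Viscosity subsolutions of `∂ₜ f - H (∇ f) = 0` on `[0, ∞) × A`. -/
def IsViscositySubsolution (A : Set E) (H : E → ℝ) (f : ℝ → E → ℝ) : Prop :=
  ContinuousOn (fun z : ℝ × E => f z.1 z.2) (Ici (0 : ℝ) ×ˢ A) ∧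
  ∀ z ∈ Ioi (0 : ℝ) ×ˢ A, ∀ (φ : ℝ × E → ℝ) (a : ℝ × E → ℝ) (g : ℝ × E → E),
    IsSmoothTest A φ a g →
    IsLocalMaxOn (fun w : ℝ × E => f w.1 w.2 - φ w) (Ioi (0 : ℝ) ×ˢ A) z →
    a z - H (g z) ≤ 0

/-- Viscosity supersolutions of `∂ₜ f - H (∇ f) = 0` on `[0, ∞) × A`. -/
def IsViscositySupersolution (A : Set E) (H : E → ℝ) (f : ℝ → E → ℝ) : Prop :=
  ContinuousOn (fun z : ℝ × E => f z.1 z.2) (Ici (0 : ℝ) ×ˢ A) ∧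
  ∀ z ∈ Ioi (0 : ℝ) ×ˢ A, ∀ (φ : ℝ × E → ℝ) (a : ℝ × E → ℝ) (g : ℝ × E → E),
    IsSmoothTest A φ a g →
    IsLocalMinOn (fun w : ℝ × E => f w.1 w.2 - φ w) (Ioi (0 : ℝ) ×ˢ A) z →
    0 ≤ a z - H (g z)

/-- Viscosity solutions: both sub- and supersolutions. -/
def IsViscositySolution (A : Set E) (H : E → ℝ) (f : ℝ → E → ℝ) : Prop :=
  IsViscositySubsolution A H f ∧ IsViscositySupersolution A H f

/-- The class in which the Cauchy problem on a cone `A` is uniquely solvable: `f` is Lipschitz in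
space uniformly in time, `|f(t, x) - f(0, x)| / t` is bounded, and every `f(t, ·)` is increasing
along the dual cone of `A`. -/
structure InSolutionClass (A : Set E) (f : ℝ → E → ℝ) : Prop where
  lipschitz_space : ∃ L : ℝ≥0, ∀ t, 0 ≤ t → LipschitzOnWith L (f t) A
  growth_time : ∃ M : ℝ, ∀ t, 0 < t → ∀ x ∈ A, |f t x - f 0 x| / t ≤ M
  increasing : ∀ t, 0 ≤ t → ConeIncreasingOn (dualCone A) A (f t)

/-- `f` is the viscosity solution, in the class above, of the Cauchy problem
`∂ₜ f = H (∇ f)` on `[0, ∞) × A` with `f(0, ·) = ψ` on `A`. -/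
structure IsCauchySolution (A : Set E) (H : E → ℝ) (ψ : E → ℝ) (f : ℝ → E → ℝ) : Prop where
  solution : IsViscositySolution A H f
  initial : ∀ x ∈ A, f 0 x = ψ x
  inClass : InSolutionClass A f

end Viscosity

/-! ### Symmetric matrices -/

/-- Real symmetric `D × D` matrices, as a subspace of the Euclidean space of all `D × D` arrays.
The induced inner product is `a · b = ∑ i k, a i k * b i k = tr (a b)`. -/
def SymMat (D : ℕ) : Submodule ℝ (EuclideanSpace ℝ (Fin D × Fin D)) where
  carrier := {a | ∀ i k, a (i, k) = a (k, i)}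
  add_mem' := by
    intro a b ha hb i k
    simp [ha i k, hb i k]
  zero_mem' := by
    intro i k
    simp
  smul_mem' := by
    intro c a ha i k
    simp [ha i k]

/-- The underlying matrix. -/
def SymMat.toMatrix {D : ℕ} (a : SymMat D) : Matrix (Fin D) (Fin D) ℝ :=
  Matrix.of fun i k => (a : EuclideanSpace ℝ (Fin D × Fin D)) (i, k)

/-- `a ≥ 0` for a symmetric matrix `a`: it is positive semidefinite. -/
def SymMat.IsPSD {D : ℕ} (a : SymMat D) : Prop := (SymMat.toMatrix a).PosSemidef

/-! ### The Hilbert space of paths and its cone of increasing paths -/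

/-- Lebesgue measure on `[0, 1)`. -/
noncomputable abbrev unitMeasure : Measure ℝ := volume.restrict (Ico (0 : ℝ) 1)

/-- The Hilbert space `L²([0, 1); S^D)`. -/
abbrev PathSpace (D : ℕ) : Type := Lp (SymMat D) 2 unitMeasure

/-- The cone of (classes of) square-integrable, right-continuous with left limits, increasing
paths `[0, 1) → S^D₊`. -/
def pathCone (D : ℕ) : Set (PathSpace D) :=
  {ι | ∃ μ : ℝ → SymMat D,
    (∀ s ∈ Ico (0 : ℝ) 1, SymMat.IsPSD (μ s)) ∧
    (∀ s ∈ Ico (0 : ℝ) 1, ∀ t ∈ Ico (0 : ℝ) 1, s ≤ t → SymMat.IsPSD (μ t - μ s)) ∧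
    (∀ t ∈ Ico (0 : ℝ) 1, ContinuousWithinAt μ (Ici t) t) ∧
    (∀ t ∈ Ioo (0 : ℝ) 1, ∃ l, Tendsto μ (𝓝[<] t) (𝓝 l)) ∧
    ⇑ι =ᵐ[unitMeasure] μ}

/-! ### Partitions of `[0, 1)` -/

/-- A partition `0 = t₀ < t₁ < ⋯ < tₙ = 1`. -/
structure UnitPartition where
  n : ℕ
  t : Fin (n + 1) → ℝ
  strictMono : StrictMono t
  zero : t 0 = 0
  one : t (Fin.last n) = 1

namespace UnitPartition

/-- Partitions are ordered by inclusion of their sets of points. -/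
instance : LE UnitPartition := ⟨fun j j' => range j.t ⊆ range j'.t⟩

/-- The `k`-th cell of the partition. -/
def cell (j : UnitPartition) (k : Fin j.n) : Set ℝ := Ico (j.t k.castSucc) (j.t k.succ)

/-- The length of the `k`-th cell. -/
def len (j : UnitPartition) (k : Fin j.n) : ℝ := j.t k.succ - j.t k.castSucc

theorem len_pos (j : UnitPartition) (k : Fin j.n) : 0 < j.len k :=
  sub_pos.2 (j.strictMono Fin.castSucc_lt_succ)

/-- Uniform partitions. -/
def IsUniform (j : UnitPartition) : Prop := ∀ k, j.t k = (k : ℝ) / j.n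

/-- The sigma-algebra on `[0, 1)` generated by the cells of the partition. -/
@[reducible] def sigmaAlgebra (j : UnitPartition) : MeasurableSpace (Ico (0 : ℝ) 1) :=
  MeasurableSpace.generateFrom {s | ∃ k, s = Subtype.val ⁻¹' j.cell k}

/-- A generating collection of partitions: it is directed, and the associated sigma-algebras
generate the Borel sigma-algebra of `[0, 1)`. -/
def IsGenerating (J : Set UnitPartition) : Prop :=
  (∀ j ∈ J, ∀ j' ∈ J, ∃ j'' ∈ J, j ≤ j'' ∧ j' ≤ j'') ∧
  ⨆ j ∈ J, j.sigmaAlgebra = borel (Ico (0 : ℝ) 1)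

/-- A good collection of partitions: a generating collection of uniform partitions. -/
def IsGood (J : Set UnitPartition) : Prop := (∀ j ∈ J, j.IsUniform) ∧ IsGenerating J

/-- Convergence in the local uniform topology over `X` of the net `(g j)`, `j ∈ J`:
uniform convergence on the trace on `X` of every closed ball. -/
def TendstoLocalUniform {E : Type*} [PseudoMetricSpace E] (J : Set UnitPartition) (X : Set E)
    (g : UnitPartition → E → ℝ) (f : E → ℝ) : Prop :=
  ∀ z ∈ X, ∀ r : ℝ, ∀ ε > 0, ∃ j₀ ∈ J, ∀ j ∈ J, j₀ ≤ j →
    ∀ y ∈ X ∩ Metric.closedBall z r, |g j y - f y| ≤ ε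

end UnitPartition

/-! ### The finite-dimensional spaces attached to a partition -/

/-- The space `(S^D)^{|j|}`. -/
def StepSpace (D : ℕ) (j : UnitPartition) : Type := Fin j.n → SymMat D

namespace StepSpace

variable {D : ℕ} {j : UnitPartition}

instance : AddCommGroup (StepSpace D j) := inferInstanceAs (AddCommGroup (Fin j.n → SymMat D))

noncomputable instance : Module ℝ (StepSpace D j) :=
  inferInstanceAs (Module ℝ (Fin j.n → SymMat D))

/-- The coordinates of an element of the step space. -/
def coord (x : StepSpace D j) : Fin j.n → SymMat D := x

theorem coord_add (x y : StepSpace D j) (k : Fin j.n) :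
    (x + y).coord k = x.coord k + y.coord k := rfl

theorem coord_smul (r : ℝ) (x : StepSpace D j) (k : Fin j.n) :
    (r • x).coord k = r • x.coord k := rfl

/-- The inner product `⟨x, y⟩ = ∑ k, (t_k - t_{k-1}) x_k · y_k`. -/
@[reducible] noncomputable def innerCore (D : ℕ) (j : UnitPartition) :
    InnerProductSpace.Core ℝ (StepSpace D j) where
  inner x y := ∑ k, j.len k * inner ℝ (x.coord k) (y.coord k)
  conj_inner_symm x y := by
    simp [real_inner_comm]
  re_inner_nonneg x := by
    simpa using Finset.sum_nonneg fun k _ => mul_nonneg (j.len_pos k).le (sq_nonneg ‖x.coord k‖)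
  add_left x y z := by
    rw [← Finset.sum_add_distrib]
    refine Finset.sum_congr rfl fun k _ => ?_
    rw [coord_add, inner_add_left, mul_add]
  smul_left x y r := by
    rw [Finset.mul_sum]
    refine Finset.sum_congr rfl fun k _ => ?_
    have h : inner ℝ ((r • x).coord k) (y.coord k) = r * inner ℝ (x.coord k) (y.coord k) :=
      real_inner_smul_left (x.coord k) (y.coord k) r
    rw [h, conj_trivial]
    ring
  definite x hx := by
    have h := (Finset.sum_eq_zero_iff_of_nonneg fun k _ =>
      mul_nonneg (j.len_pos k).le (real_inner_self_nonneg (x := x.coord k))).1 hx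
    funext k
    have hk := (mul_eq_zero.1 (h k (Finset.mem_univ k))).resolve_left (j.len_pos k).ne'
    exact inner_self_eq_zero.1 hk

noncomputable instance : NormedAddCommGroup (StepSpace D j) :=
  (innerCore D j).toNormedAddCommGroup

noncomputable instance : InnerProductSpace ℝ (StepSpace D j) :=
  InnerProductSpace.ofCore (innerCore D j).toCore

end StepSpace

/-- The cone `{0 ≤ x₁ ≤ ⋯ ≤ x_{|j|}}` of the step space. -/
def stepCone (D : ℕ) (j : UnitPartition) : Set (StepSpace D j) :=
  {x | (∀ k, SymMat.IsPSD (x.coord k)) ∧ ∀ k l, k ≤ l → SymMat.IsPSD (x.coord l - x.coord k)}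

/-- The projection `p_j`: averages over the cells of the partition. -/
noncomputable def pathProj {D : ℕ} (j : UnitPartition) (ι : PathSpace D) : StepSpace D j :=
  fun k => (j.len k)⁻¹ • ∫ s in j.cell k, ι s

/-- The lift `l_j x = ∑ k, x_k 1_{[t_{k-1}, t_k)}`. -/
noncomputable def pathLift {D : ℕ} (j : UnitPartition) (x : StepSpace D j) : PathSpace D :=
  ∑ k, indicatorConstLp 2 (s := j.cell k) (measurableSet_Ico) (measure_ne_top unitMeasure _)
    (x.coord k)

/-- `f_j` is the solution of the `j`-th approximate problem: the Cauchy problem on the cone of the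
step space with nonlinearity `H ∘ l_j` and initial condition `ψ ∘ l_j`. -/
def IsApproximateSolution {D : ℕ} (H ψ : PathSpace D → ℝ) (j : UnitPartition)
    (f : ℝ → StepSpace D j → ℝ) : Prop :=
  IsCauchySolution (stepCone D j) (fun x => H (pathLift j x)) (fun x => ψ (pathLift j x)) f

/-! The heart is a comparison of two levels `j ≤ j'` with constants independent of both. Double the
variables with the penalty `L ‖x - P y‖ + κ ‖y‖`, where `P` projects level `j'` to level `j` and `κ`
measures how much `ψ` changes under averaging over the cells of `j`. Lifted to path space, the
gradients seen by the two equations are some `g` and `g - ρ` with `‖ρ‖` essentially at most `κ`, so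
the error is an increment of `H` over that length. But `H` is only locally Lipschitz on an
infinite-dimensional space, where balls are not compact: uniform constants are available only near a
compact set, and `g` comes from the penalty and need not lie in one.

Replacing `g` by a controlled gradient. A test function touching a solution at an interior point
inherits the monotonicity of the solution and every bound on its increments, so its gradient lies in
a set depending only on `ψ` (`gradSet`, `grad_mem`). At a boundary point, penalizing the squared
distance to a translate of the cone into its interior moves the contact inside and lowers the
gradient along the dual cone (`exists_interior_touching`). In the limit this yields `Q` in the
controlled set with `g - Q` in the dual cone, for which the subsolution inequality still holds
(`exists_grad_le`). As `H` is increasing along the dual cone, the supersolution inequality passes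
from `g` to `Q` as well (`sub_le_of_levels`).

Compactness of the controlled set. Interpolating `Lᵖ` between `L¹` and `L²` bounds the increments of
`ψ` by `a` times the `L¹` norm plus `b` times the `L²` norm, with `b` as small as desired. These
bounds propagate to all the solutions (`sub_le_of_initial`) and hence to their gradients `q`. With
`q'` the average of `q` over cells, `‖q - q'‖² = ⟨q, q - q'⟩` is then small, because increasing
paths are `L¹`-close to their averages, at rate `n^(-1/2)` (`pathNormL1_sub_le`). So the set is
totally bounded (`totallyBounded_gradSet`).

The same `L¹` rate, interpolated, shows that `κ` is of order `n^(-(2-p)/(2p))`, which is the rate of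
the theorem. The lifts are thus Cauchy with explicit errors along a good collection, and the
Lipschitz bounds pass to the limit; the time constant is a bound for `|H|` on the controlled set,
which lies in the ball whose radius is the Lipschitz constant of `ψ`. -/

/-! ### Functions with a global quadratic expansion -/

section QuadraticExpansion

variable {E : Type*} [NormedAddCommGroup E] [InnerProductSpace ℝ E]
  {G : Type*} [NormedAddCommGroup G] [InnerProductSpace ℝ G]

/-- `φ` has first order expansions with gradient `g` and a uniform quadratic error. -/
def HasQuadraticExpansion (φ : E → ℝ) (g : E → E) : Prop :=
  ∃ c : ℝ, ∀ x w, |φ w - φ x - inner ℝ (g x) (w - x)| ≤ c * ‖w - x‖ ^ 2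

namespace HasQuadraticExpansion

theorem add {φ ψ : E → ℝ} {g h : E → E} (hφ : HasQuadraticExpansion φ g)
    (hψ : HasQuadraticExpansion ψ h) :
    HasQuadraticExpansion (fun x => φ x + ψ x) (fun x => g x + h x) := by
  obtain ⟨c, hc⟩ := hφ
  obtain ⟨d, hd⟩ := hψ
  refine ⟨c + d, fun x w => ?_⟩
  have h1 := abs_le.1 (hc x w)
  have h2 := abs_le.1 (hd x w)
  rw [inner_add_left, abs_le]
  constructor <;> nlinarith [h1.1, h1.2, h2.1, h2.2]

theorem const_mul {φ : E → ℝ} {g : E → E} (hφ : HasQuadraticExpansion φ g) (a : ℝ) :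
    HasQuadraticExpansion (fun x => a * φ x) (fun x => a • g x) := by
  obtain ⟨c, hc⟩ := hφ
  refine ⟨|a| * c, fun x w => ?_⟩
  rw [real_inner_smul_left, ← mul_sub, ← mul_sub, abs_mul, mul_assoc]
  exact mul_le_mul_of_nonneg_left (hc x w) (abs_nonneg a)

theorem const (b : ℝ) : HasQuadraticExpansion (fun _ : E => b) (fun _ => 0) :=
  ⟨0, fun x w => by simp⟩

theorem neg {φ : E → ℝ} {g : E → E} (hφ : HasQuadraticExpansion φ g) :
    HasQuadraticExpansion (fun x => -φ x) (fun x => -g x) := by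
  simpa using hφ.const_mul (-1)

theorem congr {φ ψ : E → ℝ} {g h : E → E} (hφ : HasQuadraticExpansion φ g)
    (h1 : ∀ x, ψ x = φ x) (h2 : ∀ x, h x = g x) : HasQuadraticExpansion ψ h := by
  obtain rfl : ψ = φ := funext h1
  obtain rfl : h = g := funext h2
  exact hφ

theorem comp_affine {φ : G → ℝ} {g : G → G} (hφ : HasQuadraticExpansion φ g)
    (L : E →L[ℝ] G) (L' : G → E) (hL : ∀ v w, inner ℝ (L' v) w = inner ℝ v (L w)) (b : G) :
    HasQuadraticExpansion (fun x => φ (L x + b)) (fun x => L' (g (L x + b))) := by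
  obtain ⟨c, hc⟩ := hφ
  refine ⟨|c| * ‖L‖ ^ 2, fun x w => ?_⟩
  have h := hc (L x + b) (L w + b)
  have e : L w + b - (L x + b) = L (w - x) := by rw [map_sub]; abel
  rw [e] at h
  rw [hL]
  refine h.trans ?_
  rw [mul_assoc, ← mul_pow]
  calc c * ‖L (w - x)‖ ^ 2 ≤ |c| * ‖L (w - x)‖ ^ 2 := by gcongr; exact le_abs_self c
    _ ≤ _ := by gcongr; exact L.le_opNorm _

theorem comp_sub_const {φ : E → ℝ} {g : E → E} (hφ : HasQuadraticExpansion φ g) (b : E) :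
    HasQuadraticExpansion (fun x => φ (x - b)) (fun x => g (x - b)) := by
  obtain ⟨c, hc⟩ := hφ
  refine ⟨c, fun x w => ?_⟩
  simpa using hc (x - b) (w - b)

/-- The gradient is even Lipschitz, with constant `6 |c|`: combine the expansions from `x` to `y`,
from `y` to `y + z` and from `x` to `y + z`, where `z` has length `‖x - y‖` and points along `g x -
g y`. -/
theorem continuous_grad {φ : E → ℝ} {g : E → E} (hφ : HasQuadraticExpansion φ g) :
    Continuous g := by
  obtain ⟨c, hc⟩ := hφ
  have key : ∀ x y, ‖g x - g y‖ ≤ 6 * |c| * ‖x - y‖ := by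
    intro x y
    rcases eq_or_ne (g x) (g y) with h | h
    · rw [h]; simp; positivity
    have hn : 0 < ‖g x - g y‖ := norm_pos_iff.2 (sub_ne_zero.2 h)
    rcases eq_or_ne x y with rfl | hxy
    · exact absurd rfl h
    have hr : 0 < ‖x - y‖ := norm_pos_iff.2 (sub_ne_zero.2 hxy)
    set r := ‖x - y‖ with hrdef
    set z : E := (r / ‖g x - g y‖) • (g x - g y) with hz
    have hzn : ‖z‖ = r := by
      rw [hz, norm_smul, Real.norm_eq_abs, abs_of_pos (by positivity)]
      field_simp
    have hin : inner ℝ (g x - g y) z = r * ‖g x - g y‖ := by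
      rw [hz, real_inner_smul_right, real_inner_self_eq_norm_sq]
      field_simp
    have h1 := abs_le.1 (hc x (y + z))
    have h2 := abs_le.1 (hc x y)
    have h3 := abs_le.1 (hc y (y + z))
    have e3 : y + z - y = z := by abel
    have e1 : y + z - x = (y - x) + z := by abel
    rw [e3, hzn] at h3
    rw [e1, inner_add_right] at h1
    rw [norm_sub_rev, ← hrdef] at h2
    have n1 : ‖y - x + z‖ ^ 2 ≤ 4 * r ^ 2 := by
      have : ‖y - x + z‖ ≤ r + r := by
        refine (norm_add_le _ _).trans ?_
        rw [hzn, norm_sub_rev]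
      nlinarith [norm_nonneg (y - x + z)]
    have n1' : c * ‖y - x + z‖ ^ 2 ≤ |c| * (4 * r ^ 2) := by
      refine (mul_le_mul_of_nonneg_right (le_abs_self c) (by positivity)).trans ?_
      gcongr
    have n2 : c * r ^ 2 ≤ |c| * r ^ 2 := mul_le_mul_of_nonneg_right (le_abs_self c) (by positivity)
    rw [inner_sub_left] at hin
    have : r * ‖g x - g y‖ ≤ r * (6 * |c| * r) := by nlinarith [h1.1, h1.2, h2.1, h2.2, h3.1, h3.2]
    exact le_of_mul_le_mul_left this hr
  refine (LipschitzWith.of_dist_le_mul (K := (6 * |c|).toNNReal) fun x y => ?_).continuous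
  rw [dist_eq_norm, dist_eq_norm, Real.coe_toNNReal _ (by positivity)]
  exact key x y

theorem norm_sq : HasQuadraticExpansion (fun x : E => ‖x‖ ^ 2) (fun x => (2 : ℝ) • x) := by
  refine ⟨1, fun x w => ?_⟩
  have : ‖w‖ ^ 2 - ‖x‖ ^ 2 - inner ℝ ((2 : ℝ) • x) (w - x) = ‖w - x‖ ^ 2 := by
    rw [real_inner_smul_left, inner_sub_right, norm_sub_sq_real, real_inner_self_eq_norm_sq,
      real_inner_comm w x]
    ring
  rw [this, one_mul, abs_of_nonneg (by positivity)]

/-- The two-sided estimate behind the expansion of `x ↦ √(δ + ‖x‖²)`. -/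
theorem sqrt_add_norm_sq_bound {δ : ℝ} (hδ : 0 < δ) (x w : E) :
    |√(δ + ‖w‖ ^ 2) - √(δ + ‖x‖ ^ 2) - inner ℝ ((√(δ + ‖x‖ ^ 2))⁻¹ • x) (w - x)|
      ≤ (√δ)⁻¹ * ‖w - x‖ ^ 2 := by
  set s := √(δ + ‖x‖ ^ 2) with hs
  set s' := √(δ + ‖w‖ ^ 2) with hs'
  have hsq : s ^ 2 = δ + ‖x‖ ^ 2 := Real.sq_sqrt (by positivity)
  have hsq' : s' ^ 2 = δ + ‖w‖ ^ 2 := Real.sq_sqrt (by positivity)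
  have hspos : 0 < s := Real.sqrt_pos.2 (by positivity)
  have hspos' : 0 < s' := Real.sqrt_pos.2 (by positivity)
  have hsδ : √δ ≤ s := Real.sqrt_le_sqrt (by nlinarith [sq_nonneg ‖x‖])
  have hδ' : 0 < √δ := Real.sqrt_pos.2 hδ
  have e : s' - s - inner ℝ (s⁻¹ • x) (w - x) = s⁻¹ * (s * s' - δ - inner ℝ x w) := by
    rw [real_inner_smul_left, inner_sub_right, real_inner_self_eq_norm_sq]
    field_simp
    linarith
  have hcs : inner ℝ x w ≤ ‖x‖ * ‖w‖ := real_inner_le_norm x w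
  -- This is Cauchy-Schwarz for the vectors `(√δ, x)` and `(√δ, w)`; the upper bound that follows
  -- comes from `0 ≤ (s - s')²`.
  have h0 : 0 ≤ s * s' - δ - inner ℝ x w := by
    have : δ + ‖x‖ * ‖w‖ ≤ s * s' := by
      refine abs_le_of_sq_le_sq' ?_ (by positivity) |>.2
      rw [mul_pow, hsq, hsq']
      nlinarith [mul_nonneg hδ.le (sq_nonneg (‖x‖ - ‖w‖))]
    linarith
  have h1 : s * s' - δ - inner ℝ x w ≤ ‖w - x‖ ^ 2 := by
    rw [norm_sub_sq_real, real_inner_comm x w]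
    have : ‖w‖ ^ 2 - 2 * inner ℝ x w + ‖x‖ ^ 2 ≥ 0 := by
      have := norm_sub_sq_real w x
      rw [real_inner_comm x w] at this
      rw [← this]; positivity
    nlinarith [sq_nonneg (s - s')]
  rw [e, abs_of_nonneg (by positivity)]
  have : s⁻¹ ≤ (√δ)⁻¹ := inv_anti₀ hδ' hsδ
  gcongr

theorem sqrt_add_norm_sq {δ : ℝ} (hδ : 0 < δ) :
    HasQuadraticExpansion (fun x : E => √(δ + ‖x‖ ^ 2))
      (fun x => (√(δ + ‖x‖ ^ 2))⁻¹ • x) :=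
  ⟨(√δ)⁻¹, fun x w => sqrt_add_norm_sq_bound hδ x w⟩

end HasQuadraticExpansion

theorem norm_inv_sqrt_smul_le {δ : ℝ} (hδ : 0 < δ) (x : E) :
    ‖(√(δ + ‖x‖ ^ 2))⁻¹ • x‖ ≤ 1 := by
  have hspos : 0 < √(δ + ‖x‖ ^ 2) := Real.sqrt_pos.2 (by positivity)
  rw [norm_smul, norm_inv, Real.norm_eq_abs, abs_of_pos hspos, inv_mul_le_iff₀ hspos, mul_one]
  exact Real.le_sqrt_of_sq_le (by linarith)

theorem norm_le_sqrt_add {V : Type*} [NormedAddCommGroup V] {δ : ℝ} (hδ : 0 ≤ δ) (x : V) : ‖x‖ ≤ √(δ + ‖x‖ ^ 2) :=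
  Real.le_sqrt_of_sq_le (by linarith)

theorem sqrt_add_le_norm_add {V : Type*} [NormedAddCommGroup V] {δ : ℝ} (hδ : 0 ≤ δ) (x : V) :
    √(δ + ‖x‖ ^ 2) ≤ √δ + ‖x‖ := by
  refine Real.sqrt_le_iff.2 ⟨by positivity, ?_⟩
  nlinarith [Real.sq_sqrt hδ, mul_nonneg (Real.sqrt_nonneg δ) (norm_nonneg x)]

/-- The metric projection on a closed convex set of a finite dimensional space. -/
theorem exists_metric_projection [CompleteSpace E] {K : Set E} (hne : K.Nonempty)
    (hcl : IsClosed K) (hconv : Convex ℝ K) :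
    ∃ P : E → E, (∀ x, P x ∈ K) ∧ ∀ x, ∀ k ∈ K, inner ℝ (x - P x) (k - P x) ≤ 0 := by
  have h : ∀ x, ∃ v ∈ K, ∀ k ∈ K, inner ℝ (x - v) (k - v) ≤ 0 := by
    intro x
    obtain ⟨v, hv, hv'⟩ := exists_norm_eq_iInf_of_complete_convex hne hcl.isComplete hconv x
    exact ⟨v, hv, (norm_eq_iInf_iff_real_inner_le_zero hconv hv).1 hv'⟩
  choose P hP hP' using h
  exact ⟨P, hP, hP'⟩

/-- For the upper bound `P x` competes in the distance from `w`; for the lower bound `P w` competes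
in the distance from `x`, and monotonicity of `id - P` moves the gradient from `w` back to `x`. -/
theorem HasQuadraticExpansion.norm_sub_projection_sq {K : Set E} {P : E → E}
    (hP : ∀ x, P x ∈ K) (hP' : ∀ x, ∀ k ∈ K, inner ℝ (x - P x) (k - P x) ≤ 0) :
    HasQuadraticExpansion (fun x => ‖x - P x‖ ^ 2) (fun x => (2 : ℝ) • (x - P x)) := by
  have hmin : ∀ x, ∀ k ∈ K, ‖x - P x‖ ^ 2 ≤ ‖x - k‖ ^ 2 := by
    intro x k hk
    have h := hP' x k hk
    have e : x - k = (x - P x) - (k - P x) := by abel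
    rw [e, norm_sub_sq_real (x - P x) (k - P x)]
    nlinarith [sq_nonneg ‖k - P x‖]
  refine ⟨1, fun x w => ?_⟩
  rw [real_inner_smul_left, one_mul, abs_le]
  have up := hmin w (P x) (hP x)
  have e1 : w - P x = (x - P x) + (w - x) := by abel
  rw [e1, norm_add_sq_real (x - P x) (w - x)] at up
  have dn := hmin x (P w) (hP w)
  have e2 : x - P w = (w - P w) - (w - x) := by abel
  rw [e2, norm_sub_sq_real (w - P w) (w - x)] at dn
  have mono : 0 ≤ inner ℝ ((w - P w) - (x - P x)) (w - x) := by
    have a1 := hP' x (P w) (hP w)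
    have a2 := hP' w (P x) (hP x)
    have e3 : w - x = ((w - P w) - (x - P x)) + (P w - P x) := by abel
    have e4 : P x - P w = -(P w - P x) := by abel
    rw [e4, inner_neg_right] at a2
    rw [e3, inner_add_right, real_inner_self_eq_norm_sq, inner_sub_left _ _ (P w - P x)]
    nlinarith [sq_nonneg ‖(w - P w) - (x - P x)‖]
  rw [inner_sub_left] at mono
  beta_reduce
  constructor <;> linarith

end QuadraticExpansion

/-! ### Smooth test functions -/

section SmoothTest

variable {E : Type*} [NormedAddCommGroup E] [InnerProductSpace ℝ E]

/-- The building block of the tests made from penalties: a quadratic polynomial in time plus a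
function of space alone. -/
theorem HasQuadraticExpansion.isSmoothTest {ρ : E → ℝ} {g : E → E}
    (hρ : HasQuadraticExpansion ρ g) (A : Set E) (α β b : ℝ) :
    IsSmoothTest A (fun w => α * (w.1 - b) ^ 2 + β * w.1 + ρ w.2)
      (fun w => 2 * α * (w.1 - b) + β) (fun w => g w.2) where
  expansion z _ := by
    obtain ⟨c, hc⟩ := hρ
    refine Asymptotics.IsBigO.of_bound (|α| + |c|) (Eventually.of_forall fun w => ?_)
    have e : α * (w.1 - b) ^ 2 + β * w.1 + ρ w.2 - (α * (z.1 - b) ^ 2 + β * z.1 + ρ z.2) -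
        ((2 * α * (z.1 - b) + β) * (w.1 - z.1) + inner ℝ (g z.2) (w.2 - z.2)) =
        α * (w.1 - z.1) ^ 2 + (ρ w.2 - ρ z.2 - inner ℝ (g z.2) (w.2 - z.2)) := by ring
    rw [e, Real.norm_eq_abs, Real.norm_eq_abs,
      abs_of_nonneg (by positivity : 0 ≤ |w.1 - z.1| ^ 2 + ‖w.2 - z.2‖ ^ 2), sq_abs]
    refine (abs_add_le _ _).trans ?_
    rw [abs_mul, abs_of_nonneg (sq_nonneg (w.1 - z.1))]
    have h := (hc z.2 w.2).trans (mul_le_mul_of_nonneg_right (le_abs_self c) (sq_nonneg _))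
    nlinarith [mul_nonneg (abs_nonneg c) (sq_nonneg (w.1 - z.1)),
      mul_nonneg (abs_nonneg α) (sq_nonneg ‖w.2 - z.2‖)]
  continuousOn_time := by fun_prop
  continuousOn_grad := (hρ.continuous_grad.comp continuous_snd).continuousOn

theorem IsSmoothTest.add {A : Set E} {φ φ' : ℝ × E → ℝ} {a a' : ℝ × E → ℝ} {g g' : ℝ × E → E}
    (h : IsSmoothTest A φ a g) (h' : IsSmoothTest A φ' a' g') :
    IsSmoothTest A (fun w => φ w + φ' w) (fun w => a w + a' w) (fun w => g w + g' w) where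
  expansion z hz := by
    refine ((h.expansion z hz).add (h'.expansion z hz)).congr_left fun w => ?_
    rw [inner_add_left]
    ring
  continuousOn_time := h.continuousOn_time.add h'.continuousOn_time
  continuousOn_grad := h.continuousOn_grad.add h'.continuousOn_grad

theorem IsSmoothTest.neg {A : Set E} {φ : ℝ × E → ℝ} {a : ℝ × E → ℝ} {g : ℝ × E → E}
    (h : IsSmoothTest A φ a g) :
    IsSmoothTest A (fun w => -φ w) (fun w => -a w) (fun w => -g w) where
  expansion z hz := by
    refine (h.expansion z hz).neg_left.congr_left fun w => ?_
    rw [inner_neg_left]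
    ring
  continuousOn_time := h.continuousOn_time.neg
  continuousOn_grad := h.continuousOn_grad.neg

theorem IsSmoothTest.continuousOn {A : Set E} {φ : ℝ × E → ℝ} {a : ℝ × E → ℝ} {g : ℝ × E → E}
    (h : IsSmoothTest A φ a g) : ContinuousOn φ (Ioi (0 : ℝ) ×ˢ A) := by
  intro z hz
  have h1 := h.expansion z hz
  have h2 : Tendsto (fun w : ℝ × E => |w.1 - z.1| ^ 2 + ‖w.2 - z.2‖ ^ 2)
      (𝓝[Ioi (0 : ℝ) ×ˢ A] z) (𝓝 0) := by
    have : Continuous (fun w : ℝ × E => |w.1 - z.1| ^ 2 + ‖w.2 - z.2‖ ^ 2) := by fun_prop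
    have := this.tendsto z
    simp only [sub_self, abs_zero, norm_zero] at this
    simpa using this.mono_left nhdsWithin_le_nhds
  have h3 := h1.trans_tendsto h2
  have h4 : Tendsto (fun w : ℝ × E => a z * (w.1 - z.1) + inner ℝ (g z) (w.2 - z.2) + φ z)
      (𝓝[Ioi (0 : ℝ) ×ˢ A] z) (𝓝 (φ z)) := by
    have : Continuous
      (fun w : ℝ × E => a z * (w.1 - z.1) + inner ℝ (g z) (w.2 - z.2) + φ z) := by fun_prop
    have := this.tendsto z
    simp only [sub_self, mul_zero, inner_zero_right, zero_add] at this
    exact this.mono_left nhdsWithin_le_nhds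
  have h5 := h3.add h4
  rw [zero_add] at h5
  refine h5.congr fun w => ?_
  ring

/-- One-sided directional information on `u` at a point where `u - φ` has a local maximum. -/
theorem IsSmoothTest.neg_inner_grad_le {A : Set E} {φ : ℝ × E → ℝ} {a : ℝ × E → ℝ}
    {g : ℝ × E → E} (h : IsSmoothTest A φ a g) {u : ℝ → E → ℝ} {t : ℝ} (ht : 0 < t) {x : E}
    (hx : x ∈ interior A)
    (hmax : IsLocalMaxOn (fun w : ℝ × E => u w.1 w.2 - φ w) (Ioi (0 : ℝ) ×ˢ A) (t, x))
    {z : E} {m : ℝ} (hz : ∀ ε > 0, x + ε • z ∈ A → u t x - u t (x + ε • z) ≤ ε * m) :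
    -inner ℝ (g (t, x)) z ≤ m := by
  have hcont : Continuous (fun ε : ℝ => ((t, x + ε • z) : ℝ × E)) := by fun_prop
  have h0 : ((t, x + (0 : ℝ) • z) : ℝ × E) = (t, x) := by simp
  have hA : ∀ᶠ ε in 𝓝[>] (0 : ℝ), x + ε • z ∈ A := by
    have : Tendsto (fun ε : ℝ => x + ε • z) (𝓝 0) (𝓝 x) := by
      have : Continuous (fun ε : ℝ => x + ε • z) := by fun_prop
      simpa using this.tendsto 0
    exact (this.eventually (mem_interior_iff_mem_nhds.1 hx)).filter_mono nhdsWithin_le_nhds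
  have htend : Tendsto (fun ε : ℝ => ((t, x + ε • z) : ℝ × E)) (𝓝[>] 0)
      (𝓝[Ioi (0 : ℝ) ×ˢ A] (t, x)) := by
    refine tendsto_nhdsWithin_iff.2 ⟨?_, ?_⟩
    · have := hcont.tendsto 0
      rw [h0] at this
      exact this.mono_left nhdsWithin_le_nhds
    · filter_upwards [hA] with ε hε using ⟨ht, hε⟩
  have hmem : ((t, x) : ℝ × E) ∈ Ioi (0 : ℝ) ×ˢ A := ⟨ht, interior_subset hx⟩
  obtain ⟨c, hc⟩ := (h.expansion (t, x) hmem).bound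
  have e1 := htend.eventually hc
  have e2 := htend.eventually hmax
  have key : ∀ᶠ ε in 𝓝[>] (0 : ℝ), -inner ℝ (g (t, x)) z - c * ‖z‖ ^ 2 * ε ≤ m := by
    filter_upwards [e1, e2, hA, self_mem_nhdsWithin] with ε h1 h2 h3 h4
    have hε : 0 < ε := h4
    have h5 := hz ε hε h3
    simp only [sub_self, mul_zero, zero_add, add_sub_cancel_left, abs_zero, norm_smul,
      Real.norm_eq_abs, inner_smul_right, abs_of_pos hε] at h1 h2
    norm_num at h1
    rw [abs_of_pos hε] at h1
    have h6 := (abs_le.1 h1).2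
    have : ε * (-inner ℝ (g (t, x)) z - c * ‖z‖ ^ 2 * ε) ≤ ε * m := by nlinarith
    exact le_of_mul_le_mul_left this hε
  have lim : Tendsto (fun ε : ℝ => -inner ℝ (g (t, x)) z - c * ‖z‖ ^ 2 * ε) (𝓝[>] 0)
      (𝓝 (-inner ℝ (g (t, x)) z)) := by
    have : Continuous (fun ε : ℝ => -inner ℝ (g (t, x)) z - c * ‖z‖ ^ 2 * ε) := by fun_prop
    have := this.tendsto 0
    simp only [mul_zero, sub_zero] at this
    exact this.mono_left nhdsWithin_le_nhds
  exact le_of_tendsto lim key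

end SmoothTest

/-! ### Doubling of variables -/

section Doubling

variable {E : Type*} [NormedAddCommGroup E] [InnerProductSpace ℝ E]
  {E' : Type*} [NormedAddCommGroup E'] [InnerProductSpace ℝ E']

/-- A continuous function dominated by `b - c ‖w‖` attains its maximum over a closed set. -/
theorem exists_isMaxOn_of_le_sub_norm {F : Type*} [NormedAddCommGroup F] [ProperSpace F]
    {s : Set F} (hs : IsClosed s) {f : F → ℝ} (hf : ContinuousOn f s) {w₀ : F} (hw₀ : w₀ ∈ s)
    {b c : ℝ} (hc : 0 < c) (hle : ∀ w ∈ s, f w ≤ b - c * ‖w‖) : ∃ w ∈ s, IsMaxOn f s w := by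
  refine hf.exists_isMaxOn' hs hw₀ ?_
  have h : ∀ᶠ w in cocompact F, (b - f w₀) / c < ‖w‖ := by
    have := (isCompact_closedBall (0 : F) ((b - f w₀) / c)).compl_mem_cocompact
    filter_upwards [this] with w hw
    simpa using hw
  filter_upwards [h.filter_mono inf_le_left, mem_inf_of_right (mem_principal_self s)] with w h1 h2
  rw [div_lt_iff₀ hc] at h1
  linarith [hle w h2]

/-- Complete squares in `t - s - h` and in `s`. The additional `1` next to `M` and `M'` leaves a
decay in `t + s`, which is the coercivity in time needed for a maximum to exist. -/
theorem doubling_coercive_bound {ε η M M' h t s : ℝ} (hε : 0 < ε) (hη : 0 < η) :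
    (M + 1) * t + (M' + 1) * s - (t - s - h) ^ 2 / (2 * ε) - η * s ^ 2 ≤
      ε * (M + 1) ^ 2 / 2 + (M + M' + 2) ^ 2 / (4 * η) + (M + 1) * h := by
  have h1 : (M + 1) * (t - s - h) - (t - s - h) ^ 2 / (2 * ε) ≤ ε * (M + 1) ^ 2 / 2 := by
    rw [← sub_nonneg]
    have : ε * (M + 1) ^ 2 / 2 - ((M + 1) * (t - s - h) - (t - s - h) ^ 2 / (2 * ε)) =
        (t - s - h - ε * (M + 1)) ^ 2 / (2 * ε) := by
      field_simp
      ring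
    rw [this]
    positivity
  have h2 : (M + M' + 2) * s - η * s ^ 2 ≤ (M + M' + 2) ^ 2 / (4 * η) := by
    rw [← sub_nonneg]
    have : (M + M' + 2) ^ 2 / (4 * η) - ((M + M' + 2) * s - η * s ^ 2) =
        (2 * η * s - (M + M' + 2)) ^ 2 / (4 * η) := by
      field_simp
      ring
    rw [this]
    positivity
  linarith

theorem mul_sub_sq_div_le {ε M τ : ℝ} (hε : 0 < ε) :
    M * τ - τ ^ 2 / (2 * ε) ≤ M ^ 2 * ε / 2 := by
  rw [← sub_nonneg]
  have : M ^ 2 * ε / 2 - (M * τ - τ ^ 2 / (2 * ε)) = (τ - ε * M) ^ 2 / (2 * ε) := by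
    field_simp
    ring
  rw [this]
  positivity

/-- Doubling of variables, with the spatial penalty `Φ` and the time shift `h`. The conclusions
drawn from the test functions are recorded by the predicates `P` and `P'`. -/
theorem doubling_of_variables [ProperSpace E] [ProperSpace E'] {A : Set E} {A' : Set E'}
    (hA : IsClosed A) (hA' : IsClosed A') {u : ℝ → E → ℝ} {v : ℝ → E' → ℝ}
    (hu : ContinuousOn (fun z : ℝ × E => u z.1 z.2) (Ici (0 : ℝ) ×ˢ A))
    (hv : ContinuousOn (fun z : ℝ × E' => v z.1 z.2) (Ici (0 : ℝ) ×ˢ A'))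
    {Φ : E → E' → ℝ} {G : E → E' → E} {G' : E → E' → E'}
    (hG : ∀ y, HasQuadraticExpansion (fun x => Φ x y) (fun x => G x y))
    (hG' : ∀ x, HasQuadraticExpansion (fun y => -Φ x y) (fun y => G' x y))
    (hΦ : Continuous fun w : E × E' => Φ w.1 w.2)
    {c M M' γ h : ℝ} (hc : 0 < c) (hM : 0 ≤ M) (hM' : 0 ≤ M') (hγ : 0 ≤ γ) (hh : 0 ≤ h)
    (hinit : ∀ x ∈ A, ∀ y ∈ A', u 0 x - v 0 y + c * (‖x‖ + ‖y‖) ≤ Φ x y)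
    (hut : ∀ t, 0 ≤ t → ∀ x ∈ A, u t x ≤ u 0 x + M * t)
    (hvt : ∀ t, 0 ≤ t → ∀ y ∈ A', v 0 y - M' * t ≤ v t y)
    {P : ℝ → E → Prop} {P' : ℝ → E' → Prop}
    (hP : ∀ z ∈ Ioi (0 : ℝ) ×ˢ A, ∀ (φ : ℝ × E → ℝ) (a : ℝ × E → ℝ) (g : ℝ × E → E),
      IsSmoothTest A φ a g →
      IsLocalMaxOn (fun w : ℝ × E => u w.1 w.2 - φ w) (Ioi (0 : ℝ) ×ˢ A) z → P (a z) (g z))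
    (hP' : ∀ z ∈ Ioi (0 : ℝ) ×ˢ A', ∀ (φ : ℝ × E' → ℝ) (a : ℝ × E' → ℝ) (g : ℝ × E' → E'),
      IsSmoothTest A' φ a g →
      IsLocalMinOn (fun w : ℝ × E' => v w.1 w.2 - φ w) (Ioi (0 : ℝ) ×ˢ A') z → P' (a z) (g z))
    (hPP : ∀ x ∈ A, ∀ y ∈ A', ∀ a a', P a (G x y) → P' a' (G' x y) → a ≤ a' + γ)
    {t : ℝ} (ht : 0 ≤ t) {x : E} (hx : x ∈ A) {y : E'} (hy : y ∈ A') :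
    u (t + h) x - v t y ≤ Φ x y + γ * t + M * h := by
  have main : ∀ ε > 0, ∀ η > 0, u (t + h) x - v t y - Φ x y - ((γ + η) * t + η * t ^ 2) ≤
      M * h + (M ^ 2 + M' ^ 2) * ε / 2 := by
    intro ε hε η hη
    -- The square forces `t` close to `s + h`. The slope `γ + η` exceeds the admissible error `γ`,
    -- which yields the contradiction; `η s²` gives coercivity in time however fast `u` and `v` grow
    -- linearly.
    set Ψ : (ℝ × E) × (ℝ × E') → ℝ := fun w => u w.1.1 w.1.2 - v w.2.1 w.2.2 - Φ w.1.2 w.2.2 -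
      (w.1.1 - w.2.1 - h) ^ 2 / (2 * ε) - ((γ + η) * w.2.1 + η * w.2.1 ^ 2) with hΨ
    set S : Set ((ℝ × E) × (ℝ × E')) := (Ici (0 : ℝ) ×ˢ A) ×ˢ (Ici (0 : ℝ) ×ˢ A') with hS
    have hSc : IsClosed S := (isClosed_Ici.prod hA).prod (isClosed_Ici.prod hA')
    have hΨc : ContinuousOn Ψ S := by
      have c1 : ContinuousOn (fun w : (ℝ × E) × (ℝ × E') => u w.1.1 w.1.2) S :=
        hu.comp continuous_fst.continuousOn fun w hw => hw.1
      have c2 : ContinuousOn (fun w : (ℝ × E) × (ℝ × E') => v w.2.1 w.2.2) S :=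
        hv.comp continuous_snd.continuousOn fun w hw => hw.2
      have c3 : Continuous (fun w : (ℝ × E) × (ℝ × E') => Φ w.1.2 w.2.2) :=
        hΦ.comp (by fun_prop : Continuous fun w : (ℝ × E) × (ℝ × E') => (w.1.2, w.2.2))
      exact ((((c1.sub c2).sub c3.continuousOn).sub (by fun_prop)).sub (by fun_prop))
    set b := ε * ((M + 1 : ℝ) + 0) ^ 2 / 2 + (M + (M' - γ - η) + 2) ^ 2 / (4 * η) + (M + 1) * h
      with hb
    have hbound : ∀ w ∈ S, Ψ w ≤ b - min 1 c * ‖w‖ := by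
      rintro ⟨⟨t, x⟩, ⟨s, y⟩⟩ ⟨⟨ht, hx⟩, ⟨hs, hy⟩⟩
      simp only [mem_Ici] at ht hs hx hy
      have h1 := hinit x hx y hy
      have h2 := hut t ht x hx
      have h3 := hvt s hs y hy
      have h4 := doubling_coercive_bound (M := M) (M' := M' - γ - η) (h := h) (t := t) (s := s)
        hε hη
      have hm1 : min 1 c ≤ 1 := min_le_left _ _
      have hmc : min 1 c ≤ c := min_le_right _ _
      have hm0 : 0 < min 1 c := lt_min one_pos hc
      have hnorm : ‖(((t, x), (s, y)) : (ℝ × E) × (ℝ × E'))‖ ≤ t + s + (‖x‖ + ‖y‖) := by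
        simp only [Prod.norm_def, Real.norm_eq_abs, abs_of_nonneg ht, abs_of_nonneg hs]
        have := norm_nonneg x
        have := norm_nonneg y
        refine max_le (max_le ?_ ?_) (max_le ?_ ?_) <;> linarith
      have h5 : min 1 c * ‖(((t, x), (s, y)) : (ℝ × E) × (ℝ × E'))‖ ≤
          t + s + c * (‖x‖ + ‖y‖) := by
        refine (mul_le_mul_of_nonneg_left hnorm hm0.le).trans ?_
        rw [mul_add]
        exact add_le_add (by nlinarith) (mul_le_mul_of_nonneg_right hmc (by positivity))
      simp only [hΨ, hb]
      rw [add_zero]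
      linarith
    have hw₀ : (((t + h, x), (t, y)) : (ℝ × E) × (ℝ × E')) ∈ S :=
      ⟨⟨add_nonneg ht hh, hx⟩, ⟨ht, hy⟩⟩
    obtain ⟨⟨⟨t₁, x₁⟩, ⟨s₁, y₁⟩⟩, hw₁, hmax⟩ :=
      exists_isMaxOn_of_le_sub_norm hSc hΨc hw₀ (lt_min one_pos hc) hbound
    obtain ⟨⟨ht₁, hx₁⟩, ⟨hs₁, hy₁⟩⟩ := hw₁
    simp only [mem_Ici] at ht₁ hs₁ hx₁ hy₁
    -- If one of the times vanishes, the initial comparison and the growth bounds already suffice.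
    -- The equations are only used when both are positive.
    have hval : Ψ ((t₁, x₁), (s₁, y₁)) ≤ M * h + (M ^ 2 + M' ^ 2) * ε / 2 ∨
        (0 < t₁ ∧ 0 < s₁) := by
      have h1 := hinit x₁ hx₁ y₁ hy₁
      have h2 := hut t₁ ht₁ x₁ hx₁
      have h3 := hvt s₁ hs₁ y₁ hy₁
      have h4 : 0 ≤ c * (‖x₁‖ + ‖y₁‖) := by positivity
      have h5 : 0 ≤ (γ + η) * s₁ + η * s₁ ^ 2 := by positivity
      rcases ht₁.eq_or_lt with h0 | h0
      · left
        have h6 := mul_sub_sq_div_le (M := M') (τ := s₁ + h) hε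
        have h7 : 0 ≤ M' * h := by positivity
        have h8 : 0 ≤ M * h := by positivity
        have h9 : 0 ≤ M ^ 2 * ε / 2 := by positivity
        have h10 : (0 - s₁ - h) ^ 2 / (2 * ε) = (s₁ + h) ^ 2 / (2 * ε) := by ring
        simp only [hΨ, ← h0] at *
        linarith
      rcases hs₁.eq_or_lt with h0' | h0'
      · left
        have h6 := mul_sub_sq_div_le (M := M) (τ := t₁ - h) hε
        have h9 : 0 ≤ M' ^ 2 * ε / 2 := by positivity
        have h10 : (t₁ - 0 - h) ^ 2 / (2 * ε) = (t₁ - h) ^ 2 / (2 * ε) := by ring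
        simp only [hΨ, ← h0'] at *
        linarith
      exact Or.inr ⟨h0, h0'⟩
    have hfin : Ψ ((t₁, x₁), (s₁, y₁)) ≤ M * h + (M ^ 2 + M' ^ 2) * ε / 2 := by
      refine hval.resolve_right ?_
      rintro ⟨ht₁', hs₁'⟩
      have hsub := hP (t₁, x₁) ⟨ht₁', hx₁⟩ _ _ _
        ((hG y₁).isSmoothTest A (1 / (2 * ε)) 0 (s₁ + h)) (by
          refine IsMaxOn.localize ?_
          rintro ⟨t', x'⟩ ⟨ht', hx'⟩
          have := hmax (show ((t', x'), (s₁, y₁)) ∈ S from ⟨⟨le_of_lt (mem_Ioi.1 ht'), hx'⟩, ⟨hs₁, hy₁⟩⟩)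
          simp only [mem_ofPred_eq, hΨ] at this ⊢
          have e1 : 1 / (2 * ε) * (t' - (s₁ + h)) ^ 2 = (t' - s₁ - h) ^ 2 / (2 * ε) := by ring
          have e2 : 1 / (2 * ε) * (t₁ - (s₁ + h)) ^ 2 = (t₁ - s₁ - h) ^ 2 / (2 * ε) := by ring
          rw [e1, e2]
          linarith)
      have hsup := hP' (s₁, y₁) ⟨hs₁', hy₁⟩ _ _ _
        ((((hG' x₁).isSmoothTest A' (-(1 / (2 * ε))) (-(γ + η)) (t₁ - h))).add
          ((HasQuadraticExpansion.const (0 : ℝ)).isSmoothTest A' (-η) 0 0)) (by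
          refine IsMinOn.localize ?_
          rintro ⟨s', y'⟩ ⟨hs', hy'⟩
          have := hmax (show ((t₁, x₁), (s', y')) ∈ S from ⟨⟨ht₁, hx₁⟩, ⟨le_of_lt (mem_Ioi.1 hs'), hy'⟩⟩)
          simp only [mem_ofPred_eq, hΨ] at this ⊢
          have e1 : -(1 / (2 * ε)) * (s' - (t₁ - h)) ^ 2 = -((t₁ - s' - h) ^ 2 / (2 * ε)) := by
            ring
          have e2 : -(1 / (2 * ε)) * (s₁ - (t₁ - h)) ^ 2 = -((t₁ - s₁ - h) ^ 2 / (2 * ε)) := by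
            ring
          rw [e1, e2]
          linarith)
      simp only [add_zero] at hsup hsub
      -- The two time derivatives differ by exactly `γ + η + 2 η s₁`, which is more than the `γ`
      -- allowed here.
      have := hPP x₁ hx₁ y₁ hy₁ _ _ hsub hsup
      have e3 : 2 * -(1 / (2 * ε)) * (s₁ - (t₁ - h)) = 2 * (1 / (2 * ε)) * (t₁ - (s₁ + h)) := by
        ring
      rw [e3] at this
      nlinarith
    have := (hmax hw₀).trans hfin
    simp only [hΨ] at this
    have e0 : t + h - t - h = 0 := by ring
    rw [e0] at this
    simpa using this
  have lim : Tendsto (fun ε : ℝ => M * h + (M ^ 2 + M' ^ 2) * ε / 2 +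
      (ε * t + ε * t ^ 2)) (𝓝[>] 0) (𝓝 (M * h)) := by
    have : Continuous (fun ε : ℝ => M * h + (M ^ 2 + M' ^ 2) * ε / 2 +
      (ε * t + ε * t ^ 2)) := by fun_prop
    have := this.tendsto 0
    simp only [mul_zero, zero_mul, add_zero, zero_div] at this
    exact this.mono_left nhdsWithin_le_nhds
  have : u (t + h) x - v t y - Φ x y - γ * t ≤ M * h := by
    refine ge_of_tendsto lim ?_
    filter_upwards [self_mem_nhdsWithin] with ε hε
    have := main ε hε ε hε
    linarith
  linarith

end Doubling

/-! ### Subsolutions at the boundary of a cone -/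

section Boundary

variable {E : Type*} [NormedAddCommGroup E] [InnerProductSpace ℝ E]

/-- Closed convex cones with nonempty interior. -/
structure IsSolidCone (A : Set E) : Prop where
  isClosed : IsClosed A
  add_mem : ∀ x ∈ A, ∀ y ∈ A, x + y ∈ A
  smul_mem : ∀ c : ℝ, 0 ≤ c → ∀ x ∈ A, c • x ∈ A
  nonempty_interior : (interior A).Nonempty

theorem IsSolidCone.convex {A : Set E} (hA : IsSolidCone A) : Convex ℝ A :=
  fun _ hx _ hy _ _ ha hb _ =>
    hA.add_mem _ (hA.smul_mem _ ha _ hx) _ (hA.smul_mem _ hb _ hy)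

theorem isClosed_dualCone (A : Set E) : IsClosed (dualCone A) := by
  have : dualCone A = ⋂ y ∈ A, {x | 0 ≤ inner ℝ x y} := by ext x; simp [dualCone]
  rw [this]
  exact isClosed_biInter fun y _ => isClosed_le continuous_const (by fun_prop)

/-- At a boundary point, touching by a test function can be replaced by touching at nearby interior
points, the gradient being decreased along the dual cone: this is achieved by penalizing the squared
distance to a translate of the cone into its interior. -/
theorem IsSolidCone.exists_interior_touching [ProperSpace E] {A : Set E} (hA : IsSolidCone A)
    {u : ℝ → E → ℝ} (hu : ContinuousOn (fun z : ℝ × E => u z.1 z.2) (Ici (0 : ℝ) ×ˢ A))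
    {z : ℝ × E} (hz : z ∈ Ioi (0 : ℝ) ×ˢ A) {φ : ℝ × E → ℝ} {a : ℝ × E → ℝ} {g : ℝ × E → E}
    (hφ : IsSmoothTest A φ a g)
    (hmax : IsLocalMaxOn (fun w : ℝ × E => u w.1 w.2 - φ w) (Ioi (0 : ℝ) ×ˢ A) z)
    {ε : ℝ} (hε : 0 < ε) :
    ∃ z' : ℝ × E, 0 < z'.1 ∧ z'.2 ∈ interior A ∧ dist z' z < ε ∧
      ∃ (φ' : ℝ × E → ℝ) (a' : ℝ × E → ℝ) (g' : ℝ × E → E), IsSmoothTest A φ' a' g' ∧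
        IsLocalMaxOn (fun w : ℝ × E => u w.1 w.2 - φ' w) (Ioi (0 : ℝ) ×ˢ A) z' ∧
        a' z' = a z' + 2 * (z'.1 - z.1) ∧
        g z' + (2 : ℝ) • (z'.2 - z.2) - g' z' ∈ dualCone A := by
  obtain ⟨hz1, hz2⟩ := hz
  rw [mem_Ioi] at hz1
  obtain ⟨e, he⟩ := hA.nonempty_interior
  obtain ⟨r, hr, hball⟩ := Metric.mem_nhds_iff.1 (mem_interior_iff_mem_nhds.1 he)
  have heA : e ∈ A := interior_subset he
  set F : ℝ × E → ℝ := fun w => u w.1 w.2 - φ w with hF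
  have hFc : ContinuousOn F (Ioi (0 : ℝ) ×ˢ A) :=
    (hu.mono (prod_mono_left Ioi_subset_Ici_self)).sub hφ.continuousOn
  obtain ⟨r₀, hr₀, hloc⟩ := Metric.mem_nhdsWithin_iff.1 hmax
  set r₁ := min (r₀ / 2) (min (ε / 2) (z.1 / 2)) with hr₁
  have hr₁0 : 0 < r₁ := by positivity
  have hr₁a : r₁ < r₀ := (min_le_left _ _).trans_lt (by linarith)
  have hr₁b : r₁ < ε := (min_le_right _ _).trans_lt ((min_le_left _ _).trans_lt (by linarith))
  have hr₁c : r₁ < z.1 := (min_le_right _ _).trans_lt ((min_le_right _ _).trans_lt (by linarith))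
  -- The shifted point is the competitor: it pays nothing for the distance to the translated cone,
  -- and for small `δ` it almost attains the value at `z`.
  have hshift : ∀ᶠ δ in 𝓝[>] (0 : ℝ), |F (z.1, z.2 + δ • e) - F z| < r₁ ^ 2 / 4 ∧
      δ ^ 2 * ‖e‖ ^ 2 < r₁ ^ 2 / 4 ∧ δ * ‖e‖ < r₁ := by
    have hcont : Continuous (fun δ : ℝ => ((z.1, z.2 + δ • e) : ℝ × E)) := by fun_prop
    have h1 : Tendsto (fun δ : ℝ => ((z.1, z.2 + δ • e) : ℝ × E)) (𝓝[>] 0)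
        (𝓝[Ioi (0 : ℝ) ×ˢ A] z) := by
      refine tendsto_nhdsWithin_iff.2 ⟨?_, ?_⟩
      · have := hcont.tendsto 0
        simp only [zero_smul, add_zero] at this
        exact this.mono_left nhdsWithin_le_nhds
      · filter_upwards [self_mem_nhdsWithin] with δ hδ
        exact ⟨hz1, hA.add_mem _ hz2 _ (hA.smul_mem _ (le_of_lt hδ) _ heA)⟩
    have h2 := (hFc z ⟨hz1, hz2⟩).tendsto.comp h1
    have h3 := Metric.tendsto_nhds.1 h2 (r₁ ^ 2 / 4) (by positivity)
    have h4 : Tendsto (fun δ : ℝ => δ ^ 2 * ‖e‖ ^ 2) (𝓝[>] 0) (𝓝 0) := by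
      have : Continuous (fun δ : ℝ => δ ^ 2 * ‖e‖ ^ 2) := by fun_prop
      have := this.tendsto 0
      norm_num at this
      exact this.mono_left nhdsWithin_le_nhds
    have h5 : Tendsto (fun δ : ℝ => δ * ‖e‖) (𝓝[>] 0) (𝓝 0) := by
      have : Continuous (fun δ : ℝ => δ * ‖e‖) := by fun_prop
      have := this.tendsto 0
      norm_num at this
      exact this.mono_left nhdsWithin_le_nhds
    filter_upwards [h3, h4.eventually_lt_const (by positivity : 0 < r₁ ^ 2 / 4),
      h5.eventually_lt_const hr₁0] with δ h6 h7 h8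
    exact ⟨by simpa [Real.dist_eq] using h6, h7, h8⟩
  obtain ⟨δ, ⟨hδ1, hδ2, hδ3⟩, hδ0⟩ := (hshift.and self_mem_nhdsWithin).exists
  replace hδ0 : 0 < δ := hδ0
  obtain ⟨P, hP, hP'⟩ := exists_metric_projection ⟨z.2, hz2⟩ hA.isClosed hA.convex
  have hPself : ∀ x ∈ A, x - P x = 0 := by
    intro x hx
    have := hP' x x hx
    rw [real_inner_self_eq_norm_sq] at this
    exact norm_eq_zero.1 (pow_eq_zero_iff two_ne_zero |>.1 (le_antisymm this (sq_nonneg _)))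
  -- With this weight, a penalty below `r₁²` forces the distance to the translate of `A` by `δ • e`
  -- below `δ * r`; balls of that radius centred in the translate lie in `A`, so the maximizer is
  -- interior.
  set B := r₁ ^ 2 / (δ * r) ^ 2 with hB
  have hB0 : 0 < B := by positivity
  have hpen : HasQuadraticExpansion (fun x => ‖x - z.2‖ ^ 2 + B * ‖x - δ • e - P (x - δ • e)‖ ^ 2)
      (fun x => (2 : ℝ) • (x - z.2) + B • (2 : ℝ) • (x - δ • e - P (x - δ • e))) :=
    (HasQuadraticExpansion.norm_sq.comp_sub_const z.2).add
      (((HasQuadraticExpansion.norm_sub_projection_sq hP hP').comp_sub_const (δ • e)).const_mul B)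
  have htest := hφ.add (hpen.isSmoothTest A 1 0 z.1)
  set φ' : ℝ × E → ℝ := fun w => φ w + (1 * (w.1 - z.1) ^ 2 + 0 * w.1 +
    (‖w.2 - z.2‖ ^ 2 + B * ‖w.2 - δ • e - P (w.2 - δ • e)‖ ^ 2)) with hφ'
  have hcpt : IsCompact (Metric.closedBall z r₁ ∩ (Ici (0 : ℝ) ×ˢ A)) :=
    (isCompact_closedBall z r₁).inter_right (isClosed_Ici.prod hA.isClosed)
  have hsubset : Metric.closedBall z r₁ ∩ (Ici (0 : ℝ) ×ˢ A) ⊆ Ioi (0 : ℝ) ×ˢ A := by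
    rintro w ⟨hw1, -, hw2⟩
    refine ⟨?_, hw2⟩
    have : dist w.1 z.1 ≤ r₁ := (le_max_left _ _).trans hw1
    rw [Real.dist_eq] at this
    have := (abs_le.1 this).1
    rw [mem_Ioi]
    linarith
  have hw₀ : (z.1, z.2 + δ • e) ∈ Metric.closedBall z r₁ ∩ (Ici (0 : ℝ) ×ˢ A) := by
    refine ⟨?_, hz1.le, hA.add_mem _ hz2 _ (hA.smul_mem _ hδ0.le _ heA)⟩
    rw [Metric.mem_closedBall, Prod.dist_eq]
    simp only [dist_self, dist_self_add_left]
    rw [norm_smul, Real.norm_eq_abs, abs_of_pos hδ0]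
    exact max_le hr₁0.le hδ3.le
  obtain ⟨z', hz', hz'max⟩ := hcpt.exists_isMaxOn ⟨_, hw₀⟩
    (((hu.mono (prod_mono_left Ioi_subset_Ici_self)).sub htest.continuousOn).mono hsubset)
  have hz'A := hsubset hz'
  have hcmp := hz'max hw₀
  have hFz : F z' ≤ F z := hloc ⟨Metric.closedBall_subset_ball hr₁a hz'.1, hz'A⟩
  have hd0 : z.2 + δ • e - δ • e - P (z.2 + δ • e - δ • e) = 0 := by
    rw [add_sub_cancel_right]; exact hPself _ hz2
  simp only [mem_ofPred_eq, Pi.sub_apply, hφ', hd0, sub_self, add_sub_cancel_left] at hcmp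
  rw [norm_smul, Real.norm_eq_abs, mul_pow, sq_abs] at hcmp
  have hsmall : (z'.1 - z.1) ^ 2 + ‖z'.2 - z.2‖ ^ 2 +
      B * ‖z'.2 - δ • e - P (z'.2 - δ • e)‖ ^ 2 < r₁ ^ 2 := by
    have := (abs_lt.1 hδ1).1
    simp only [hF] at this hFz
    norm_num at hcmp
    nlinarith
  have hpos : 0 ≤ B * ‖z'.2 - δ • e - P (z'.2 - δ • e)‖ ^ 2 := by positivity
  have hd1 : |z'.1 - z.1| < r₁ := abs_lt_of_sq_lt_sq (by nlinarith [sq_nonneg ‖z'.2 - z.2‖]) hr₁0.le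
  have hd2 : ‖z'.2 - z.2‖ < r₁ :=
    (abs_lt_of_sq_lt_sq (by nlinarith [sq_nonneg (z'.1 - z.1)]) hr₁0.le).trans_le' (le_abs_self _)
  have hd3 : ‖z'.2 - δ • e - P (z'.2 - δ • e)‖ < δ * r := by
    refine (abs_lt_of_sq_lt_sq ?_ (by positivity)).trans_le' (le_abs_self _)
    have h1 : B * ‖z'.2 - δ • e - P (z'.2 - δ • e)‖ ^ 2 < r₁ ^ 2 := by
      nlinarith [sq_nonneg (z'.1 - z.1), sq_nonneg ‖z'.2 - z.2‖]
    have h2 : r₁ ^ 2 = B * (δ * r) ^ 2 := by rw [hB]; field_simp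
    rw [h2] at h1
    exact lt_of_mul_lt_mul_left h1 hB0.le
  have hdist : dist z' z < r₁ := by
    rw [Prod.dist_eq, Real.dist_eq, dist_eq_norm]
    exact max_lt hd1 hd2
  refine ⟨z', hz'A.1, ?_, hdist.trans hr₁b, φ', _, _, htest, ?_, by ring, ?_⟩
  · rw [mem_interior]
    refine ⟨Metric.ball (P (z'.2 - δ • e) + δ • e) (δ * r), ?_, Metric.isOpen_ball, ?_⟩
    · intro y hy
      have h1 : δ⁻¹ • (y - P (z'.2 - δ • e)) ∈ A := by
        apply hball
        rw [Metric.mem_ball, dist_eq_norm] at hy ⊢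
        have : δ⁻¹ • (y - P (z'.2 - δ • e)) - e = δ⁻¹ • (y - (P (z'.2 - δ • e) + δ • e)) := by
          rw [← sub_sub, smul_sub _ _ (δ • e), inv_smul_smul₀ hδ0.ne']
        rw [this, norm_smul, norm_inv, Real.norm_eq_abs, abs_of_pos hδ0, inv_mul_lt_iff₀ hδ0]
        exact hy
      have h2 := hA.add_mem _ (hP (z'.2 - δ • e)) _ (hA.smul_mem δ hδ0.le _ h1)
      rwa [smul_inv_smul₀ hδ0.ne', add_sub_cancel] at h2
    · rw [Metric.mem_ball, dist_eq_norm]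
      rwa [← sub_sub, sub_right_comm]
  · have : ∀ᶠ w in 𝓝[Ioi (0 : ℝ) ×ˢ A] z', w ∈ Metric.closedBall z r₁ := by
      refine Filter.Eventually.filter_mono nhdsWithin_le_nhds ?_
      exact mem_of_superset (Metric.isOpen_ball.mem_nhds hdist) Metric.ball_subset_closedBall
    filter_upwards [this, self_mem_nhdsWithin] with w hw1 hw2
    exact hz'max ⟨hw1, le_of_lt (mem_Ioi.1 hw2.1), hw2.2⟩
  -- For `k ∈ A` the point `P _ + k` is again in the cone, so the variational inequality makes the
  -- projection residual pair nonpositively with `k`.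
  · intro k hk
    have h1 := hP' (z'.2 - δ • e) _ (hA.add_mem _ (hP (z'.2 - δ • e)) _ hk)
    rw [add_sub_cancel_left] at h1
    have h2 : g z' + (2 : ℝ) • (z'.2 - z.2) - (g z' + ((2 : ℝ) • (z'.2 - z.2) +
        B • (2 : ℝ) • (z'.2 - δ • e - P (z'.2 - δ • e)))) =
        -(B • (2 : ℝ) • (z'.2 - δ • e - P (z'.2 - δ • e))) := by abel
    rw [h2, inner_neg_left, real_inner_smul_left, real_inner_smul_left]
    nlinarith

/-- A subsolution on a cone satisfies, even at boundary points, the subsolution inequality with an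
element `Q` of any compact set `S` containing its gradients at interior points, and `Q` lies below
the gradient of the test function. -/
theorem IsSolidCone.exists_grad_le [ProperSpace E] {A : Set E} (hA : IsSolidCone A)
    {H : E → ℝ} (hH : Continuous H) {u : ℝ → E → ℝ} (hu : IsViscositySubsolution A H u)
    {S : Set E} (hS : IsCompact S)
    (hgrad : ∀ t, 0 < t → ∀ x ∈ interior A,
      ∀ (φ : ℝ × E → ℝ) (a : ℝ × E → ℝ) (g : ℝ × E → E), IsSmoothTest A φ a g →
      IsLocalMaxOn (fun w : ℝ × E => u w.1 w.2 - φ w) (Ioi (0 : ℝ) ×ˢ A) (t, x) → g (t, x) ∈ S)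
    {z : ℝ × E} (hz : z ∈ Ioi (0 : ℝ) ×ˢ A) {φ : ℝ × E → ℝ} {a : ℝ × E → ℝ} {g : ℝ × E → E}
    (hφ : IsSmoothTest A φ a g)
    (hmax : IsLocalMaxOn (fun w : ℝ × E => u w.1 w.2 - φ w) (Ioi (0 : ℝ) ×ˢ A) z) :
    ∃ Q ∈ S, g z - Q ∈ dualCone A ∧ a z ≤ H Q := by
  have step : ∀ n : ℕ, ∃ z' : ℝ × E, ∃ Q : E, z' ∈ Ioi (0 : ℝ) ×ˢ A ∧
      dist z' z < 1 / ((n : ℝ) + 1) ∧ Q ∈ S ∧ a z' + 2 * (z'.1 - z.1) ≤ H Q ∧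
      g z' + (2 : ℝ) • (z'.2 - z.2) - Q ∈ dualCone A := by
    intro n
    obtain ⟨z', h1, h2, h3, φ', a', g', h4, h5, h6, h7⟩ :=
      hA.exists_interior_touching hu.1 hz hφ hmax (Nat.one_div_pos_of_nat (n := n) (α := ℝ))
    refine ⟨z', g' z', ⟨h1, interior_subset h2⟩, h3, hgrad _ h1 _ h2 _ _ _ h4 h5, ?_, h7⟩
    rw [← h6]
    linarith [hu.2 z' ⟨h1, interior_subset h2⟩ φ' a' g' h4 h5]
  choose w Q hw1 hw2 hQ h1 h2 using step
  obtain ⟨Q₀, hQ₀, θ, hθ, hlim⟩ := hS.tendsto_subseq hQ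
  have hwz : Tendsto w atTop (𝓝 z) := by
    refine tendsto_iff_dist_tendsto_zero.2 ?_
    exact squeeze_zero (fun _ => dist_nonneg) (fun n => (hw2 n).le)
      tendsto_one_div_add_atTop_nhds_zero_nat
  have hwz' : Tendsto (w ∘ θ) atTop (𝓝 z) := hwz.comp hθ.tendsto_atTop
  have hwz'' : Tendsto (w ∘ θ) atTop (𝓝[Ioi (0 : ℝ) ×ˢ A] z) :=
    tendsto_nhdsWithin_iff.2 ⟨hwz', Eventually.of_forall fun n => hw1 _⟩
  have ha := (hφ.continuousOn_time z hz).tendsto.comp hwz''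
  have hg := (hφ.continuousOn_grad z hz).tendsto.comp hwz''
  have hfst : Tendsto (fun n => 2 * ((w (θ n)).1 - z.1)) atTop (𝓝 0) := by
    have : Continuous (fun w : ℝ × E => 2 * (w.1 - z.1)) := by fun_prop
    have := (this.tendsto z).comp hwz'
    simp only [sub_self, mul_zero] at this
    exact this
  have hsnd : Tendsto (fun n => (2 : ℝ) • ((w (θ n)).2 - z.2)) atTop (𝓝 0) := by
    have : Continuous (fun w : ℝ × E => (2 : ℝ) • (w.2 - z.2)) := by fun_prop
    have := (this.tendsto z).comp hwz'
    simp only [sub_self, smul_zero] at this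
    exact this
  refine ⟨Q₀, hQ₀, ?_, ?_⟩
  · have := (hg.add hsnd).sub hlim
    rw [add_zero] at this
    exact (isClosed_dualCone A).mem_of_tendsto this (Eventually.of_forall fun n => h2 _)
  · have := ha.add hfst
    rw [add_zero] at this
    exact le_of_tendsto_of_tendsto' this ((hH.tendsto Q₀).comp hlim) fun n => h1 _

end Boundary

/-! ### Duality between sub- and supersolutions -/

section Duality

variable {E : Type*} [NormedAddCommGroup E] [InnerProductSpace ℝ E]

/-- Passing to `-f` replaces `H` by `q ↦ -H (-q)`, an operation which preserves monotonicity along a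
cone. Lower bounds thereby become upper bounds for the opposite problem. -/
theorem IsViscositySupersolution.neg {A : Set E} {H : E → ℝ} {f : ℝ → E → ℝ}
    (hf : IsViscositySupersolution A H f) :
    IsViscositySubsolution A (fun q => -H (-q)) (fun t x => -f t x) := by
  refine ⟨hf.1.neg, fun z hz φ a g hφ hmax => ?_⟩
  have := hf.2 z hz _ _ _ hφ.neg (by
    filter_upwards [hmax] with w hw
    linarith)
  linarith

theorem IsViscositySubsolution.neg {A : Set E} {H : E → ℝ} {f : ℝ → E → ℝ}
    (hf : IsViscositySubsolution A H f) :
    IsViscositySupersolution A (fun q => -H (-q)) (fun t x => -f t x) := by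
  refine ⟨hf.1.neg, fun z hz φ a g hφ hmin => ?_⟩
  have := hf.2 z hz _ _ _ hφ.neg (by
    filter_upwards [hmin] with w hw
    linarith)
  linarith

theorem IsViscositySolution.neg {A : Set E} {H : E → ℝ} {f : ℝ → E → ℝ}
    (hf : IsViscositySolution A H f) :
    IsViscositySolution A (fun q => -H (-q)) (fun t x => -f t x) :=
  ⟨hf.2.neg, hf.1.neg⟩

end Duality

/-! ### Comparison results on cones -/

section Comparison

variable {E : Type*} [NormedAddCommGroup E] [InnerProductSpace ℝ E]
  {E' : Type*} [NormedAddCommGroup E'] [InnerProductSpace ℝ E']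

theorem continuous_sqrt_add_norm_sq {V : Type*} [NormedAddCommGroup V] (δ : ℝ) :
    Continuous fun x : V => √(δ + ‖x‖ ^ 2) := by
  fun_prop

/-- `N` is a uniform limit of functions with quadratic expansions and bounded gradients lying
above it. -/
def IsSmoothable (N : E → ℝ) : Prop :=
  ∀ δ > 0, ∃ (ρ : E → ℝ) (g : E → E) (R : ℝ), HasQuadraticExpansion ρ g ∧ Continuous ρ ∧
    (∀ x, N x ≤ ρ x) ∧ (∀ x, ρ x ≤ N x + δ) ∧ ∀ x, ‖g x‖ ≤ R

/-- Estimates of the increments of the initial condition by a smoothable function propagate. -/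
theorem IsViscositySolution.sub_le_of_initial [ProperSpace E] {A : Set E} (hA : IsClosed A)
    {H : E → ℝ} (hH : Continuous H) {f : ℝ → E → ℝ} (hf : IsViscositySolution A H f)
    {N : E → ℝ} (hN : IsSmoothable N) {M M' : ℝ} (hM : 0 ≤ M) (hM' : 0 ≤ M')
    (hinit : ∀ x ∈ A, ∀ y ∈ A, f 0 x - f 0 y ≤ N (x - y))
    (hup : ∀ t, 0 ≤ t → ∀ x ∈ A, f t x ≤ f 0 x + M * t)
    (hlow : ∀ t, 0 ≤ t → ∀ x ∈ A, f 0 x - M' * t ≤ f t x)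
    {t h : ℝ} (ht : 0 ≤ t) (hh : 0 ≤ h) {x y : E} (hx : x ∈ A) (hy : y ∈ A) :
    f (t + h) x - f t y ≤ N (x - y) + M * h := by
  have main : ∀ δ > 0, f (t + h) x - f t y ≤
      N (x - y) + M * h + δ * (1 + (1 + ‖x - y‖) + (1 + ‖x‖) + t) := by
    intro δ hδ
    obtain ⟨ρ, g, R, hρ, hρc, hNρ, hρN, hgR⟩ := hN δ hδ
    have huc := (isCompact_closedBall (0 : E) (R + 2)).uniformContinuousOn_of_continuous
      hH.continuousOn
    obtain ⟨c₀, hc₀, hcH⟩ := Metric.uniformContinuousOn_iff.1 huc δ hδ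
    -- Below `c₀`, so that `H` varies by less than `δ`; at most `1`, so that the gradients stay in
    -- the ball of radius `R + 2`; at most `δ`, so that the extra penalties vanish in the limit.
    set c := min (min (c₀ / 2) 1) δ with hc
    have hc0 : 0 < c := by positivity
    have hc1 : c ≤ 1 := (min_le_left _ _).trans (min_le_right _ _)
    have hcδ : c ≤ δ := min_le_right _ _
    have hcc : c < c₀ := ((min_le_left _ _).trans (min_le_left _ _)).trans_lt (by linarith)
    set σ : E → ℝ := fun z => √(1 + ‖z‖ ^ 2) with hσ
    set s : E → E := fun z => (√(1 + ‖z‖ ^ 2))⁻¹ • z with hs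
    have hσs : HasQuadraticExpansion σ s := .sqrt_add_norm_sq one_pos
    have hs1 : ∀ z, ‖s z‖ ≤ 1 := norm_inv_sqrt_smul_le one_pos
    have hσc : Continuous σ := continuous_sqrt_add_norm_sq 1
    have hσ1 : ∀ z, ‖z‖ ≤ σ z := norm_le_sqrt_add zero_le_one
    have hσ2 : ∀ z, σ z ≤ 1 + ‖z‖ := fun z => by
      simpa using sqrt_add_le_norm_add zero_le_one z
    -- The two terms with `c` make the penalty coercive in both variables. Only `c * σ x` makes the
    -- two gradients differ, by a vector of norm at most `c`.
    have key := doubling_of_variables (Φ := fun x y => ρ (x - y) + c * σ (x - y) + c * σ x)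
      (G := fun x y => g (x - y) + c • s (x - y) + c • s x)
      (G' := fun x y => g (x - y) + c • s (x - y)) (c := c / 2) (γ := δ)
      (P := fun a q => a ≤ H q) (P' := fun a q => H q ≤ a) hA hA hf.1.1 hf.2.1
      (fun y => ((hρ.comp_sub_const y).add ((hσs.comp_sub_const y).const_mul c)).add
        (hσs.const_mul c))
      (fun x => by
        have h1 : HasQuadraticExpansion (fun y : E => ρ (x - y) + c * σ (x - y))
            (fun y => -(g (x - y) + c • s (x - y))) := by
          refine ((hρ.add (hσs.const_mul c)).comp_affine (-ContinuousLinearMap.id ℝ E)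
            (fun v => -v) (by simp) x).congr (fun y => ?_) (fun y => ?_) <;>
            simp [neg_add_eq_sub]
        refine (h1.neg.add (HasQuadraticExpansion.const (-(c * σ x)))).congr
          (fun y => ?_) (fun y => ?_)
        · ring
        · simp)
      (by fun_prop) (by positivity) hM hM' hδ.le hh
      (fun x hx y hy => by
        have h1 := (hinit x hx y hy).trans (hNρ _)
        have h2 : ‖y‖ ≤ ‖x‖ + ‖x - y‖ := by
          have := norm_sub_norm_le y x
          rw [norm_sub_rev] at this
          linarith
        have h3 := mul_le_mul_of_nonneg_left (hσ1 x) hc0.le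
        have h4 := mul_le_mul_of_nonneg_left (hσ1 (x - y)) hc0.le
        have h5 := mul_le_mul_of_nonneg_left h2 hc0.le
        have h6 := mul_nonneg hc0.le (norm_nonneg (x - y))
        linarith)
      hup hlow
      (fun z hz φ a g hφ hmax => by linarith [hf.1.2 z hz φ a g hφ hmax])
      (fun z hz φ a g hφ hmin => by linarith [hf.2.2 z hz φ a g hφ hmin])
      (fun x _ y _ a a' h1 h2 => by
        have n1 : ‖c • s (x - y)‖ ≤ 1 := by
          rw [norm_smul, Real.norm_eq_abs, abs_of_pos hc0]
          nlinarith [hs1 (x - y), norm_nonneg (s (x - y))]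
        have n2 : ‖c • s x‖ ≤ c := by
          rw [norm_smul, Real.norm_eq_abs, abs_of_pos hc0]
          nlinarith [hs1 x, norm_nonneg (s x)]
        have n3 := hgR (x - y)
        have n4 := norm_add_le (g (x - y)) (c • s (x - y))
        have n5 := norm_add_le (g (x - y) + c • s (x - y)) (c • s x)
        have := hcH (g (x - y) + c • s (x - y) + c • s x)
          (by rw [mem_closedBall_zero_iff]; linarith) (g (x - y) + c • s (x - y))
          (by rw [mem_closedBall_zero_iff]; linarith)
          (by rw [dist_self_add_left]; linarith)
        rw [Real.dist_eq] at this
        linarith [(abs_lt.1 this).2])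
      ht hx hy
    have h1 := hρN (x - y)
    have h2 : c * σ (x - y) ≤ δ * (1 + ‖x - y‖) :=
      mul_le_mul hcδ (hσ2 _) (by positivity) hδ.le
    have h3 : c * σ x ≤ δ * (1 + ‖x‖) := mul_le_mul hcδ (hσ2 _) (by positivity) hδ.le
    linarith
  have lim : Tendsto (fun δ : ℝ => N (x - y) + M * h + δ * (1 + (1 + ‖x - y‖) + (1 + ‖x‖) + t))
      (𝓝[>] 0) (𝓝 (N (x - y) + M * h)) := by
    have : Continuous (fun δ : ℝ =>
      N (x - y) + M * h + δ * (1 + (1 + ‖x - y‖) + (1 + ‖x‖) + t)) := by fun_prop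
    have := this.tendsto 0
    simp only [zero_mul, add_zero] at this
    exact this.mono_left nhdsWithin_le_nhds
  exact ge_of_tendsto lim (by filter_upwards [self_mem_nhdsWithin] with δ hδ using main δ hδ)

/-- Comparison of a subsolution and a supersolution on two cones linked by a contraction `p` with
adjoint `e`. -/
theorem sub_le_of_initial_of_link [ProperSpace E] [ProperSpace E'] {A : Set E} {A' : Set E'}
    (hA : IsClosed A) (hA' : IsClosed A') {u : ℝ → E → ℝ} {v : ℝ → E' → ℝ}
    (hu : ContinuousOn (fun z : ℝ × E => u z.1 z.2) (Ici (0 : ℝ) ×ˢ A))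
    (hv : ContinuousOn (fun z : ℝ × E' => v z.1 z.2) (Ici (0 : ℝ) ×ˢ A'))
    (p : E' →L[ℝ] E) (e : E → E') (hpe : ∀ x y, inner ℝ (e x) y = inner ℝ x (p y))
    (hp : ∀ y, ‖p y‖ ≤ ‖y‖) (hpA : ∀ y ∈ A', p y ∈ A)
    {L κ Λ M M' : ℝ} (hL : 0 ≤ L) (hκ : 0 ≤ κ) (hΛ : 0 ≤ Λ) (hM : 0 ≤ M) (hM' : 0 ≤ M')
    (hinit : ∀ x ∈ A, ∀ y ∈ A', u 0 x - v 0 y ≤ L * ‖x - p y‖ + κ * ‖y‖)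
    (hut : ∀ t, 0 ≤ t → ∀ x ∈ A, u t x ≤ u 0 x + M * t)
    (hvt : ∀ t, 0 ≤ t → ∀ y ∈ A', v 0 y - M' * t ≤ v t y)
    {P : ℝ → E → Prop} {P' : ℝ → E' → Prop}
    (hP : ∀ z ∈ Ioi (0 : ℝ) ×ˢ A, ∀ (φ : ℝ × E → ℝ) (a : ℝ × E → ℝ) (g : ℝ × E → E),
      IsSmoothTest A φ a g →
      IsLocalMaxOn (fun w : ℝ × E => u w.1 w.2 - φ w) (Ioi (0 : ℝ) ×ˢ A) z → P (a z) (g z))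
    (hP' : ∀ z ∈ Ioi (0 : ℝ) ×ˢ A', ∀ (φ : ℝ × E' → ℝ) (a : ℝ × E' → ℝ) (g : ℝ × E' → E'),
      IsSmoothTest A' φ a g →
      IsLocalMinOn (fun w : ℝ × E' => v w.1 w.2 - φ w) (Ioi (0 : ℝ) ×ˢ A') z → P' (a z) (g z))
    {r : ℝ} (hκr : κ < r)
    (hPP : ∀ (g : E) (ρ : E') (b : ℝ), ‖ρ‖ ≤ b → b ≤ r → ∀ a a', P a g → P' a' (e g - ρ) →
      a ≤ a' + Λ * b)
    {t : ℝ} (ht : 0 ≤ t) {y : E'} (hy : y ∈ A') :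
    u t (p y) - v t y ≤ κ * ‖y‖ + Λ * κ * t := by
  have main : ∀ c > 0, κ + c ≤ r → u t (p y) - v t y ≤
      (L + c) * c + (κ + c) * (c + ‖y‖) + Λ * (κ + c) * t := by
    intro c hc hcr
    set σ : E → ℝ := fun z => √(c ^ 2 + ‖z‖ ^ 2) with hσ
    set s : E → E := fun z => (√(c ^ 2 + ‖z‖ ^ 2))⁻¹ • z with hs
    set σ' : E' → ℝ := fun z => √(c ^ 2 + ‖z‖ ^ 2) with hσ'
    set s' : E' → E' := fun z => (√(c ^ 2 + ‖z‖ ^ 2))⁻¹ • z with hs'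
    have hc2 : 0 < c ^ 2 := by positivity
    have hσs : HasQuadraticExpansion σ s := .sqrt_add_norm_sq hc2
    have hσs' : HasQuadraticExpansion σ' s' := .sqrt_add_norm_sq hc2
    have hσc : Continuous σ := continuous_sqrt_add_norm_sq _
    have hσc' : Continuous σ' := continuous_sqrt_add_norm_sq _
    have hs1 : ∀ z, ‖s' z‖ ≤ 1 := norm_inv_sqrt_smul_le hc2
    -- The adjoint `e` transports the gradient at `x` to the other cone, while the penalty in `y`
    -- contributes an error of norm at most `κ + c`. This error is what `hPP` has to absorb.
    have key := doubling_of_variables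
      (Φ := fun x y => (L + c) * σ (x - p y) + (κ + c) * σ' y)
      (G := fun x y => (L + c) • s (x - p y))
      (G' := fun x y => e ((L + c) • s (x - p y)) - (κ + c) • s' y)
      (c := c / 2) (γ := Λ * (κ + c)) (h := 0)
      (P := P) (P' := P') hA hA' hu hv
      (fun y => ((((hσs.const_mul (L + c)).comp_sub_const (p y)).add
        (HasQuadraticExpansion.const ((κ + c) * σ' y))).congr (fun x => rfl) (fun x => by simp)))
      (fun x => by
        have h1 : HasQuadraticExpansion (fun y : E' => (L + c) * σ (x - p y))
            (fun y => -e ((L + c) • s (x - p y))) := by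
          refine (((hσs.const_mul (L + c))).comp_affine (-p) (fun v => -e v)
            (by simp [hpe]) x).congr (fun y => ?_) (fun y => ?_) <;>
            simp [neg_add_eq_sub]
        refine (h1.add (hσs'.const_mul (κ + c))).neg.congr (fun y => rfl) (fun y => ?_)
        abel)
      (by fun_prop) (by positivity) hM hM' (by positivity) le_rfl
      (fun x hx y hy => by
        have h1 := hinit x hx y hy
        have h2 : ‖x‖ ≤ ‖y‖ + ‖x - p y‖ := by
          have := norm_sub_norm_le x (p y)
          linarith [hp y]
        have h3 := mul_le_mul_of_nonneg_left (norm_le_sqrt_add hc2.le (x - p y))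
          (by positivity : 0 ≤ L + c)
        have h4 := mul_le_mul_of_nonneg_left (norm_le_sqrt_add hc2.le y)
          (by positivity : 0 ≤ κ + c)
        have h5 := mul_le_mul_of_nonneg_left h2 hc.le
        have h6 := mul_nonneg hc.le (norm_nonneg (x - p y))
        simp only [hσ, hσ']
        linarith)
      hut hvt hP hP'
      (fun x _ y _ a a' h1 h2 => hPP _ _ _ (by
        rw [norm_smul, Real.norm_eq_abs, abs_of_pos (by positivity)]
        exact mul_le_of_le_one_right (by positivity) (hs1 y)) hcr a a' h1 h2)
      ht (hpA y hy) hy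
    have h1 : σ (p y - p y) = c := by simp [hσ, Real.sqrt_sq hc.le]
    have h2 : σ' y ≤ c + ‖y‖ := by
      simpa [Real.sqrt_sq hc.le] using sqrt_add_le_norm_add hc2.le y
    have h3 := mul_le_mul_of_nonneg_left h2 (by positivity : 0 ≤ κ + c)
    simp only [add_zero, mul_zero, h1] at key
    linarith
  have lim : Tendsto (fun c : ℝ => (L + c) * c + (κ + c) * (c + ‖y‖) + Λ * (κ + c) * t)
      (𝓝[>] 0) (𝓝 (κ * ‖y‖ + Λ * κ * t)) := by
    have : Continuous
      (fun c : ℝ => (L + c) * c + (κ + c) * (c + ‖y‖) + Λ * (κ + c) * t) := by fun_prop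
    have := this.tendsto 0
    simp only [mul_zero, zero_add, add_zero] at this
    exact this.mono_left nhdsWithin_le_nhds
  refine ge_of_tendsto lim ?_
  have : ∀ᶠ c in 𝓝[>] (0 : ℝ), c < r - κ :=
    (eventually_lt_nhds (by linarith)).filter_mono nhdsWithin_le_nhds
  filter_upwards [self_mem_nhdsWithin, this] with c h1 h2
  exact main c h1 (by linarith)

/-- If all test functions touching `f` from above have time derivative at most `M`, then
`f(t, ·) ≤ f(0, ·) + M t`. -/
theorem le_initial_add_mul [ProperSpace E] {A : Set E} (hA : IsClosed A) {f : ℝ → E → ℝ}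
    (hf : ContinuousOn (fun z : ℝ × E => f z.1 z.2) (Ici (0 : ℝ) ×ˢ A))
    {L M M₀ : ℝ} (hL : 0 ≤ L) (hM₀ : 0 ≤ M₀)
    (hinit : ∀ x ∈ A, ∀ y ∈ A, f 0 x - f 0 y ≤ L * ‖x - y‖)
    (hup : ∀ t, 0 ≤ t → ∀ x ∈ A, f t x ≤ f 0 x + M₀ * t)
    (htest : ∀ z ∈ Ioi (0 : ℝ) ×ˢ A, ∀ (φ : ℝ × E → ℝ) (a : ℝ × E → ℝ) (g : ℝ × E → E),
      IsSmoothTest A φ a g →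
      IsLocalMaxOn (fun w : ℝ × E => f w.1 w.2 - φ w) (Ioi (0 : ℝ) ×ˢ A) z → a z ≤ M)
    {t : ℝ} (ht : 0 ≤ t) {x : E} (hx : x ∈ A) : f t x ≤ f 0 x + M * t := by
  have hf0 : ContinuousOn (f 0) A :=
    hf.comp (f := fun x => ((0 : ℝ), x)) (by fun_prop) fun x hx => ⟨self_mem_Ici, hx⟩
  -- The barrier solves no equation: it only has to satisfy the predicate `M ≤ a`, which follows by
  -- testing at slightly earlier times.
  have key := sub_le_of_initial_of_link (u := f) (v := fun s y => f 0 y + M * s) (κ := 0) (Λ := 0)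
    (r := 1) (P := fun a _ => a ≤ M) (P' := fun a _ => M ≤ a) (M' := |M|) hA hA hf
    ((hf0.comp continuous_snd.continuousOn fun w hw => hw.2).add (by fun_prop))
    (ContinuousLinearMap.id ℝ E) id (by simp) (by simp) (by simp) hL le_rfl le_rfl hM₀
    (abs_nonneg M) (by simpa using hinit) hup
    (fun t ht y _ => by
      have := neg_abs_le M
      nlinarith)
    htest
    (by
      rintro ⟨s, y⟩ ⟨hs, hy⟩ φ a g hφ hmin
      replace hs : 0 < s := hs
      have hcont : Continuous (fun ε : ℝ => ((s - ε, y) : ℝ × E)) := by fun_prop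
      have htend : Tendsto (fun ε : ℝ => ((s - ε, y) : ℝ × E)) (𝓝[>] 0)
          (𝓝[Ioi (0 : ℝ) ×ˢ A] (s, y)) := by
        refine tendsto_nhdsWithin_iff.2 ⟨?_, ?_⟩
        · have := hcont.tendsto 0
          simp only [sub_zero] at this
          exact this.mono_left nhdsWithin_le_nhds
        · filter_upwards [(eventually_lt_nhds hs).filter_mono nhdsWithin_le_nhds] with ε hε
          exact ⟨by simpa using hε, hy⟩
      obtain ⟨c, hc⟩ := (hφ.expansion (s, y) ⟨hs, hy⟩).bound
      have key : ∀ᶠ ε in 𝓝[>] (0 : ℝ), M - c * ε ≤ a (s, y) := by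
        filter_upwards [htend.eventually hc, htend.eventually hmin, self_mem_nhdsWithin]
          with ε h1 h2 h3
        replace h3 : 0 < ε := h3
        simp only [sub_self, inner_zero_right, norm_zero, sub_sub_cancel_left] at h1 h2
        norm_num at h1
        have h4 := (abs_le.1 h1).1
        have : ε * (M - c * ε) ≤ ε * a (s, y) := by nlinarith
        exact le_of_mul_le_mul_left this h3
      have lim : Tendsto (fun ε : ℝ => M - c * ε) (𝓝[>] 0) (𝓝 M) := by
        have : Continuous (fun ε : ℝ => M - c * ε) := by fun_prop
        have := this.tendsto 0
        simp only [mul_zero, sub_zero] at this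
        exact this.mono_left nhdsWithin_le_nhds
      exact le_of_tendsto lim key)
    zero_lt_one
    (fun g ρ b _ _ a a' h1 h2 => by linarith) ht hx
  simp only [ContinuousLinearMap.id_apply] at key
  linarith

end Comparison

/-! ### Symmetric matrices: testing positivity against rank one matrices -/

namespace SymMat

variable {D : ℕ}

theorem inner_eq_sum (a b : SymMat D) : inner ℝ a b = ∑ i, ∑ k,
    (a : EuclideanSpace ℝ (Fin D × Fin D)) (i, k) *
      (b : EuclideanSpace ℝ (Fin D × Fin D)) (i, k) := by
  rw [Submodule.coe_inner, PiLp.inner_apply, Fintype.sum_prod_type]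
  refine Finset.sum_congr rfl fun i _ => Finset.sum_congr rfl fun k _ => ?_
  rw [real_inner_comm]
  simp

theorem inner_smul_left' (c : ℝ) (a b : SymMat D) : inner ℝ (c • a) b = c * inner ℝ a b :=
  real_inner_smul_left a b c

theorem norm_smul' (c : ℝ) (a : SymMat D) : ‖c • a‖ = |c| * ‖a‖ :=
  norm_smul c a

/-- The rank one matrix `v vᵀ`. -/
def outer (v : Fin D → ℝ) : SymMat D :=
  ⟨WithLp.toLp 2 fun q => v q.1 * v q.2, fun i k => by simp [mul_comm]⟩

theorem outer_apply (v : Fin D → ℝ) (i k : Fin D) :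
    (outer v : EuclideanSpace ℝ (Fin D × Fin D)) (i, k) = v i * v k := rfl

theorem inner_outer (a : SymMat D) (v : Fin D → ℝ) :
    inner ℝ a (outer v) = v ⬝ᵥ (toMatrix a).mulVec v := by
  rw [inner_eq_sum]
  simp only [outer_apply, dotProduct, Matrix.mulVec, Finset.mul_sum, toMatrix, Matrix.of_apply]
  refine Finset.sum_congr rfl fun i _ => Finset.sum_congr rfl fun k _ => ?_
  ring

/-- Positivity becomes a family of linear inequalities, so closedness, sums and averages reduce to
scalar facts. -/
theorem isPSD_iff {a : SymMat D} : IsPSD a ↔ ∀ v, 0 ≤ inner ℝ a (outer v) := by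
  simp only [inner_outer]
  constructor
  · intro h v
    simpa using h.dotProduct_mulVec_nonneg v
  · intro h
    refine Matrix.PosSemidef.of_dotProduct_mulVec_nonneg ?_ fun v => by simpa using h v
    ext i k
    simpa [toMatrix, Matrix.conjTranspose] using a.2 k i

theorem isPSD_zero : IsPSD (0 : SymMat D) := isPSD_iff.2 fun v => by simp

theorem IsPSD.add {a b : SymMat D} (ha : IsPSD a) (hb : IsPSD b) : IsPSD (a + b) :=
  isPSD_iff.2 fun v => by
    rw [inner_add_left]; exact add_nonneg (isPSD_iff.1 ha v) (isPSD_iff.1 hb v)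

theorem IsPSD.smul {a : SymMat D} (ha : IsPSD a) {c : ℝ} (hc : 0 ≤ c) : IsPSD (c • a) :=
  isPSD_iff.2 fun v => by
    rw [inner_smul_left']; exact mul_nonneg hc (isPSD_iff.1 ha v)

theorem isClosed_isPSD : IsClosed {a : SymMat D | IsPSD a} := by
  have : {a : SymMat D | IsPSD a} = ⋂ v, {a | 0 ≤ inner ℝ a (outer v)} := by
    ext a; simp [isPSD_iff]
  rw [this]
  exact isClosed_iInter fun v => isClosed_le continuous_const (by fun_prop)

/-- The identity matrix. -/
def one : SymMat D :=
  ⟨WithLp.toLp 2 fun q => if q.1 = q.2 then 1 else 0, fun i k => by simp [eq_comm]⟩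

theorem inner_one_outer (v : Fin D → ℝ) : inner ℝ (one : SymMat D) (outer v) = ∑ i, v i ^ 2 := by
  rw [inner_eq_sum]
  simp [one, outer_apply, sq]

theorem norm_outer (v : Fin D → ℝ) : ‖outer v‖ = ∑ i, v i ^ 2 := by
  have h : ‖outer v‖ ^ 2 = (∑ i, v i ^ 2) ^ 2 := by
    rw [← real_inner_self_eq_norm_sq, inner_eq_sum, sq (∑ i, v i ^ 2), Finset.sum_mul_sum]
    refine Finset.sum_congr rfl fun i _ => Finset.sum_congr rfl fun k _ => ?_
    rw [outer_apply]
    ring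
  exact (sq_eq_sq₀ (norm_nonneg _) (Finset.sum_nonneg fun i _ => sq_nonneg _)).1 h

theorem isPSD_smul_one_add {c : ℝ} {b : SymMat D} (hb : ‖b‖ ≤ c) : IsPSD (c • one + b) := by
  refine isPSD_iff.2 fun v => ?_
  rw [inner_add_left, inner_smul_left', inner_one_outer, ← norm_outer]
  have := neg_le_of_abs_le (abs_real_inner_le_norm b (outer v))
  nlinarith [norm_nonneg (outer v)]

/-- The trace. -/
noncomputable def tr (a : SymMat D) : ℝ := inner ℝ a one

theorem tr_sub (a b : SymMat D) : tr (a - b) = tr a - tr b := inner_sub_left _ _ _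

theorem tr_le (a : SymMat D) : tr a ≤ ‖a‖ * ‖(one : SymMat D)‖ := real_inner_le_norm _ _

theorem tr_eq_sum (a : SymMat D) :
    tr a = ∑ i, (a : EuclideanSpace ℝ (Fin D × Fin D)) (i, i) := by
  rw [tr, inner_eq_sum]
  simp [one]

theorem IsPSD.diag_nonneg {a : SymMat D} (ha : IsPSD a) (i : Fin D) :
    0 ≤ (a : EuclideanSpace ℝ (Fin D × Fin D)) (i, i) := by
  have := isPSD_iff.1 ha (Pi.single i 1)
  rw [inner_eq_sum] at this
  simpa [outer_apply, Pi.single_apply] using this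

theorem IsPSD.tr_nonneg {a : SymMat D} (ha : IsPSD a) : 0 ≤ tr a := by
  rw [tr_eq_sum]
  exact Finset.sum_nonneg fun i _ => ha.diag_nonneg i

/-- Off the diagonal, testing against `e_i ± e_k` gives `2 |a_ik| ≤ a_ii + a_kk`. -/
theorem IsPSD.abs_apply_le {a : SymMat D} (ha : IsPSD a) (i k : Fin D) :
    |(a : EuclideanSpace ℝ (Fin D × Fin D)) (i, k)| ≤ tr a := by
  have hd : ∀ l, (a : EuclideanSpace ℝ (Fin D × Fin D)) (l, l) ≤ tr a := fun l => by
    rw [tr_eq_sum]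
    exact Finset.single_le_sum (fun i _ => ha.diag_nonneg i) (Finset.mem_univ l)
  rcases eq_or_ne i k with rfl | hik
  · rw [abs_of_nonneg (ha.diag_nonneg i)]; exact hd i
  have key : ∀ σ : ℝ, 0 ≤ (a : EuclideanSpace ℝ (Fin D × Fin D)) (i, i) +
      σ ^ 2 * (a : EuclideanSpace ℝ (Fin D × Fin D)) (k, k) +
      2 * σ * (a : EuclideanSpace ℝ (Fin D × Fin D)) (i, k) := by
    intro σ
    have := isPSD_iff.1 ha (Pi.single i 1 + Pi.single k σ)
    rw [inner_outer] at this
    simp only [Matrix.mulVec_add, add_dotProduct, dotProduct_add, Matrix.mulVec_single,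
      single_dotProduct, MulOpposite.op_one, one_smul, one_mul] at this
    simp [toMatrix] at this
    rw [← a.2 i k] at this
    linarith
  have h1 := key 1
  have h2 := key (-1)
  rw [abs_le]
  constructor <;> nlinarith [hd i, hd k]

/-- On the positive cone the norm is dominated by a linear functional. This is what lets the
oscillation of an increasing path over consecutive cells telescope. -/
theorem IsPSD.norm_le {a : SymMat D} (ha : IsPSD a) : ‖a‖ ≤ D * tr a := by
  have h : ‖a‖ ^ 2 ≤ (D * tr a) ^ 2 := by
    rw [← real_inner_self_eq_norm_sq, inner_eq_sum]
    calc _ ≤ ∑ _i : Fin D, ∑ _k : Fin D, tr a ^ 2 := by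
          refine Finset.sum_le_sum fun i _ => Finset.sum_le_sum fun k _ => ?_
          rw [← sq]
          exact sq_le_sq' (neg_le_of_abs_le (ha.abs_apply_le i k)) (le_of_abs_le (ha.abs_apply_le i k))
      _ = (D * tr a) ^ 2 := by simp; ring
  exact le_of_sq_le_sq h (by have := ha.tr_nonneg; positivity)

end SymMat

/-! ### Cells of a partition -/

namespace UnitPartition

theorem n_pos (j : UnitPartition) : 0 < j.n := by
  rcases Nat.eq_zero_or_pos j.n with h | h
  · have : Fin.last j.n = 0 := by ext; simp [h]
    have h1 := j.one
    rw [this, j.zero] at h1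
    exact absurd h1 zero_ne_one
  · exact h

theorem measurableSet_cell (j : UnitPartition) (k : Fin j.n) : MeasurableSet (j.cell k) :=
  measurableSet_Ico

theorem t_mem (j : UnitPartition) (k : Fin (j.n + 1)) : j.t k ∈ Icc (0 : ℝ) 1 := by
  rw [← j.zero, ← j.one]
  exact ⟨j.strictMono.monotone (Fin.zero_le k), j.strictMono.monotone (Fin.le_last k)⟩

theorem cell_subset (j : UnitPartition) (k : Fin j.n) : j.cell k ⊆ Ico (0 : ℝ) 1 :=
  fun _ hs => ⟨(j.t_mem _).1.trans hs.1, hs.2.trans_le (j.t_mem _).2⟩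

theorem t_castSucc_mem (j : UnitPartition) (k : Fin j.n) : j.t k.castSucc ∈ j.cell k :=
  ⟨le_rfl, j.strictMono Fin.castSucc_lt_succ⟩

theorem exists_mem_cell (j : UnitPartition) {s : ℝ} (hs : s ∈ Ico (0 : ℝ) 1) :
    ∃ k, s ∈ j.cell k := by
  obtain ⟨i, hi, hmin⟩ := wellFounded_lt.has_min {i : Fin (j.n + 1) | s < j.t i}
    ⟨Fin.last _, by simpa [j.one] using hs.2⟩
  have h0 : i ≠ 0 := by
    rintro rfl
    have : s < j.t 0 := hi
    rw [j.zero] at this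
    exact absurd hs.1 (not_le.2 this)
  obtain ⟨k, rfl⟩ := Fin.exists_succ_eq.2 h0
  exact ⟨k, not_lt.1 fun h => hmin k.castSucc h Fin.castSucc_lt_succ, hi⟩

theorem exists_mem_Ioc (j : UnitPartition) {s : ℝ} (hs : s ∈ Ioc (0 : ℝ) 1) :
    ∃ k : Fin j.n, s ∈ Ioc (j.t k.castSucc) (j.t k.succ) := by
  obtain ⟨i, hi, hmin⟩ := wellFounded_lt.has_min {i : Fin (j.n + 1) | s ≤ j.t i}
    ⟨Fin.last _, by simpa [j.one] using hs.2⟩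
  have h0 : i ≠ 0 := by
    rintro rfl
    have : s ≤ j.t 0 := hi
    rw [j.zero] at this
    exact absurd hs.1 (not_lt.2 this)
  obtain ⟨k, rfl⟩ := Fin.exists_succ_eq.2 h0
  exact ⟨k, not_le.1 fun h => hmin k.castSucc h Fin.castSucc_lt_succ, hi⟩

theorem le_of_mem_cell (j : UnitPartition) {s s' : ℝ} (h : s ≤ s') {k l : Fin j.n}
    (hk : s ∈ j.cell k) (hl : s' ∈ j.cell l) : k ≤ l := by
  by_contra hlt
  rw [not_le] at hlt
  have : j.t l.succ ≤ j.t k.castSucc := j.strictMono.monotone (Fin.succ_le_castSucc_iff.2 hlt)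
  linarith [hk.1, hl.2]

theorem eq_of_mem_cell (j : UnitPartition) {s : ℝ} {k l : Fin j.n}
    (hk : s ∈ j.cell k) (hl : s ∈ j.cell l) : k = l :=
  le_antisymm (j.le_of_mem_cell le_rfl hk hl) (j.le_of_mem_cell le_rfl hl hk)

theorem iUnion_cell (j : UnitPartition) : ⋃ k, j.cell k = Ico (0 : ℝ) 1 :=
  Subset.antisymm (iUnion_subset j.cell_subset) fun _ hs => mem_iUnion.2 (j.exists_mem_cell hs)

theorem pairwise_disjoint_cell (j : UnitPartition) : Pairwise (Function.onFun Disjoint j.cell) :=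
  fun _ _ hkl => Set.disjoint_left.2 fun _ hk hl => hkl (j.eq_of_mem_cell hk hl)

theorem restrict_cell (j : UnitPartition) (k : Fin j.n) :
    unitMeasure.restrict (j.cell k) = volume.restrict (j.cell k) := by
  rw [unitMeasure, Measure.restrict_restrict (j.measurableSet_cell k),
    inter_eq_left.2 (j.cell_subset k)]

theorem volume_cell (j : UnitPartition) (k : Fin j.n) :
    volume.real (j.cell k) = j.len k := by
  rw [cell, Real.volume_real_Ico_of_le (sub_nonneg.1 (j.len_pos k).le), len]

/-- Every cell of a refinement is contained in a cell. -/
theorem exists_cell_subset {j j' : UnitPartition} (h : j ≤ j') (m : Fin j'.n) :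
    ∃ k, j'.cell m ⊆ j.cell k := by
  obtain ⟨k, hk⟩ := j.exists_mem_cell (j'.cell_subset m (j'.t_castSucc_mem m))
  refine ⟨k, fun s hs => ⟨hk.1.trans hs.1, hs.2.trans_le ?_⟩⟩
  obtain ⟨i, hi⟩ := h ⟨k.succ, rfl⟩
  have h1 : m.castSucc < i := j'.strictMono.lt_iff_lt.1 (by rw [hi]; exact hk.2)
  rw [← hi]
  exact j'.strictMono.monotone (Fin.castSucc_lt_iff_succ_le.1 h1)

theorem n_le_of_le {j j' : UnitPartition} (h : j ≤ j') : j.n ≤ j'.n := by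
  have h1 : (range j.t).ncard ≤ (range j'.t).ncard := ncard_le_ncard h (finite_range _)
  rw [← image_univ, ← image_univ, ncard_image_of_injective _ j.strictMono.injective,
    ncard_image_of_injective _ j'.strictMono.injective, ncard_univ, ncard_univ] at h1
  simpa using h1

theorem IsUniform.len_eq {j : UnitPartition} (h : j.IsUniform) (k : Fin j.n) :
    j.len k = (j.n : ℝ)⁻¹ := by
  rw [len, h, h]
  simp
  ring

end UnitPartition

/-! ### The step spaces and their cones -/

namespace StepSpace

variable {D : ℕ} {j : UnitPartition}

instance : FiniteDimensional ℝ (StepSpace D j) :=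
  inferInstanceAs (FiniteDimensional ℝ (Fin j.n → SymMat D))

instance : ProperSpace (StepSpace D j) := FiniteDimensional.proper_real _

theorem inner_def (x y : StepSpace D j) :
    inner ℝ x y = ∑ k, j.len k * inner ℝ (x.coord k) (y.coord k) := rfl

theorem norm_sq_eq (x : StepSpace D j) : ‖x‖ ^ 2 = ∑ k, j.len k * ‖x.coord k‖ ^ 2 := by
  rw [← real_inner_self_eq_norm_sq, inner_def]
  simp only [real_inner_self_eq_norm_sq]

theorem coord_zero (k : Fin j.n) : (0 : StepSpace D j).coord k = 0 := rfl

/-- The coordinate maps. -/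
def coordₗ (D : ℕ) {j : UnitPartition} (k : Fin j.n) : StepSpace D j →ₗ[ℝ] SymMat D where
  toFun x := x.coord k
  map_add' _ _ := rfl
  map_smul' _ _ := rfl

theorem continuous_coord (k : Fin j.n) : Continuous fun x : StepSpace D j => x.coord k :=
  (coordₗ D k).continuous_of_finiteDimensional

/-- The element of the step space supported on one cell. -/
def single (k : Fin j.n) (a : SymMat D) : StepSpace D j := Pi.single (M := fun _ => SymMat D) k a

theorem inner_single (x : StepSpace D j) (k : Fin j.n) (a : SymMat D) :
    inner ℝ x (single k a) = j.len k * inner ℝ (x.coord k) a := by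
  rw [inner_def, Finset.sum_eq_single k]
  · have : (single k a : StepSpace D j).coord k = a :=
      Pi.single_eq_same (M := fun _ => SymMat D) k a
    rw [this]
  · intro l _ hl
    have : (single k a : StepSpace D j).coord l = 0 :=
      Pi.single_eq_of_ne (M := fun _ => SymMat D) hl a
    rw [this, inner_zero_right, mul_zero]
  · exact fun h => absurd (Finset.mem_univ k) h

/-- The `L¹` norm on the step space. -/
noncomputable def normL1 (x : StepSpace D j) : ℝ := ∑ k, j.len k * ‖x.coord k‖

theorem sum_len (j : UnitPartition) : ∑ k, j.len k = 1 := by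
  have h : ∀ i : Fin (j.n + 1), j.t i = ∑ k : Fin j.n, if k.castSucc < i then j.len k else 0 := by
    intro i
    induction i using Fin.induction with
    | zero => simp [j.zero]
    | succ i ih =>
      have e : ∀ k : Fin j.n, (if k.castSucc < i.succ then j.len k else 0) =
          (if k.castSucc < i.castSucc then j.len k else 0) + if k = i then j.len k else 0 := by
        intro k
        rcases lt_trichotomy k i with h | h | h
        · simp [h.ne, h, h.le]
        · simp [h]
        · simp [h.not_ge, h.ne', h.not_gt]
      simp only [e, Finset.sum_add_distrib]
      rw [← ih]
      simp [UnitPartition.len]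
  have := h (Fin.last _)
  rw [j.one] at this
  simpa [Fin.castSucc_lt_last] using this.symm

/-- Replace each norm by `√(η + ‖·‖²)`, with `η` such that `(a + b) √η ≤ δ`. The weights of the
inner product cancel those of the `L¹` norm, so the gradient of the `L¹` part has coordinates in the
unit ball; the cell lengths sum to one, hence its norm is at most one. -/
theorem isSmoothable_norms {a b : ℝ} (ha : 0 ≤ a) (hb : 0 ≤ b) :
    IsSmoothable fun x : StepSpace D j => a * normL1 x + b * ‖x‖ := by
  intro δ hδ
  set η := (δ / (a + b + 1)) ^ 2 with hη
  have hη0 : 0 < η := by positivity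
  have hsη : √η = δ / (a + b + 1) := Real.sqrt_sq (by positivity)
  set s : StepSpace D j → StepSpace D j := fun x =>
    (fun k => (√(η + ‖x.coord k‖ ^ 2))⁻¹ • x.coord k : Fin j.n → SymMat D) with hs
  have hcoord : ∀ x k, (s x).coord k = (√(η + ‖x.coord k‖ ^ 2))⁻¹ • x.coord k := fun _ _ => rfl
  have h1 : HasQuadraticExpansion
      (fun x : StepSpace D j => ∑ k, j.len k * √(η + ‖x.coord k‖ ^ 2)) s := by
    refine ⟨(√η)⁻¹, fun x w => ?_⟩
    rw [inner_def, ← Finset.sum_sub_distrib, ← Finset.sum_sub_distrib, norm_sq_eq, Finset.mul_sum]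
    refine (Finset.abs_sum_le_sum_abs _ _).trans (Finset.sum_le_sum fun k _ => ?_)
    rw [← mul_sub, ← mul_sub, abs_mul, abs_of_pos (j.len_pos k), mul_left_comm]
    exact mul_le_mul_of_nonneg_left
      (HasQuadraticExpansion.sqrt_add_norm_sq_bound hη0 (x.coord k) (w.coord k)) (j.len_pos k).le
  have h2 : HasQuadraticExpansion (fun x : StepSpace D j => √(η + ‖x‖ ^ 2))
      (fun x => (√(η + ‖x‖ ^ 2))⁻¹ • x) := .sqrt_add_norm_sq hη0
  refine ⟨_, _, a + b, (h1.const_mul a).add (h2.const_mul b), ?_, ?_, ?_, ?_⟩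
  · refine (continuous_const.mul (continuous_finsetSum _ fun k _ => continuous_const.mul
      ((continuous_sqrt_add_norm_sq η).comp (continuous_coord k)))).add (by fun_prop)
  · intro x
    refine add_le_add (mul_le_mul_of_nonneg_left (Finset.sum_le_sum fun k _ => ?_) ha)
      (mul_le_mul_of_nonneg_left (norm_le_sqrt_add hη0.le x) hb)
    exact mul_le_mul_of_nonneg_left (norm_le_sqrt_add hη0.le (x.coord k)) (j.len_pos k).le
  · intro x
    have e1 : ∑ k, j.len k * √(η + ‖x.coord k‖ ^ 2) ≤ √η + normL1 x := by
      calc _ ≤ ∑ k, (j.len k * √η + j.len k * ‖x.coord k‖) := by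
            refine Finset.sum_le_sum fun k _ => ?_
            rw [← mul_add]
            exact mul_le_mul_of_nonneg_left (sqrt_add_le_norm_add hη0.le _) (j.len_pos k).le
        _ = _ := by rw [Finset.sum_add_distrib, ← Finset.sum_mul, sum_len, one_mul]; rfl
    have e2 := sqrt_add_le_norm_add hη0.le x
    have e3 := mul_le_mul_of_nonneg_left e1 ha
    have e4 := mul_le_mul_of_nonneg_left e2 hb
    have e5 : (a + b) * √η ≤ δ := by
      rw [hsη, mul_div_assoc', div_le_iff₀ (by positivity)]
      nlinarith
    linarith
  · intro x
    have n1 : ‖s x‖ ≤ 1 := by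
      have : ‖s x‖ ^ 2 ≤ 1 ^ 2 := by
        rw [norm_sq_eq, one_pow, ← sum_len j]
        refine Finset.sum_le_sum fun k _ => mul_le_of_le_one_right (j.len_pos k).le ?_
        rw [hcoord]
        exact pow_le_one₀ (norm_nonneg _) (norm_inv_sqrt_smul_le hη0 (x.coord k))
      exact le_of_sq_le_sq this zero_le_one
    have n2 := norm_inv_sqrt_smul_le hη0 x
    refine (norm_add_le _ _).trans ?_
    rw [norm_smul, norm_smul _ ((√(η + ‖x‖ ^ 2))⁻¹ • x), Real.norm_eq_abs, Real.norm_eq_abs,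
      abs_of_nonneg ha, abs_of_nonneg hb]
    nlinarith

end StepSpace

section StepCone

variable {D : ℕ} {j : UnitPartition}

open StepSpace

theorem isSolidCone_stepCone (D : ℕ) (j : UnitPartition) : IsSolidCone (stepCone D j) where
  isClosed := by
    have : stepCone D j = (⋂ k, (fun x : StepSpace D j => x.coord k) ⁻¹' {a | SymMat.IsPSD a}) ∩
        ⋂ k, ⋂ l, ⋂ (_ : k ≤ l),
          (fun x : StepSpace D j => x.coord l - x.coord k) ⁻¹' {a | SymMat.IsPSD a} := by
      ext x; simp [stepCone]
    rw [this]
    refine (isClosed_iInter fun k => SymMat.isClosed_isPSD.preimage (continuous_coord k)).inter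
      (isClosed_iInter fun k => isClosed_iInter fun l => isClosed_iInter fun _ =>
        SymMat.isClosed_isPSD.preimage ((continuous_coord l).sub (continuous_coord k)))
  add_mem x hx y hy := by
    refine ⟨fun k => (hx.1 k).add (hy.1 k), fun k l hkl => ?_⟩
    rw [coord_add, coord_add, add_sub_add_comm]
    exact (hx.2 k l hkl).add (hy.2 k l hkl)
  smul_mem c hc x hx := by
    refine ⟨fun k => (hx.1 k).smul hc, fun k l hkl => ?_⟩
    rw [coord_smul, coord_smul, ← smul_sub]
    exact (hx.2 k l hkl).smul hc
  nonempty_interior := by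
    -- Coordinates and increments of this path dominate the identity, with room for perturbations of
    -- size `1 / 2` in each coordinate.
    set e : StepSpace D j :=
      (fun k => ((k : ℕ) + 1 : ℝ) • SymMat.one : Fin j.n → SymMat D) with he
    have hek : ∀ k, e.coord k = ((k : ℕ) + 1 : ℝ) • SymMat.one := fun _ => rfl
    refine ⟨e, mem_interior.2 ⟨⋂ k, {y | ‖y.coord k - e.coord k‖ < 1 / 2}, ?_, ?_, ?_⟩⟩
    · intro y hy
      have hy' : ∀ k, ‖y.coord k - e.coord k‖ < 1 / 2 := by simpa using hy
      refine ⟨fun k => ?_, fun k l hkl => ?_⟩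
      · have : y.coord k = ((k : ℕ) + 1 : ℝ) • SymMat.one + (y.coord k - e.coord k) := by
          rw [hek]; abel
        rw [this]
        refine SymMat.isPSD_smul_one_add ((hy' k).le.trans ?_)
        have : (0 : ℝ) ≤ (k : ℕ) := Nat.cast_nonneg _
        linarith
      · rcases hkl.eq_or_lt with rfl | hlt
        · rw [sub_self]; exact SymMat.isPSD_zero
        have : y.coord l - y.coord k = ((l : ℕ) - (k : ℕ) : ℝ) • SymMat.one +
            ((y.coord l - e.coord l) - (y.coord k - e.coord k)) := by
          rw [hek, hek]; module
        rw [this]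
        refine SymMat.isPSD_smul_one_add ((norm_sub_le _ _).trans ?_)
        have h1 : (k : ℕ) + 1 ≤ (l : ℕ) := hlt
        have h2 : ((k : ℕ) : ℝ) + 1 ≤ (l : ℕ) := by exact_mod_cast h1
        linarith [hy' k, hy' l]
    · exact isOpen_iInter_of_finite fun k =>
        isOpen_lt ((continuous_coord k).sub continuous_const).norm continuous_const
    · simp

/-- The cone is recovered from its dual. -/
theorem mem_stepCone_of_dual {q : StepSpace D j}
    (h : ∀ z ∈ dualCone (stepCone D j), 0 ≤ inner ℝ q z) : q ∈ stepCone D j := by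
  refine ⟨fun k => SymMat.isPSD_iff.2 fun v => ?_,
    fun k l hkl => SymMat.isPSD_iff.2 fun v => ?_⟩
  · have := h (single k (SymMat.outer v)) fun y hy => by
      rw [real_inner_comm, inner_single]
      exact mul_nonneg (j.len_pos k).le (SymMat.isPSD_iff.1 (hy.1 k) v)
    rw [inner_single] at this
    exact nonneg_of_mul_nonneg_right this (j.len_pos k)
  -- These dual vectors read off the increment between two cells; dividing by the lengths undoes the
  -- weights.
  · have key : ∀ y : StepSpace D j, inner ℝ y ((j.len l)⁻¹ • single l (SymMat.outer v) -
        (j.len k)⁻¹ • single k (SymMat.outer v)) =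
        inner ℝ (y.coord l - y.coord k) (SymMat.outer v) := by
      intro y
      rw [inner_sub_right, real_inner_smul_right, real_inner_smul_right, inner_single,
        inner_single, inner_sub_left, inv_mul_cancel_left₀ (j.len_pos l).ne',
        inv_mul_cancel_left₀ (j.len_pos k).ne']
    have := h _ fun y hy => by
      rw [real_inner_comm, key y]
      exact SymMat.isPSD_iff.1 (hy.2 k l hkl) v
    rwa [key] at this

end StepCone

/-! ### Lifts and projections -/

section LiftProj

variable {D : ℕ}

theorem pathLift_eq_sum (j : UnitPartition) (x : StepSpace D j) :
    pathLift j x = ∑ k, (indicatorConstLp 2 (j.measurableSet_cell k)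
      (measure_ne_top unitMeasure _) (x.coord k) : PathSpace D) := rfl

theorem pathLift_coeFn (j : UnitPartition) (x : StepSpace D j) :
    ⇑(pathLift j x) =ᵐ[unitMeasure] fun s => ∑ k, (j.cell k).indicator (fun _ => x.coord k) s := by
  have h1 : ⇑(pathLift j x) =ᵐ[unitMeasure] fun s => ∑ k, (indicatorConstLp 2
      (j.measurableSet_cell k) (measure_ne_top unitMeasure _) (x.coord k) : PathSpace D) s := by
    rw [pathLift_eq_sum]
    exact Lp.coeFn_fun_finsetSum _ _
  have h2 : ∀ᵐ s ∂unitMeasure, ∀ k : Fin j.n, (indicatorConstLp 2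
      (j.measurableSet_cell k) (measure_ne_top unitMeasure _) (x.coord k) : PathSpace D) s =
      (j.cell k).indicator (fun _ => x.coord k) s :=
    ae_all_iff.2 fun k => indicatorConstLp_coeFn
  filter_upwards [h1, h2] with s hs1 hs2
  rw [hs1]
  exact Finset.sum_congr rfl fun k _ => hs2 k

theorem sum_indicator_cell (j : UnitPartition) (x : StepSpace D j) {k : Fin j.n} {s : ℝ}
    (hs : s ∈ j.cell k) :
    ∑ l, (j.cell l).indicator (fun _ => x.coord l) s = x.coord k := by
  rw [Finset.sum_eq_single k]
  · rw [indicator_of_mem hs]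
  · exact fun l _ hl => indicator_of_notMem (fun h => hl (j.eq_of_mem_cell h hs)) _
  · exact fun h => absurd (Finset.mem_univ k) h

theorem ae_mem_unit : ∀ᵐ s ∂unitMeasure, s ∈ Ico (0 : ℝ) 1 := ae_restrict_mem measurableSet_Ico

/-- A lift is almost everywhere constant on the cells. -/
theorem pathLift_ae (j : UnitPartition) (x : StepSpace D j) :
    ∀ᵐ s ∂unitMeasure, ∀ k, s ∈ j.cell k → pathLift j x s = x.coord k := by
  filter_upwards [pathLift_coeFn j x] with s hs k hk
  rw [hs, sum_indicator_cell j x hk]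

theorem pathLift_add (j : UnitPartition) (x y : StepSpace D j) :
    pathLift j (x + y) = pathLift j x + pathLift j y := by
  rw [pathLift_eq_sum, pathLift_eq_sum, pathLift_eq_sum, ← Finset.sum_add_distrib]
  exact Finset.sum_congr rfl fun k _ => indicatorConstLp_add.symm

/-- Lift and projection are adjoint. Linearity and contractivity of the projection, and its
compatibility between levels, are deduced from this. -/
theorem inner_pathLift (j : UnitPartition) (x : StepSpace D j) (μ : PathSpace D) :
    inner ℝ (pathLift j x) μ = inner ℝ x (pathProj j μ) := by
  rw [pathLift_eq_sum, sum_inner (𝕜 := ℝ) (E := PathSpace D), StepSpace.inner_def]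
  refine Finset.sum_congr rfl fun k _ => ?_
  rw [L2.inner_indicatorConstLp_eq_inner_setIntegral]
  have : (pathProj j μ).coord k = (j.len k)⁻¹ • ∫ s in j.cell k, μ s := rfl
  have e := real_inner_smul_right (x.coord k) (∫ s in j.cell k, μ s) (j.len k)⁻¹
  have h : inner ℝ (x.coord k) ((pathProj j μ).coord k) =
      (j.len k)⁻¹ * inner ℝ (x.coord k) (∫ s in j.cell k, μ s) := e
  rw [h, mul_inv_cancel_left₀ (j.len_pos k).ne', j.restrict_cell]

theorem pathProj_add (j : UnitPartition) (μ ν : PathSpace D) :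
    pathProj j (μ + ν) = pathProj j μ + pathProj j ν := by
  refine ext_inner_left ℝ fun x => ?_
  rw [inner_add_right, ← inner_pathLift, ← inner_pathLift, ← inner_pathLift,
    inner_add_right (𝕜 := ℝ) (E := PathSpace D)]

theorem pathProj_smul (j : UnitPartition) (c : ℝ) (μ : PathSpace D) :
    pathProj j (c • μ) = c • pathProj j μ := by
  refine ext_inner_left ℝ fun x => ?_
  rw [real_inner_smul_right, ← inner_pathLift, ← inner_pathLift,
    real_inner_smul_right (F := PathSpace D)]

theorem pathLift_smul (j : UnitPartition) (c : ℝ) (x : StepSpace D j) :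
    pathLift j (c • x) = c • pathLift j x := by
  refine ext_inner_right ℝ fun μ => ?_
  rw [real_inner_smul_left (F := PathSpace D), inner_pathLift, inner_pathLift,
    real_inner_smul_left]

theorem pathProj_pathLift (j : UnitPartition) (x : StepSpace D j) :
    pathProj j (pathLift j x) = x := by
  funext k
  have h : ∀ᵐ s ∂(volume.restrict (j.cell k)), pathLift j x s = x.coord k := by
    rw [← j.restrict_cell]
    filter_upwards [ae_restrict_of_ae (pathLift_ae j x),
      ae_restrict_mem (j.measurableSet_cell k)] with s h1 h2 using h1 k h2
  change (j.len k)⁻¹ • ∫ s in j.cell k, pathLift j x s = x.coord k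
  rw [integral_congr_ae h, setIntegral_const, j.volume_cell]
  exact inv_smul_smul₀ (j.len_pos k).ne' _

/-- The lift as a linear isometry. -/
noncomputable def liftₗᵢ (D : ℕ) (j : UnitPartition) : StepSpace D j →ₗᵢ[ℝ] PathSpace D where
  toFun := pathLift j
  map_add' := pathLift_add j
  map_smul' := pathLift_smul j
  norm_map' x := by
    have h : ‖pathLift j x‖ ^ 2 = ‖x‖ ^ 2 := by
      rw [← real_inner_self_eq_norm_sq (F := PathSpace D), ← real_inner_self_eq_norm_sq x,
        inner_pathLift,
        pathProj_pathLift]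
    exact (sq_eq_sq₀ (norm_nonneg (pathLift j x)) (norm_nonneg x)).1 h

theorem norm_pathLift (j : UnitPartition) (x : StepSpace D j) : ‖pathLift j x‖ = ‖x‖ :=
  (liftₗᵢ D j).norm_map x

theorem pathLift_sub (j : UnitPartition) (x y : StepSpace D j) :
    pathLift j (x - y) = pathLift j x - pathLift j y := (liftₗᵢ D j).map_sub x y

theorem pathLift_neg (j : UnitPartition) (x : StepSpace D j) :
    pathLift j (-x) = -pathLift j x := (liftₗᵢ D j).map_neg x

theorem continuous_pathLift (j : UnitPartition) :
    Continuous (pathLift j : StepSpace D j → PathSpace D) := (liftₗᵢ D j).continuous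

theorem norm_pathProj_le (j : UnitPartition) (μ : PathSpace D) : ‖pathProj j μ‖ ≤ ‖μ‖ := by
  have h : ‖pathProj j μ‖ * ‖pathProj j μ‖ ≤ ‖pathProj j μ‖ * ‖μ‖ := by
    calc _ = inner ℝ (pathLift j (pathProj j μ)) μ := by
          rw [inner_pathLift, real_inner_self_eq_norm_mul_norm]
      _ ≤ ‖pathLift j (pathProj j μ)‖ * ‖μ‖ := real_inner_le_norm (F := PathSpace D) _ _
      _ = _ := by rw [norm_pathLift]
  rcases (norm_nonneg (pathProj j μ)).eq_or_lt with h0 | h0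
  · rw [← h0]; exact norm_nonneg μ
  · exact le_of_mul_le_mul_left h h0

/-- The projection as a linear map. -/
noncomputable def projₗ (D : ℕ) (j : UnitPartition) : PathSpace D →ₗ[ℝ] StepSpace D j where
  toFun := pathProj j
  map_add' := pathProj_add j
  map_smul' := pathProj_smul j

theorem pathProj_sub (j : UnitPartition) (μ ν : PathSpace D) :
    pathProj j (μ - ν) = pathProj j μ - pathProj j ν := (projₗ D j).map_sub μ ν

/-- The `L¹` norm of a path. -/
noncomputable def pathNormL1 (z : PathSpace D) : ℝ := ∫ s, ‖z s‖ ∂unitMeasure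

theorem integrable_path (z : PathSpace D) : Integrable z unitMeasure :=
  (Lp.memLp z).integrable one_le_two

theorem integral_unit_eq_sum (j : UnitPartition) {F : Type*} [NormedAddCommGroup F]
    [NormedSpace ℝ F] {f : ℝ → F} (hf : Integrable f unitMeasure) :
    ∫ s, f s ∂unitMeasure = ∑ k, ∫ s in j.cell k, f s := by
  have h := integral_iUnion_fintype (μ := unitMeasure) (f := f) j.measurableSet_cell
    j.pairwise_disjoint_cell fun k => hf.integrableOn
  rw [j.iUnion_cell, unitMeasure, Measure.restrict_restrict measurableSet_Ico, inter_self] at h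
  rw [unitMeasure, h]
  refine Finset.sum_congr rfl fun k _ => ?_
  rw [← j.restrict_cell]

theorem integrableOn_cell (j : UnitPartition) {F : Type*} [NormedAddCommGroup F]
    {f : ℝ → F} (hf : Integrable f unitMeasure) (k : Fin j.n) : IntegrableOn f (j.cell k) := by
  have := hf.integrableOn (s := j.cell k)
  rwa [IntegrableOn, j.restrict_cell] at this

theorem pathNormL1_pathLift (j : UnitPartition) (x : StepSpace D j) :
    pathNormL1 (pathLift j x) = StepSpace.normL1 x := by
  rw [pathNormL1, integral_unit_eq_sum j (integrable_path _).norm, StepSpace.normL1]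
  refine Finset.sum_congr rfl fun k _ => ?_
  have h : ∀ᵐ s ∂(volume.restrict (j.cell k)), ‖pathLift j x s‖ = ‖x.coord k‖ := by
    rw [← j.restrict_cell]
    filter_upwards [ae_restrict_of_ae (pathLift_ae j x),
      ae_restrict_mem (j.measurableSet_cell k)] with s h1 h2
    rw [h1 k h2]
  rw [integral_congr_ae h, setIntegral_const, j.volume_cell, smul_eq_mul]

theorem normL1_pathProj_le (j : UnitPartition) (z : PathSpace D) :
    StepSpace.normL1 (pathProj j z) ≤ pathNormL1 z := by
  rw [pathNormL1, integral_unit_eq_sum j (integrable_path _).norm, StepSpace.normL1]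
  refine Finset.sum_le_sum fun k _ => ?_
  have : (pathProj j z).coord k = (j.len k)⁻¹ • ∫ s in j.cell k, z s := rfl
  rw [this, SymMat.norm_smul', abs_of_pos (inv_pos.2 (j.len_pos k)),
    mul_inv_cancel_left₀ (j.len_pos k).ne']
  exact norm_integral_le_integral_norm _

/-- A coarse step path is also a step path for the refinement. Hence a gradient carried from level
`j` to level `j'` has the same lift. -/
theorem pathLift_eq_of_le {j j' : UnitPartition} (h : j ≤ j') (x : StepSpace D j) :
    pathLift j' (pathProj j' (pathLift j x)) = pathLift j x := by
  choose κ hκ using UnitPartition.exists_cell_subset h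
  set x' : StepSpace D j' := (fun m => x.coord (κ m) : Fin j'.n → SymMat D) with hx'
  have hx'c : ∀ m, x'.coord m = x.coord (κ m) := fun _ => rfl
  have e : pathLift j x = pathLift j' x' := by
    refine Lp.ext ?_
    filter_upwards [pathLift_ae j x, pathLift_ae j' x', ae_mem_unit] with s h1 h2 h3
    obtain ⟨m, hm⟩ := j'.exists_mem_cell h3
    rw [h2 m hm, hx'c, h1 _ (hκ m hm)]
  rw [e, pathProj_pathLift]

theorem pathProj_pathLift_pathProj {j j' : UnitPartition} (h : j ≤ j') (μ : PathSpace D) :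
    pathProj j (pathLift j' (pathProj j' μ)) = pathProj j μ := by
  refine ext_inner_left ℝ fun x => ?_
  rw [← inner_pathLift, real_inner_comm (F := PathSpace D), inner_pathLift, real_inner_comm,
    ← inner_pathLift, pathLift_eq_of_le h, inner_pathLift]

end LiftProj

/-! ### Increasing paths -/

section Cone

variable {D : ℕ}

open StepSpace

theorem pathLift_mem_pathCone {j : UnitPartition} {x : StepSpace D j} (hx : x ∈ stepCone D j) :
    pathLift j x ∈ pathCone D := by
  set m : ℝ → SymMat D := fun s => ∑ k, (j.cell k).indicator (fun _ => x.coord k) s with hm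
  have hcell : ∀ {k s}, s ∈ j.cell k → m s = x.coord k := fun hs => sum_indicator_cell j x hs
  refine ⟨m, fun s hs => ?_, fun s hs t ht hst => ?_, fun t ht => ?_, fun t ht => ?_,
    pathLift_coeFn j x⟩
  · obtain ⟨k, hk⟩ := j.exists_mem_cell hs
    rw [hcell hk]
    exact hx.1 k
  · obtain ⟨k, hk⟩ := j.exists_mem_cell hs
    obtain ⟨l, hl⟩ := j.exists_mem_cell ht
    rw [hcell hk, hcell hl]
    exact hx.2 k l (j.le_of_mem_cell hst hk hl)
  · obtain ⟨k, hk⟩ := j.exists_mem_cell ht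
    have : (fun _ => x.coord k) =ᶠ[𝓝[≥] t] m := by
      filter_upwards [Ico_mem_nhdsGE hk.2] with s hs
      exact (hcell ⟨hk.1.trans hs.1, hs.2⟩).symm
    exact (continuousWithinAt_const (b := x.coord k)).congr_of_eventuallyEq this.symm (hcell hk)
  · obtain ⟨k, hk⟩ := j.exists_mem_Ioc ⟨ht.1, ht.2.le⟩
    refine ⟨x.coord k, tendsto_const_nhds.congr' ?_⟩
    filter_upwards [Ico_mem_nhdsLT hk.1] with s hs
    exact (hcell ⟨hs.1, hs.2.trans_le hk.2⟩).symm

theorem inner_coord_pathProj (j : UnitPartition) (ι : PathSpace D) (k : Fin j.n) (a : SymMat D) :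
    inner ℝ ((pathProj j ι).coord k) a = (j.len k)⁻¹ * ∫ s in j.cell k, inner ℝ (ι s) a := by
  have h1 : (pathProj j ι).coord k = (j.len k)⁻¹ • ∫ s in j.cell k, ι s := rfl
  rw [h1, SymMat.inner_smul_left', real_inner_comm,
    ← integral_inner (integrableOn_cell j (integrable_path ι) k)]
  simp_rw [real_inner_comm a]

theorem integrableOn_const_cell (j : UnitPartition) (k : Fin j.n) {F : Type*}
    [NormedAddCommGroup F] (b : F) : IntegrableOn (fun _ : ℝ => b) (j.cell k) :=
  integrableOn_const (by simp [UnitPartition.cell])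

theorem integrableOn_inner_cell (j : UnitPartition) (ι : PathSpace D) (k : Fin j.n)
    (a : SymMat D) : IntegrableOn (fun s => inner ℝ (ι s) a) (j.cell k) :=
  Integrable.inner_const (𝕜 := ℝ) (integrableOn_cell j (integrable_path ι) k) a

theorem ae_cell_of_ae {j : UnitPartition} {q : ℝ → Prop} (h : ∀ᵐ s ∂unitMeasure, q s)
    (k : Fin j.n) : ∀ᵐ s ∂(volume.restrict (j.cell k)), q s := by
  rw [← j.restrict_cell]
  exact ae_restrict_of_ae h

theorem le_inner_coord_pathProj {j : UnitPartition} {ι : PathSpace D} {m : ℝ → SymMat D}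
    (hm : ⇑ι =ᵐ[unitMeasure] m) {k : Fin j.n} {a : SymMat D} {b : ℝ}
    (h : ∀ s ∈ j.cell k, b ≤ inner ℝ (m s) a) : b ≤ inner ℝ ((pathProj j ι).coord k) a := by
  rw [inner_coord_pathProj, ← div_eq_inv_mul, le_div_iff₀ (j.len_pos k), ← j.volume_cell,
    mul_comm, ← smul_eq_mul, ← setIntegral_const]
  refine setIntegral_mono_ae_restrict (integrableOn_const_cell j k b)
    (integrableOn_inner_cell j ι k a) ?_
  filter_upwards [ae_cell_of_ae hm k, ae_restrict_mem (j.measurableSet_cell k)] with s h1 h2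
  rw [h1]
  exact h s h2

theorem inner_coord_pathProj_le {j : UnitPartition} {ι : PathSpace D} {m : ℝ → SymMat D}
    (hm : ⇑ι =ᵐ[unitMeasure] m) {k : Fin j.n} {a : SymMat D} {b : ℝ}
    (h : ∀ s ∈ j.cell k, inner ℝ (m s) a ≤ b) : inner ℝ ((pathProj j ι).coord k) a ≤ b := by
  have := le_inner_coord_pathProj hm (a := -a) (b := -b) fun s hs => by
    rw [inner_neg_right]; exact neg_le_neg (h s hs)
  rw [inner_neg_right] at this
  exact neg_le_neg_iff.1 this

/-- Tested on a rank one matrix, the path becomes a scalar increasing function; its value at the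
left end of the later cell separates the averages over the two cells. -/
theorem pathProj_mem_stepCone (j : UnitPartition) {ι : PathSpace D} (hι : ι ∈ pathCone D) :
    pathProj j ι ∈ stepCone D j := by
  obtain ⟨m, hpos, hmono, -, -, hm⟩ := hι
  refine ⟨fun k => SymMat.isPSD_iff.2 fun v => ?_, fun k l hkl => SymMat.isPSD_iff.2 fun v => ?_⟩
  · exact le_inner_coord_pathProj hm fun s hs =>
      SymMat.isPSD_iff.1 (hpos s (j.cell_subset k hs)) v
  · rcases hkl.eq_or_lt with rfl | hlt
    · simp
    have hmv : ∀ s ∈ Ico (0 : ℝ) 1, ∀ t ∈ Ico (0 : ℝ) 1, s ≤ t →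
        inner ℝ (m s) (SymMat.outer v) ≤ inner ℝ (m t) (SymMat.outer v) := by
      intro s hs t ht hst
      have := SymMat.isPSD_iff.1 (hmono s hs t ht hst) v
      rw [inner_sub_left] at this
      linarith
    have hl := j.t_castSucc_mem l
    have hl' := j.cell_subset l hl
    rw [inner_sub_left, sub_nonneg]
    refine (inner_coord_pathProj_le hm (b := inner ℝ (m (j.t l.castSucc)) (SymMat.outer v))
      fun s hs => ?_).trans (le_inner_coord_pathProj hm fun s hs => ?_)
    · refine hmv s (j.cell_subset k hs) _ hl' (hs.2.le.trans ?_)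
      exact j.strictMono.monotone (Fin.succ_le_castSucc_iff.2 hlt)
    · exact hmv _ hl' s (j.cell_subset l hs) hs.1

/-- The projection maps one cone into the other, so its adjoint maps the dual cones the opposite
way. This lets the monotonicity of `H` act on gradients at level `j`. -/
theorem pathLift_mem_dualCone {j : UnitPartition} {z : StepSpace D j}
    (hz : z ∈ dualCone (stepCone D j)) : pathLift j z ∈ dualCone (pathCone D) := by
  intro μ hμ
  have := hz _ (pathProj_mem_stepCone j hμ)
  rwa [← inner_pathLift] at this

theorem integral_norm_sq_path (ι : PathSpace D) : ∫ s, ‖ι s‖ ^ 2 ∂unitMeasure = ‖ι‖ ^ 2 := by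
  rw [← real_inner_self_eq_norm_sq (F := PathSpace D), L2.inner_def]
  simp_rw [real_inner_self_eq_norm_sq]

theorem integrable_norm_sq_path (ι : PathSpace D) :
    Integrable (fun s => ‖ι s‖ ^ 2) unitMeasure := by
  have := L2.integrable_inner (𝕜 := ℝ) ι ι
  simpa only [real_inner_self_eq_norm_sq] using this

/-- The Cauchy-Schwarz inequality over a cell. -/
theorem setIntegral_cell_norm_le (j : UnitPartition) (ι : PathSpace D) (k : Fin j.n) :
    ∫ s in j.cell k, ‖ι s‖ ≤ √(j.len k) * ‖ι‖ := by
  set I := ∫ s in j.cell k, ‖ι s‖ with hI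
  have hI0 : 0 ≤ I := integral_nonneg fun s => norm_nonneg _
  have hlen := j.len_pos k
  have key : ∀ c : ℝ, 2 * c * I ≤ c ^ 2 * j.len k + ‖ι‖ ^ 2 := by
    intro c
    have h1 : ∫ s in j.cell k, 2 * c * ‖ι s‖ ≤ ∫ s in j.cell k, (c ^ 2 + ‖ι s‖ ^ 2) := by
      refine setIntegral_mono ((integrableOn_cell j (integrable_path ι).norm k).const_mul _)
        (IntegrableOn.add (integrableOn_const_cell j k _)
          (integrableOn_cell j (integrable_norm_sq_path ι) k)) fun s => ?_
      nlinarith [sq_nonneg (c - ‖ι s‖)]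
    have h2 : ∫ s in j.cell k, ‖ι s‖ ^ 2 ≤ ‖ι‖ ^ 2 := by
      rw [← integral_norm_sq_path, ← j.restrict_cell]
      exact setIntegral_le_integral (integrable_norm_sq_path ι)
        (Eventually.of_forall fun s => sq_nonneg _)
    rw [integral_const_mul, integral_add (integrableOn_const_cell j k _)
      (integrableOn_cell j (integrable_norm_sq_path ι) k), setIntegral_const, j.volume_cell,
      smul_eq_mul] at h1
    linarith
  have h := key (I / j.len k)
  have h3 : I ^ 2 ≤ (√(j.len k) * ‖ι‖) ^ 2 := by
    rw [mul_pow, Real.sq_sqrt hlen.le]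
    have e1 : 2 * (I / j.len k) * I = 2 * (I ^ 2 / j.len k) := by ring
    have e2 : (I / j.len k) ^ 2 * j.len k = I ^ 2 / j.len k := by field_simp
    rw [e1, e2] at h
    have : I ^ 2 / j.len k ≤ ‖ι‖ ^ 2 := by linarith
    rwa [div_le_iff₀' hlen] at this
  exact le_of_sq_le_sq h3 (by positivity)

/-- The constant in the `L¹` approximation estimate. -/
noncomputable def approxConst (D : ℕ) : ℝ := 2 * D * ‖(SymMat.one : SymMat D)‖ + 2

theorem approxConst_pos (D : ℕ) : 0 < approxConst D := by unfold approxConst; positivity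

/-- Increasing paths are approximated in `L¹` by their averages, with a rate. -/
theorem pathNormL1_sub_le {j : UnitPartition} (hj : j.IsUniform) {ι : PathSpace D}
    (hι : ι ∈ pathCone D) :
    pathNormL1 (ι - pathLift j (pathProj j ι)) ≤ approxConst D * (√(j.n : ℝ))⁻¹ * ‖ι‖ := by
  have hn : (0 : ℝ) < j.n := by exact_mod_cast j.n_pos
  obtain ⟨N, hN⟩ : ∃ N, j.n = N + 1 := ⟨j.n - 1, by have := j.n_pos; omega⟩
  set last : Fin j.n := ⟨N, by omega⟩ with hlast
  set I := ∫ s in j.cell last, ‖ι s‖ with hI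
  set x := pathProj j ι with hx
  have hxk : ∀ k, x.coord k = (j.len k)⁻¹ • ∫ s in j.cell k, ι s := fun _ => rfl
  have hsub : ∀ k, ∫ s in j.cell k, ‖(ι - pathLift j x) s‖ =
      ∫ s in j.cell k, ‖ι s - x.coord k‖ := by
    intro k
    refine integral_congr_ae ?_
    filter_upwards [ae_cell_of_ae (Lp.coeFn_sub ι (pathLift j x)) k,
      ae_cell_of_ae (pathLift_ae j x) k, ae_restrict_mem (j.measurableSet_cell k)] with s h1 h2 h3
    rw [h1, Pi.sub_apply, h2 k h3]
  -- The path may blow up at `1`, so no value at the right end bounds the last cell. Only its mass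
  -- `I` is used there, of order `n^(-1/2)` by Cauchy-Schwarz.
  have hlastle : ∫ s in j.cell last, ‖ι s - x.coord last‖ ≤ 2 * I := by
    have hint := integrableOn_cell j (integrable_path ι) last
    have hc := integrableOn_const_cell j last (x.coord last)
    have h1 : ∫ s in j.cell last, ‖ι s - x.coord last‖ ≤
        ∫ s in j.cell last, (‖ι s‖ + ‖x.coord last‖) :=
      setIntegral_mono (hint.sub hc).norm (hint.norm.add hc.norm) fun s => norm_sub_le _ _
    rw [integral_add hint.norm hc.norm, setIntegral_const, j.volume_cell, smul_eq_mul] at h1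
    have h2 : j.len last * ‖x.coord last‖ ≤ I := by
      rw [hxk, SymMat.norm_smul', abs_of_pos (inv_pos.2 (j.len_pos last)),
        mul_inv_cancel_left₀ (j.len_pos last).ne']
      exact norm_integral_le_integral_norm _
    linarith
  obtain ⟨m, hpos, hmono, -, -, hm⟩ := hι
  set τ : ℕ → ℝ := fun i => SymMat.tr (m ((i : ℝ) / j.n)) with hτ
  have htr : ∀ s ∈ Ico (0 : ℝ) 1, ∀ t ∈ Ico (0 : ℝ) 1, s ≤ t →
      SymMat.tr (m s) ≤ SymMat.tr (m t) := by
    intro s hs t ht hst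
    have := (hmono s hs t ht hst).tr_nonneg
    rw [SymMat.tr_sub] at this
    linarith
  have hpt : ∀ i : ℕ, i < j.n → (i : ℝ) / j.n ∈ Ico (0 : ℝ) 1 := fun i hi =>
    ⟨by positivity, (div_lt_one hn).2 (by exact_mod_cast hi)⟩
  have hcell : ∀ k : Fin j.n, j.cell k = Ico ((k : ℕ) / j.n : ℝ) (((k : ℕ) + 1 : ℕ) / j.n : ℝ) := by
    intro k
    rw [UnitPartition.cell, hj, hj]
    simp
  -- Both the path and its average dominate the value at the left end of the cell and have trace at
  -- most that at the right end, so their distance is controlled by the increment of `τ`.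
  have hinner : ∀ k : Fin j.n, (k : ℕ) + 1 < j.n →
      ∫ s in j.cell k, ‖ι s - x.coord k‖ ≤
        (j.n : ℝ)⁻¹ * (2 * D * (τ ((k : ℕ) + 1) - τ k)) := by
    intro k hk
    have hk0 := hpt k k.2
    have hk1 := hpt _ hk
    have hs0 : ∀ s ∈ j.cell k, ((k : ℕ) : ℝ) / j.n ≤ s ∧ s ≤ ((k : ℕ) + 1 : ℕ) / (j.n : ℝ) := by
      intro s hs
      rw [hcell] at hs
      exact ⟨hs.1, hs.2.le⟩
    have hpsd : SymMat.IsPSD (x.coord k - m ((k : ℕ) / j.n)) := by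
      refine SymMat.isPSD_iff.2 fun v => ?_
      rw [inner_sub_left, sub_nonneg]
      refine le_inner_coord_pathProj hm fun s hs => ?_
      have := SymMat.isPSD_iff.1 (hmono _ hk0 s (j.cell_subset k hs) (hs0 s hs).1) v
      rw [inner_sub_left] at this
      linarith
    have hxtr : SymMat.tr (x.coord k) ≤ τ ((k : ℕ) + 1) :=
      inner_coord_pathProj_le hm fun s hs =>
        htr s (j.cell_subset k hs) _ hk1 (hs0 s hs).2
    have hbound : ∀ s ∈ j.cell k, ‖m s - x.coord k‖ ≤ 2 * D * (τ ((k : ℕ) + 1) - τ k) := by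
      intro s hs
      have e : m s - x.coord k = (m s - m ((k : ℕ) / j.n)) - (x.coord k - m ((k : ℕ) / j.n)) := by
        abel
      have h1 := (hmono _ hk0 s (j.cell_subset k hs) (hs0 s hs).1).norm_le
      have h2 := hpsd.norm_le
      have h3 := htr s (j.cell_subset k hs) _ hk1 (hs0 s hs).2
      rw [SymMat.tr_sub] at h1 h2
      have hD : (0 : ℝ) ≤ D := Nat.cast_nonneg D
      have h4 := mul_le_mul_of_nonneg_left h3 hD
      have h5 := mul_le_mul_of_nonneg_left hxtr hD
      rw [e]
      refine (norm_sub_le _ _).trans ?_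
      simp only [hτ] at *
      linarith
    have h1 : ∫ s in j.cell k, ‖ι s - x.coord k‖ ≤
        ∫ s in j.cell k, 2 * D * (τ ((k : ℕ) + 1) - τ k) := by
      have hc := integrableOn_const_cell j k (x.coord k)
      refine setIntegral_mono_ae_restrict
        ((integrableOn_cell j (integrable_path ι) k).sub hc).norm
        (integrableOn_const_cell j k _) ?_
      filter_upwards [ae_cell_of_ae hm k, ae_restrict_mem (j.measurableSet_cell k)] with s h1 h2
      rw [h1]
      exact hbound s h2
    rwa [setIntegral_const, j.volume_cell, hj.len_eq, smul_eq_mul] at h1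
  -- The telescoped sum leaves the trace at the start of the last cell, which monotonicity bounds by
  -- the average over that cell.
  have hτN : (j.n : ℝ)⁻¹ * τ N ≤ ‖(SymMat.one : SymMat D)‖ * I := by
    have hN1 := hpt N (by omega)
    have hlow : τ N ≤ SymMat.tr (x.coord last) := by
      refine le_inner_coord_pathProj hm fun s hs => ?_
      refine htr _ hN1 s (j.cell_subset last hs) ?_
      rw [hcell] at hs
      exact hs.1
    have h2 : SymMat.tr (x.coord last) ≤ (j.len last)⁻¹ * I * ‖(SymMat.one : SymMat D)‖ := by
      refine (SymMat.tr_le _).trans (mul_le_mul_of_nonneg_right ?_ (norm_nonneg _))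
      rw [hxk, SymMat.norm_smul', abs_of_pos (inv_pos.2 (j.len_pos last))]
      exact mul_le_mul_of_nonneg_left (norm_integral_le_integral_norm _)
        (inv_pos.2 (j.len_pos last)).le
    rw [hj.len_eq, inv_inv] at h2
    rw [inv_mul_le_iff₀ hn]
    linarith
  set B : ℕ → ℝ := fun k => if k < N then (j.n : ℝ)⁻¹ * (2 * D * (τ (k + 1) - τ k)) else 2 * I
    with hB
  have hsum : pathNormL1 (ι - pathLift j x) ≤ ∑ k ∈ Finset.range j.n, B k := by
    rw [pathNormL1, integral_unit_eq_sum j (integrable_path _).norm, Finset.sum_range]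
    refine Finset.sum_le_sum fun k _ => ?_
    rw [hsub]
    by_cases hk : (k : ℕ) < N
    · simp only [hB, hk, if_true]
      exact hinner k (by omega)
    · have : k = last := by ext; simp only [hlast]; omega
      simp only [hB, hk, if_false]
      rw [this]
      exact hlastle
  have hBsum : ∑ k ∈ Finset.range j.n, B k ≤ (j.n : ℝ)⁻¹ * (2 * D * τ N) + 2 * I := by
    rw [hN, Finset.sum_range_succ]
    have h1 : ∑ k ∈ Finset.range N, B k =
        ∑ k ∈ Finset.range N, (j.n : ℝ)⁻¹ * (2 * D * (τ (k + 1) - τ k)) := by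
      refine Finset.sum_congr rfl fun k hk => ?_
      simp only [hB, Finset.mem_range.1 hk, if_true]
    have h2 : B N = 2 * I := by simp [hB]
    rw [h1, h2, ← Finset.mul_sum, ← Finset.mul_sum, Finset.sum_range_sub, ← hN]
    have h3 : 0 ≤ τ 0 := (hpos _ (hpt 0 j.n_pos)).tr_nonneg
    gcongr
    linarith
  have hIle : I ≤ (√(j.n : ℝ))⁻¹ * ‖ι‖ := by
    have := setIntegral_cell_norm_le j ι last
    rwa [hj.len_eq, Real.sqrt_inv] at this
  have hfinal : approxConst D * I ≤ approxConst D * ((√(j.n : ℝ))⁻¹ * ‖ι‖) :=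
    mul_le_mul_of_nonneg_left hIle (approxConst_pos D).le
  have h6 := mul_le_mul_of_nonneg_left hτN (by positivity : (0 : ℝ) ≤ 2 * D)
  unfold approxConst at *
  nlinarith

end Cone

/-! ### The set of gradients -/

section Gradients

variable {D : ℕ}

theorem toReal_eLpNorm_le_norm (z : PathSpace D) {p : ℝ} (hp : p < 2) :
    (eLpNorm z (ENNReal.ofReal p) unitMeasure).toReal ≤ ‖z‖ := by
  have : IsProbabilityMeasure unitMeasure := ⟨by simp⟩
  rw [Lp.norm_def]
  refine ENNReal.toReal_mono (Lp.eLpNorm_ne_top z) ?_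
  refine eLpNorm_le_eLpNorm_of_exponent_le ?_ (Lp.aestronglyMeasurable z)
  rw [show (2 : ℝ≥0∞) = ENNReal.ofReal 2 by simp]
  exact ENNReal.ofReal_le_ofReal hp.le

theorem lintegral_enorm_path (z : PathSpace D) :
    ∫⁻ s, ‖z s‖ₑ ∂unitMeasure = ENNReal.ofReal (pathNormL1 z) := by
  rw [pathNormL1, ofReal_integral_norm_eq_lintegral_enorm (integrable_path z)]

theorem lintegral_enorm_sq_path (z : PathSpace D) :
    ∫⁻ s, ‖z s‖ₑ ^ (2 : ℝ) ∂unitMeasure = ENNReal.ofReal (‖z‖ ^ 2) := by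
  rw [← integral_norm_sq_path, ofReal_integral_eq_lintegral_ofReal (integrable_norm_sq_path z)
    (Eventually.of_forall fun s => sq_nonneg _)]
  refine lintegral_congr fun s => ?_
  rw [ENNReal.ofReal_pow (norm_nonneg _), ofReal_norm, ENNReal.rpow_two]

theorem pathNormL1_nonneg (z : PathSpace D) : 0 ≤ pathNormL1 z :=
  integral_nonneg fun _ => norm_nonneg _

/-- Interpolation of `Lᵖ` between `L¹` and `L²`. -/
theorem toReal_eLpNorm_le (z : PathSpace D) {p : ℝ} (hp1 : 1 ≤ p) (hp2 : p < 2) :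
    (eLpNorm z (ENNReal.ofReal p) unitMeasure).toReal ≤
      pathNormL1 z ^ ((2 - p) / p) * ‖z‖ ^ (1 - (2 - p) / p) := by
  have hp0 : 0 < p := by linarith
  have hae : AEMeasurable (fun s => ‖z s‖ₑ) unitMeasure := (Lp.aestronglyMeasurable z).enorm
  -- Hölder for the factorization `|z|^p = |z|^(2-p) * (|z|²)^(p-1)`, whose exponents `2 - p` and `p
  -- - 1` sum to one.
  have h := ENNReal.lintegral_mul_norm_pow_le (p := 2 - p) (q := p - 1) hae (hae.pow_const (2 : ℝ))
    (by linarith) (by linarith) (by ring)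
  have e : ∀ s, ‖z s‖ₑ ^ (2 - p) * (‖z s‖ₑ ^ (2 : ℝ)) ^ (p - 1) = ‖z s‖ₑ ^ p := by
    intro s
    rw [← ENNReal.rpow_mul, ← ENNReal.rpow_add_of_nonneg _ _ (by linarith) (by linarith)]
    congr 1
    ring
  simp_rw [e] at h
  rw [lintegral_enorm_path, lintegral_enorm_sq_path] at h
  have hle : eLpNorm z (ENNReal.ofReal p) unitMeasure ≤
      ENNReal.ofReal (pathNormL1 z ^ ((2 - p) / p) * ‖z‖ ^ (1 - (2 - p) / p)) := by
    rw [eLpNorm_eq_lintegral_rpow_enorm_toReal (by simpa using hp0) ENNReal.ofReal_ne_top,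
      ENNReal.toReal_ofReal hp0.le]
    refine (ENNReal.rpow_le_rpow h (by positivity)).trans_eq ?_
    rw [ENNReal.mul_rpow_of_nonneg _ _ (by positivity), ← ENNReal.rpow_mul, ← ENNReal.rpow_mul,
      ENNReal.ofReal_mul (Real.rpow_nonneg (pathNormL1_nonneg z) _),
      ENNReal.ofReal_rpow_of_nonneg (pathNormL1_nonneg z)
        (mul_nonneg (by linarith) (by positivity)),
      ENNReal.ofReal_rpow_of_nonneg (by positivity) (mul_nonneg (by linarith) (by positivity)),
      ← Real.rpow_natCast, ← Real.rpow_mul (norm_nonneg z)]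
    congr 3
    · ring
    · push_cast
      field_simp
      ring
  exact ENNReal.toReal_le_of_le_ofReal
    (mul_nonneg (Real.rpow_nonneg (pathNormL1_nonneg z) _) (Real.rpow_nonneg (norm_nonneg z) _)) hle

/-- The increments of `ψ` are controlled by `a` times the `L¹` norm plus `b` times the `L²` norm. -/
structure IncrementBound (ψ : PathSpace D → ℝ) (a b : ℝ) : Prop where
  left_nonneg : 0 ≤ a
  right_nonneg : 0 ≤ b
  bound : ∀ μ ∈ pathCone D, ∀ ν ∈ pathCone D,
    ψ μ - ψ ν ≤ a * pathNormL1 (μ - ν) + b * ‖μ - ν‖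

/-- The set containing the gradients of the solutions with initial condition `ψ`. -/
def gradSet (ψ : PathSpace D → ℝ) : Set (PathSpace D) :=
  {q | q ∈ pathCone D ∧ ∀ a b, IncrementBound ψ a b → ∀ z, inner ℝ q z ≤ a * pathNormL1 z + b * ‖z‖}

theorem norm_le_of_mem_gradSet {ψ : PathSpace D → ℝ} {L : ℝ} (hL : IncrementBound ψ 0 L)
    {q : PathSpace D} (hq : q ∈ gradSet ψ) : ‖q‖ ≤ L := by
  have h := hq.2 0 L hL q
  rw [real_inner_self_eq_norm_sq (F := PathSpace D), zero_mul, zero_add, sq] at h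
  rcases (norm_nonneg q).eq_or_lt with h0 | h0
  · rw [← h0]; exact hL.right_nonneg
  · exact le_of_mul_le_mul_right h h0

/-- Weighted AM-GM applied to `s X` and `b' Y`, where `s` is chosen so that `s^θ * b'^(1-θ) = 1`.
Since `θ > 0`, the coefficient of the `L²` norm can be made arbitrarily small at the expense of `a`.
-/
theorem exists_incrementBound {ψ : PathSpace D → ℝ} {C θ : ℝ} (hC : 0 < C) (hθ : 0 < θ)
    (hθ1 : θ ≤ 1)
    (h : ∀ μ ∈ pathCone D, ∀ ν ∈ pathCone D,
      ψ μ - ψ ν ≤ C * (pathNormL1 (μ - ν) ^ θ * ‖μ - ν‖ ^ (1 - θ)))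
    {b : ℝ} (hb : 0 < b) : ∃ a, IncrementBound ψ a b := by
  set b' := b / C with hb'
  have hb'0 : 0 < b' := by positivity
  set s := b' ^ (-(1 - θ) / θ) with hs
  have hs0 : 0 < s := Real.rpow_pos_of_pos hb'0 _
  refine ⟨C * s, by positivity, hb.le, fun μ hμ ν hν => (h μ hμ ν hν).trans ?_⟩
  set X := pathNormL1 (μ - ν)
  have hX : 0 ≤ X := pathNormL1_nonneg _
  set Y := ‖μ - ν‖
  have hY : 0 ≤ Y := norm_nonneg (μ - ν)
  have h1 := Real.geom_mean_le_arith_mean2_weighted hθ.le (sub_nonneg.2 hθ1)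
    (mul_nonneg hs0.le hX) (mul_nonneg hb'0.le hY) (by ring)
  have h2 : (s * X) ^ θ * (b' * Y) ^ (1 - θ) = X ^ θ * Y ^ (1 - θ) := by
    rw [Real.mul_rpow hs0.le hX, Real.mul_rpow hb'0.le hY, hs, ← Real.rpow_mul hb'0.le,
      div_mul_cancel₀ _ hθ.ne']
    have : b' ^ (-(1 - θ)) * b' ^ (1 - θ) = 1 := by
      rw [← Real.rpow_add hb'0]; simp
    linear_combination X ^ θ * Y ^ (1 - θ) * this
  rw [h2] at h1
  have h3 : θ * (s * X) ≤ s * X := mul_le_of_le_one_left (by positivity) hθ1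
  have h4 : (1 - θ) * (b' * Y) ≤ b' * Y := mul_le_of_le_one_left (by positivity) (by linarith)
  have h5 : C * (X ^ θ * Y ^ (1 - θ)) ≤ C * (s * X + b' * Y) :=
    mul_le_mul_of_nonneg_left (by linarith) hC.le
  have h6 : C * b' = b := by rw [hb']; field_simp
  calc _ ≤ _ := h5
    _ = C * s * X + (C * b') * Y := by ring
    _ = _ := by rw [h6]

/-- The uniform partition with `n` cells. -/
noncomputable def uniformPartition (n : ℕ) (hn : 0 < n) : UnitPartition where
  n := n
  t k := (k : ℝ) / n
  strictMono k l hkl := by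
    have : (0 : ℝ) < n := by exact_mod_cast hn
    beta_reduce
    gcongr
    exact_mod_cast hkl
  zero := by simp
  one := by
    have : (n : ℝ) ≠ 0 := by exact_mod_cast hn.ne'
    simp [this]

theorem uniformPartition_isUniform (n : ℕ) (hn : 0 < n) : (uniformPartition n hn).IsUniform :=
  fun _ => rfl

theorem norm_sub_pathLift_pathProj_le (j : UnitPartition) (q : PathSpace D) :
    ‖q - pathLift j (pathProj j q)‖ ≤ 2 * ‖q‖ := by
  refine (norm_sub_le q _).trans ?_
  rw [norm_pathLift]
  linarith [norm_pathProj_le j q]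

/-- The residual is orthogonal to step paths. Written this way, its norm is accessible to the
pairing bounds that define `gradSet`. -/
theorem norm_sq_sub_pathLift_pathProj (j : UnitPartition) (q : PathSpace D) :
    ‖q - pathLift j (pathProj j q)‖ ^ 2 = inner ℝ q (q - pathLift j (pathProj j q)) := by
  have h : inner ℝ (pathLift j (pathProj j q)) (q - pathLift j (pathProj j q)) = 0 := by
    rw [inner_pathLift, pathProj_sub, pathProj_pathLift, sub_self, inner_zero_right]
  rw [← real_inner_self_eq_norm_sq (F := PathSpace D),
    inner_sub_left (𝕜 := ℝ) (E := PathSpace D), h, sub_zero]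

/-- Pairing `q` with its own residual bounds the squared residual by `a` times its `L¹` norm plus
`b` times its `L²` norm. The first is uniformly small for a fine partition, the second for small
`b`, so the set lies near a compact subset of a finite-dimensional space. -/
theorem totallyBounded_gradSet {ψ : PathSpace D → ℝ} {L : ℝ} (hL : IncrementBound ψ 0 L)
    (hψ : ∀ b > 0, ∃ a, IncrementBound ψ a b) : TotallyBounded (gradSet ψ) := by
  rw [Metric.totallyBounded_iff]
  intro ε hε
  have hL0 := hL.right_nonneg
  -- The residual has norm at most `2 L`, so this coefficient contributes at most `ε² / 8`, half of
  -- the `(ε / 2)²` to be reached.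
  obtain ⟨a, ha⟩ := hψ (ε ^ 2 / (16 * (L + 1))) (by positivity)
  have ha0 := ha.left_nonneg
  have hcD := approxConst_pos D
  obtain ⟨n, hn0, hn⟩ : ∃ n : ℕ, 0 < n ∧ a * (approxConst D * (√(n : ℝ))⁻¹ * L) < ε ^ 2 / 8 := by
    have h1 : Tendsto (fun n : ℕ => a * (approxConst D * (√(n : ℝ))⁻¹ * L)) atTop (𝓝 0) := by
      have h2 : Tendsto (fun n : ℕ => (√(n : ℝ))⁻¹) atTop (𝓝 0) :=
        (Real.tendsto_sqrt_atTop.comp tendsto_natCast_atTop_atTop).inv_tendsto_atTop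
      have := ((h2.const_mul (approxConst D)).mul_const L).const_mul a
      simpa using this
    obtain ⟨n, h3, h4⟩ := ((h1.eventually_lt_const (by positivity : 0 < ε ^ 2 / 8)).and
      (eventually_gt_atTop 0)).exists
    exact ⟨n, h4, h3⟩
  set j := uniformPartition n hn0 with hj
  have hcpt : IsCompact (pathLift j '' Metric.closedBall (0 : StepSpace D j) L) :=
    (isCompact_closedBall _ _).image (continuous_pathLift j)
  obtain ⟨t, -, htf, ht⟩ := hcpt.finite_cover_balls (half_pos hε)
  refine ⟨t, htf, fun q hq => ?_⟩
  have hqL := norm_le_of_mem_gradSet hL hq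
  have hmem : pathLift j (pathProj j q) ∈ pathLift j '' Metric.closedBall (0 : StepSpace D j) L :=
    ⟨_, by rw [mem_closedBall_zero_iff]; exact (norm_pathProj_le j q).trans hqL, rfl⟩
  obtain ⟨y, hy, hyd⟩ := mem_iUnion₂.1 (ht hmem)
  refine mem_iUnion₂.2 ⟨y, hy, ?_⟩
  rw [Metric.mem_ball] at hyd ⊢
  refine (dist_triangle q (pathLift j (pathProj j q)) y).trans_lt ?_
  have hclose : ‖q - pathLift j (pathProj j q)‖ ^ 2 < (ε / 2) ^ 2 := by
    rw [norm_sq_sub_pathLift_pathProj]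
    refine (hq.2 a _ ha _).trans_lt ?_
    have h1 : a * pathNormL1 (q - pathLift j (pathProj j q)) ≤
        a * (approxConst D * (√(n : ℝ))⁻¹ * L) := by
      refine mul_le_mul_of_nonneg_left ?_ ha0
      refine (pathNormL1_sub_le (uniformPartition_isUniform n hn0) hq.1).trans ?_
      exact mul_le_mul_of_nonneg_left hqL (by positivity)
    have h2 : ε ^ 2 / (16 * (L + 1)) * ‖q - pathLift j (pathProj j q)‖ ≤ ε ^ 2 / 8 := by
      have := norm_sub_pathLift_pathProj_le j q
      rw [div_mul_eq_mul_div, div_le_iff₀ (by positivity)]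
      nlinarith [sq_nonneg ε]
    linarith
  have h3 : ‖q - pathLift j (pathProj j q)‖ < ε / 2 := lt_of_pow_lt_pow_left₀ 2 (by positivity) hclose
  rw [dist_eq_norm (E := PathSpace D)]
  linarith

end Gradients

/-- A locally Lipschitz function is Lipschitz, around the points of a compact set, with uniform
constants. -/
theorem LocallyLipschitz.exists_bound_of_isCompact {V : Type*} [NormedAddCommGroup V] {H : V → ℝ}
    (hH : LocallyLipschitz H) {K : Set V} (hK : IsCompact K) :
    ∃ r > 0, ∃ Λ ≥ 0, ∀ q ∈ K, ∀ ρ, ‖ρ‖ ≤ r → |H (q + ρ) - H q| ≤ Λ * ‖ρ‖ := by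
  refine hK.induction_on (p := fun s => ∃ r > 0, ∃ Λ ≥ 0, ∀ q ∈ s, ∀ ρ, ‖ρ‖ ≤ r →
    |H (q + ρ) - H q| ≤ Λ * ‖ρ‖) ?_ ?_ ?_ ?_
  · exact ⟨1, one_pos, 0, le_rfl, by simp⟩
  · rintro s t hst ⟨r, hr, Λ, hΛ, h⟩
    exact ⟨r, hr, Λ, hΛ, fun q hq => h q (hst hq)⟩
  · rintro s t ⟨r, hr, Λ, hΛ, h⟩ ⟨r', hr', Λ', hΛ', h'⟩
    refine ⟨min r r', lt_min hr hr', max Λ Λ', hΛ.trans (le_max_left _ _), ?_⟩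
    rintro q (hq | hq) ρ hρ
    · exact (h q hq ρ (hρ.trans (min_le_left _ _))).trans
        (mul_le_mul_of_nonneg_right (le_max_left _ _) (norm_nonneg _))
    · exact (h' q hq ρ (hρ.trans (min_le_right _ _))).trans
        (mul_le_mul_of_nonneg_right (le_max_right _ _) (norm_nonneg _))
  · intro x hx
    obtain ⟨Λ, t, ht, hLip⟩ := hH x
    obtain ⟨ε, hε, hball⟩ := Metric.mem_nhds_iff.1 ht
    refine ⟨Metric.ball x (ε / 2), mem_nhdsWithin_of_mem_nhds (Metric.ball_mem_nhds x (by positivity)),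
      ε / 4, by positivity, Λ, Λ.2, fun q hq ρ hρ => ?_⟩
    rw [Metric.mem_ball] at hq
    have h1 : q + ρ ∈ t := hball (by
      rw [Metric.mem_ball]
      have := dist_triangle (q + ρ) q x
      rw [dist_self_add_left] at this
      linarith)
    have h2 : q ∈ t := hball (by rw [Metric.mem_ball]; linarith)
    have := hLip.dist_le_mul _ h1 _ h2
    rwa [Real.dist_eq, dist_self_add_left] at this

/-! ### A priori estimates for the approximate solutions -/

section APriori

variable {D : ℕ} {H ψ : PathSpace D → ℝ} {j : UnitPartition} {f : ℝ → StepSpace D j → ℝ}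

theorem InSolutionClass.exists_growth {E : Type*} [NormedAddCommGroup E] [InnerProductSpace ℝ E]
    {A : Set E} {f : ℝ → E → ℝ} (hf : InSolutionClass A f) :
    ∃ M : ℝ, 0 ≤ M ∧ ∀ t, 0 ≤ t → ∀ x ∈ A, |f t x - f 0 x| ≤ M * t := by
  obtain ⟨M, hM⟩ := hf.growth_time
  refine ⟨|M|, abs_nonneg M, fun t ht x hx => ?_⟩
  rcases ht.eq_or_lt with rfl | ht
  · simp
  · have := (hM t ht x hx).trans (le_abs_self M)
    rwa [div_le_iff₀ ht] at this

theorem StepSpace.normL1_smul (c : ℝ) (x : StepSpace D j) :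
    StepSpace.normL1 (c • x) = |c| * StepSpace.normL1 x := by
  simp only [StepSpace.normL1, StepSpace.coord_smul, SymMat.norm_smul', Finset.mul_sum]
  refine Finset.sum_congr rfl fun k _ => by ring

theorem IncrementBound.initial {a b : ℝ} (h : IncrementBound ψ a b) {x y : StepSpace D j}
    (hx : x ∈ stepCone D j) (hy : y ∈ stepCone D j) :
    ψ (pathLift j x) - ψ (pathLift j y) ≤ a * StepSpace.normL1 (x - y) + b * ‖x - y‖ := by
  have := h.bound _ (pathLift_mem_pathCone hx) _ (pathLift_mem_pathCone hy)
  rwa [← pathLift_sub, pathNormL1_pathLift, norm_pathLift] at this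

/-- Lifts preserve both norms and the comparison loses nothing, so the constants are those of `ψ`,
for every partition and every time. -/
theorem IsApproximateSolution.sub_le (hH : Continuous H) (hf : IsApproximateSolution H ψ j f)
    {a b : ℝ} (h : IncrementBound ψ a b) {t : ℝ} (ht : 0 ≤ t) {x y : StepSpace D j}
    (hx : x ∈ stepCone D j) (hy : y ∈ stepCone D j) :
    f t x - f t y ≤ a * StepSpace.normL1 (x - y) + b * ‖x - y‖ := by
  obtain ⟨M, hM, hgrowth⟩ := hf.inClass.exists_growth
  have := hf.solution.sub_le_of_initial (isSolidCone_stepCone D j).isClosed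
    (hH.comp (continuous_pathLift j))
    (StepSpace.isSmoothable_norms h.left_nonneg h.right_nonneg) hM hM
    (fun x hx y hy => by
      rw [hf.initial x hx, hf.initial y hy]
      exact h.initial hx hy)
    (fun t ht x hx => by linarith [(abs_le.1 (hgrowth t ht x hx)).2])
    (fun t ht x hx => by linarith [(abs_le.1 (hgrowth t ht x hx)).1])
    ht le_rfl hx hy
  simpa using this

/-- The gradients at level `j`. -/
def stepGradSet (ψ : PathSpace D → ℝ) (j : UnitPartition) : Set (StepSpace D j) :=
  {q | q ∈ stepCone D j ∧ ∀ a b, IncrementBound ψ a b →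
    ∀ z, inner ℝ q z ≤ a * StepSpace.normL1 z + b * ‖z‖}

/-- The projection contracts both norms. Gradients from all levels thus fall into one set that does
not depend on the partition. -/
theorem pathLift_mem_gradSet {q : StepSpace D j} (hq : q ∈ stepGradSet ψ j) :
    pathLift j q ∈ gradSet ψ := by
  refine ⟨pathLift_mem_pathCone hq.1, fun a b h z => ?_⟩
  rw [inner_pathLift]
  refine (hq.2 a b h _).trans (add_le_add ?_ ?_)
  · exact mul_le_mul_of_nonneg_left (normL1_pathProj_le j z) h.left_nonneg
  · exact mul_le_mul_of_nonneg_left (norm_pathProj_le j z) h.right_nonneg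

theorem isCompact_stepGradSet {L : ℝ} (hL : IncrementBound ψ 0 L) (j : UnitPartition) :
    IsCompact (stepGradSet ψ j) := by
  refine (isCompact_closedBall (0 : StepSpace D j) L).of_isClosed_subset ?_ fun q hq => ?_
  · have : stepGradSet ψ j = stepCone D j ∩ ⋂ a, ⋂ b, ⋂ (_ : IncrementBound ψ a b), ⋂ z,
        {q : StepSpace D j | inner ℝ q z ≤ a * StepSpace.normL1 z + b * ‖z‖} := by
      ext q; simp [stepGradSet]
    rw [this]
    refine (isSolidCone_stepCone D j).isClosed.inter (isClosed_iInter fun a =>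
      isClosed_iInter fun b => isClosed_iInter fun _ => isClosed_iInter fun z =>
        isClosed_le (by fun_prop) continuous_const)
  · rw [mem_closedBall_zero_iff, ← norm_pathLift]
    exact norm_le_of_mem_gradSet hL (pathLift_mem_gradSet hq)

/-- At an interior point every direction is available: directions of the dual cone place the
gradient in the bidual, that is in the cone, and the increment bounds give the pairing bounds. -/
theorem IsApproximateSolution.grad_mem (hH : Continuous H) (hf : IsApproximateSolution H ψ j f) :
    ∀ t, 0 < t → ∀ x ∈ interior (stepCone D j), ∀ (φ : ℝ × StepSpace D j → ℝ)
      (a : ℝ × StepSpace D j → ℝ) (g : ℝ × StepSpace D j → StepSpace D j),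
      IsSmoothTest (stepCone D j) φ a g →
      IsLocalMaxOn (fun w : ℝ × StepSpace D j => f w.1 w.2 - φ w)
        (Ioi (0 : ℝ) ×ˢ stepCone D j) (t, x) → g (t, x) ∈ stepGradSet ψ j := by
  intro t ht x hx φ a g hφ hmax
  have hxA := interior_subset hx
  refine ⟨mem_stepCone_of_dual fun z hz => ?_, fun a b h z => ?_⟩
  · have := hφ.neg_inner_grad_le ht hx hmax (z := z) (m := 0) fun ε hε hmem => by
      have h1 := hf.inClass.increasing t ht.le _ hmem _ hxA (by
        rw [add_sub_cancel_left]
        intro y hy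
        rw [real_inner_smul_left]
        exact mul_nonneg hε.le (hz y hy))
      linarith
    linarith
  · have := hφ.neg_inner_grad_le ht hx hmax (z := -z) (m := a * StepSpace.normL1 z + b * ‖z‖)
      fun ε hε hmem => by
        have h1 := hf.sub_le hH h ht.le hxA hmem
        have h2 : x - (x + ε • -z) = ε • z := by rw [sub_add_cancel_left, smul_neg, neg_neg]
        rw [h2, StepSpace.normL1_smul, norm_smul, Real.norm_eq_abs, abs_of_pos hε] at h1
        linarith
    rwa [inner_neg_right, neg_neg] at this

theorem IsApproximateSolution.neg_grad_mem (hH : Continuous H)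
    (hf : IsApproximateSolution H ψ j f) :
    ∀ t, 0 < t → ∀ x ∈ interior (stepCone D j), ∀ (φ : ℝ × StepSpace D j → ℝ)
      (a : ℝ × StepSpace D j → ℝ) (g : ℝ × StepSpace D j → StepSpace D j),
      IsSmoothTest (stepCone D j) φ a g →
      IsLocalMaxOn (fun w : ℝ × StepSpace D j => -f w.1 w.2 - φ w)
        (Ioi (0 : ℝ) ×ˢ stepCone D j) (t, x) → g (t, x) ∈ -stepGradSet ψ j := by
  intro t ht x hx φ a g hφ hmax
  have hxA := interior_subset hx
  refine ⟨mem_stepCone_of_dual fun z hz => ?_, fun a b h z => ?_⟩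
  · have := hφ.neg_inner_grad_le (u := fun t x => -f t x) ht hx hmax (z := -z) (m := 0)
      fun ε hε hmem => by
        have h1 := hf.inClass.increasing t ht.le _ hxA _ hmem (by
          rw [sub_add_cancel_left, smul_neg, neg_neg]
          intro y hy
          rw [real_inner_smul_left]
          exact mul_nonneg hε.le (hz y hy))
        linarith
    rw [inner_neg_right] at this
    rw [inner_neg_left]
    linarith
  · have := hφ.neg_inner_grad_le (u := fun t x => -f t x) ht hx hmax (z := z)
      (m := a * StepSpace.normL1 z + b * ‖z‖) fun ε hε hmem => by
        have h1 := hf.sub_le hH h ht.le hmem hxA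
        rw [add_sub_cancel_left, StepSpace.normL1_smul, norm_smul, Real.norm_eq_abs,
          abs_of_pos hε] at h1
        linarith
    rwa [inner_neg_left]

theorem IsApproximateSolution.continuousOn (hf : IsApproximateSolution H ψ j f) :
    ContinuousOn (fun z : ℝ × StepSpace D j => f z.1 z.2) (Ici (0 : ℝ) ×ˢ stepCone D j) :=
  hf.solution.1.1

theorem IsApproximateSolution.norm_sub_le (hH : Continuous H)
    (hf : IsApproximateSolution H ψ j f) {L : ℝ} (hL : IncrementBound ψ 0 L)
    {t : ℝ} (ht : 0 ≤ t) {x y : StepSpace D j}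
    (hx : x ∈ stepCone D j) (hy : y ∈ stepCone D j) : f t x - f t y ≤ L * ‖x - y‖ := by
  simpa using hf.sub_le hH hL ht hx hy

/-- The solution class only provides some growth constant. It is improved to `M` because a test
function touching `f` or `-f` from above, even at the boundary, has time derivative bounded through
the value of `H` at an element of `gradSet`. -/
theorem IsApproximateSolution.abs_sub_initial_le (hH : Continuous H)
    (hf : IsApproximateSolution H ψ j f) {L M : ℝ} (hL : IncrementBound ψ 0 L)
    (hM : ∀ q ∈ gradSet ψ, |H q| ≤ M) {t : ℝ} (ht : 0 ≤ t) {x : StepSpace D j}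
    (hx : x ∈ stepCone D j) : |f t x - f 0 x| ≤ M * t := by
  obtain ⟨M₀, hM₀, hgrowth⟩ := hf.inClass.exists_growth
  have hcone := isSolidCone_stepCone D j
  have hS := isCompact_stepGradSet hL j
  have hHl : Continuous fun x : StepSpace D j => H (pathLift j x) :=
    hH.comp (continuous_pathLift j)
  have up : f t x ≤ f 0 x + M * t :=
    le_initial_add_mul hcone.isClosed hf.continuousOn hL.right_nonneg hM₀
      (fun x hx y hy => hf.norm_sub_le hH hL le_rfl hx hy)
      (fun t ht x hx => by linarith [(abs_le.1 (hgrowth t ht x hx)).2])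
      (fun z hz φ a g hφ hmax => by
        obtain ⟨Q, hQ, -, h⟩ := hcone.exists_grad_le hHl hf.solution.1 hS (hf.grad_mem hH) hz hφ hmax
        exact h.trans (le_of_abs_le (hM _ (pathLift_mem_gradSet hQ)))) ht hx
  have low : -f t x ≤ -f 0 x + M * t :=
    le_initial_add_mul (f := fun t x => -f t x) hcone.isClosed hf.continuousOn.neg
      hL.right_nonneg hM₀
      (fun x hx y hy => by
        have := hf.norm_sub_le hH hL le_rfl hy hx
        rw [norm_sub_rev] at this
        linarith)
      (fun t ht x hx => by linarith [(abs_le.1 (hgrowth t ht x hx)).1])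
      (fun z hz φ a g hφ hmax => by
        obtain ⟨Q, hQ, -, h⟩ := hcone.exists_grad_le
          (H := fun q => -H (pathLift j (-q))) (hHl.comp continuous_neg).neg
          hf.solution.2.neg hS.neg (hf.neg_grad_mem hH) hz hφ hmax
        have h1 := neg_le_of_abs_le (hM _ (pathLift_mem_gradSet hQ))
        linarith) ht hx
  rw [abs_le]
  constructor <;> linarith

/-- The improved growth bound at time zero propagates to later times by comparing `f` with its own
translate in time. -/
theorem IsApproximateSolution.abs_time_sub_le (hH : Continuous H)
    (hf : IsApproximateSolution H ψ j f) {L M : ℝ} (hL : IncrementBound ψ 0 L)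
    (hM0 : 0 ≤ M) (hM : ∀ q ∈ gradSet ψ, |H q| ≤ M) {t h : ℝ} (ht : 0 ≤ t) (hh : 0 ≤ h)
    {x : StepSpace D j} (hx : x ∈ stepCone D j) : |f (t + h) x - f t x| ≤ M * h := by
  have hcl := (isSolidCone_stepCone D j).isClosed
  have hHl : Continuous fun x : StepSpace D j => H (pathLift j x) :=
    hH.comp (continuous_pathLift j)
  have hN : IsSmoothable fun x : StepSpace D j => 0 * StepSpace.normL1 x + L * ‖x‖ :=
    StepSpace.isSmoothable_norms le_rfl hL.right_nonneg
  have hgrowth : ∀ t, 0 ≤ t → ∀ x ∈ stepCone D j, |f t x - f 0 x| ≤ M * t := fun t ht x hx =>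
    hf.abs_sub_initial_le hH hL hM ht hx
  have up := hf.solution.sub_le_of_initial hcl hHl hN hM0 hM0
    (fun x hx y hy => hf.sub_le hH hL le_rfl hx hy)
    (fun t ht x hx => by linarith [(abs_le.1 (hgrowth t ht x hx)).2])
    (fun t ht x hx => by linarith [(abs_le.1 (hgrowth t ht x hx)).1]) ht hh hx hx
  have low := hf.solution.neg.sub_le_of_initial hcl (hHl.comp continuous_neg).neg hN hM0 hM0
    (fun x hx y hy => by
      have := hf.sub_le hH hL le_rfl hy hx
      have e : StepSpace.normL1 (y - x) = StepSpace.normL1 (x - y) := by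
        rw [← neg_sub, ← neg_one_smul ℝ, StepSpace.normL1_smul]; simp
      rw [norm_sub_rev, e] at this
      linarith)
    (fun t ht x hx => by linarith [(abs_le.1 (hgrowth t ht x hx)).1])
    (fun t ht x hx => by linarith [(abs_le.1 (hgrowth t ht x hx)).2]) ht hh hx hx
  have e0 : StepSpace.normL1 (0 : StepSpace D j) = 0 := by
    simp [StepSpace.normL1, StepSpace.coord_zero]
  simp only [sub_self, e0, mul_zero, norm_zero, zero_add] at up low
  rw [abs_le]
  constructor <;> linarith

end APriori

/-! ### Comparison of two levels of approximation -/

section Levels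

variable {D : ℕ} {ψ : PathSpace D → ℝ} {j j' : UnitPartition}

theorem sub_le_of_levels {H : PathSpace D → ℝ} (hjj' : j ≤ j') (hH : Continuous H)
    (hHinc : ∀ q q', q - q' ∈ dualCone (pathCone D) → H q' ≤ H q)
    {u : ℝ → StepSpace D j → ℝ} {v : ℝ → StepSpace D j' → ℝ}
    (hu : IsViscositySubsolution (stepCone D j) (fun x => H (pathLift j x)) u)
    (hv : IsViscositySupersolution (stepCone D j') (fun x => H (pathLift j' x)) v)
    {S : Set (StepSpace D j)} (hS : IsCompact S)
    (hgrad : ∀ t, 0 < t → ∀ x ∈ interior (stepCone D j), ∀ (φ : ℝ × StepSpace D j → ℝ)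
      (a : ℝ × StepSpace D j → ℝ) (g : ℝ × StepSpace D j → StepSpace D j),
      IsSmoothTest (stepCone D j) φ a g →
      IsLocalMaxOn (fun w : ℝ × StepSpace D j => u w.1 w.2 - φ w)
        (Ioi (0 : ℝ) ×ˢ stepCone D j) (t, x) → g (t, x) ∈ S)
    {L κ Λ M M' r : ℝ} (hL : 0 ≤ L) (hκ : 0 ≤ κ) (hΛ : 0 ≤ Λ) (hM : 0 ≤ M) (hM' : 0 ≤ M')
    (hHS : ∀ Q ∈ S, ∀ ρ, ‖ρ‖ ≤ r → |H (pathLift j Q + ρ) - H (pathLift j Q)| ≤ Λ * ‖ρ‖)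
    (hκr : κ < r)
    (hinit : ∀ x ∈ stepCone D j, ∀ y ∈ stepCone D j',
      u 0 x - v 0 y ≤ L * ‖x - pathProj j (pathLift j' y)‖ + κ * ‖y‖)
    (hut : ∀ t, 0 ≤ t → ∀ x ∈ stepCone D j, u t x ≤ u 0 x + M * t)
    (hvt : ∀ t, 0 ≤ t → ∀ y ∈ stepCone D j', v 0 y - M' * t ≤ v t y)
    {t : ℝ} (ht : 0 ≤ t) {y : StepSpace D j'} (hy : y ∈ stepCone D j') :
    u t (pathProj j (pathLift j' y)) - v t y ≤ κ * ‖y‖ + Λ * κ * t := by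
  have hcone := isSolidCone_stepCone D j
  refine sub_le_of_initial_of_link hcone.isClosed (isSolidCone_stepCone D j').isClosed hu.1 hv.1
    (LinearMap.toContinuousLinearMap ((projₗ D j).comp (liftₗᵢ D j').toLinearMap))
    (fun x => pathProj j' (pathLift j x)) ?_ ?_ ?_ hL hκ hΛ hM hM' hinit hut hvt
    (P := fun a g => ∃ Q ∈ S, g - Q ∈ dualCone (stepCone D j) ∧ a ≤ H (pathLift j Q))
    (P' := fun a g => H (pathLift j' g) ≤ a) ?_ ?_ hκr ?_ ht hy
  · intro x y
    change inner ℝ (pathProj j' (pathLift j x)) y = inner ℝ x (pathProj j (pathLift j' y))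
    rw [← inner_pathLift, real_inner_comm, ← inner_pathLift, real_inner_comm (F := PathSpace D)]
  · intro y
    exact (norm_pathProj_le j _).trans (norm_pathLift j' y).le
  · exact fun y hy => pathProj_mem_stepCone j (pathLift_mem_pathCone hy)
  · intro z hz φ a g hφ hmax
    exact hcone.exists_grad_le (hH.comp (continuous_pathLift j)) hu hS hgrad hz hφ hmax
  · intro z hz φ a g hφ hmin
    linarith [hv.2 z hz φ a g hφ hmin]
  · rintro g ρ b hρ hb a a' ⟨Q, hQ, hgQ, ha⟩ ha'
    rw [pathLift_sub, pathLift_eq_of_le hjj'] at ha'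
    have hρ' : ‖-pathLift j' ρ‖ ≤ b := by rw [norm_neg (E := PathSpace D), norm_pathLift]; exact hρ
    have h1 := (abs_le.1 (hHS Q hQ (-pathLift j' ρ) (hρ'.trans hb))).1
    have h2 := mul_le_mul_of_nonneg_left hρ' hΛ
    -- The regularity of `H` is only known around the lift of `Q`. Monotonicity first trades `g` for
    -- `Q`, with the same perturbation on both sides.
    have h3 := hHinc (pathLift j g - pathLift j' ρ) (pathLift j Q + -pathLift j' ρ) (by
      have : pathLift j g - pathLift j' ρ - (pathLift j Q + -pathLift j' ρ) =
          pathLift j (g - Q) := by rw [pathLift_sub]; abel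
      rw [this]
      exact pathLift_mem_dualCone hgQ)
    linarith

/-- Two levels of approximation are close as long as `ψ` does not change much under averaging. -/
theorem IsApproximateSolution.abs_sub_le_of_levels {H : PathSpace D → ℝ} (hjj' : j ≤ j')
    (hH : Continuous H)
    (hHinc : ConeIncreasingOn (dualCone (pathCone D)) univ H)
    {u : ℝ → StepSpace D j → ℝ} {v : ℝ → StepSpace D j' → ℝ}
    (hu : IsApproximateSolution H ψ j u) (hv : IsApproximateSolution H ψ j' v)
    {L κ Λ r : ℝ} (hL : IncrementBound ψ 0 L) (hκ : 0 ≤ κ) (hΛ : 0 ≤ Λ)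
    (hHS : ∀ q ∈ gradSet ψ, ∀ ρ, ‖ρ‖ ≤ r → |H (q + ρ) - H q| ≤ Λ * ‖ρ‖) (hκr : κ < r)
    (hψκ : ∀ μ ∈ pathCone D, |ψ (pathLift j (pathProj j μ)) - ψ μ| ≤ κ * ‖μ‖)
    {t : ℝ} (ht : 0 ≤ t) {y : StepSpace D j'} (hy : y ∈ stepCone D j') :
    |u t (pathProj j (pathLift j' y)) - v t y| ≤ κ * ‖y‖ + Λ * κ * t := by
  obtain ⟨M, hM, hMu⟩ := hu.inClass.exists_growth
  obtain ⟨M', hM', hMv⟩ := hv.inClass.exists_growth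
  have hS := isCompact_stepGradSet hL j
  have hψ1 : ∀ y ∈ stepCone D j',
      |ψ (pathLift j (pathProj j (pathLift j' y))) - ψ (pathLift j' y)| ≤ κ * ‖y‖ := by
    intro y hy
    have := hψκ _ (pathLift_mem_pathCone hy)
    rwa [norm_pathLift] at this
  have hψ2 : ∀ x ∈ stepCone D j, ∀ y ∈ stepCone D j',
      |ψ (pathLift j x) - ψ (pathLift j (pathProj j (pathLift j' y)))| ≤
        L * ‖x - pathProj j (pathLift j' y)‖ := by
    intro x hx y hy
    have hy' := pathProj_mem_stepCone j (pathLift_mem_pathCone hy)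
    have h1 := hL.initial hx hy'
    have h2 := hL.initial hy' hx
    rw [norm_sub_rev] at h2
    rw [abs_le]
    constructor <;> linarith
  rw [abs_le]
  constructor
  -- The lower bound is the upper bound for the opposite problem, with gradients in the reflected
  -- set.
  · have := sub_le_of_levels (H := fun q => -H (-q)) (u := fun t x => -u t x)
      (v := fun t x => -v t x) hjj' (hH.comp continuous_neg).neg
      (fun q q' hqq' => neg_le_neg (hHinc (-q') (mem_univ _) (-q) (mem_univ _) (by
        rwa [neg_sub_neg])))
      (by simpa only [pathLift_neg] using hu.solution.2.neg)
      (by simpa only [pathLift_neg] using hv.solution.1.neg)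
      hS.neg (hu.neg_grad_mem hH) hL.right_nonneg hκ hΛ hM hM'
      (fun Q hQ ρ hρ => by
        have := hHS _ (pathLift_mem_gradSet hQ) (-ρ) (by rwa [norm_neg (E := PathSpace D)])
        rw [norm_neg (E := PathSpace D), pathLift_neg, abs_sub_comm] at this
        rw [neg_add, sub_neg_eq_add, neg_add_eq_sub]
        exact this)
      hκr
      (fun x hx y hy => by
        rw [hu.initial x hx, hv.initial y hy]
        linarith [(abs_le.1 (hψ1 y hy)).1, (abs_le.1 (hψ2 x hx y hy)).1])
      (fun t ht x hx => by linarith [(abs_le.1 (hMu t ht x hx)).1])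
      (fun t ht x hx => by linarith [(abs_le.1 (hMv t ht x hx)).2]) ht hy
    linarith
  · exact sub_le_of_levels hjj' hH (fun q q' hqq' => hHinc q (mem_univ _) q' (mem_univ _) hqq')
      hu.solution.1 hv.solution.2 hS (hu.grad_mem hH) hL.right_nonneg hκ hΛ hM hM'
      (fun Q hQ ρ hρ => hHS _ (pathLift_mem_gradSet hQ) ρ hρ) hκr
      (fun x hx y hy => by
        rw [hu.initial x hx, hv.initial y hy]
        linarith [(abs_le.1 (hψ1 y hy)).2, (abs_le.1 (hψ2 x hx y hy)).2])
      (fun t ht x hx => by linarith [(abs_le.1 (hMu t ht x hx)).2])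
      (fun t ht x hx => by linarith [(abs_le.1 (hMv t ht x hx)).1]) ht hy

end Levels

/-! ### Best Lipschitz constants -/

section LipConst

variable {X : Type*} [PseudoMetricSpace X]

theorem lipConst_le {A : Set X} {g : X → ℝ} {c : ℝ}
    (h : ∀ x ∈ A, ∀ y ∈ A, |g x - g y| ≤ c * dist x y) : lipConst A g ≤ ENNReal.ofReal c := by
  refine iSup₂_le fun x hx => iSup₂_le fun y hy => ENNReal.div_le_of_le_mul ?_
  rw [edist_dist, edist_dist, ← ENNReal.ofReal_mul' dist_nonneg, Real.dist_eq]
  exact ENNReal.ofReal_le_ofReal (h x hx y hy)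

theorem abs_sub_le_lipConst_mul {A : Set X} {g : X → ℝ} (hg : lipConst A g ≠ ∞) {x y : X}
    (hx : x ∈ A) (hy : y ∈ A) (h0 : dist x y = 0 → g x = g y) :
    |g x - g y| ≤ (lipConst A g).toReal * dist x y := by
  have h1 : edist (g x) (g y) / edist x y ≤ lipConst A g :=
    le_iSup₂_of_le x hx (le_iSup₂_of_le y hy le_rfl)
  have h2 : edist (g x) (g y) ≤ lipConst A g * edist x y := by
    rcases eq_or_ne (edist x y) 0 with h | h
    · have : dist x y = 0 := by rw [dist_edist, h, ENNReal.toReal_zero]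
      rw [h0 this, edist_self]
      exact zero_le
    · exact (ENNReal.div_le_iff h (edist_ne_top x y)).1 h1
  have h3 := ENNReal.toReal_mono (ENNReal.mul_ne_top hg (edist_ne_top x y)) h2
  rwa [ENNReal.toReal_mul, ← dist_edist, ← dist_edist, Real.dist_eq] at h3

end LipConst

/-! ### Collections of partitions -/

namespace UnitPartition

/-- If all the partitions had fewer than `N` cells, `0` and `1 / (N + 2)` would always share the
first cell, so no set in the generated sigma-algebra could separate them. -/
theorem IsGood.exists_n_ge {J : Set UnitPartition} (hJ : IsGood J) (N : ℕ) :
    ∃ j ∈ J, N ≤ j.n := by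
  by_contra! hlt
  set z : Ico (0 : ℝ) 1 := ⟨0, by simp⟩ with hz
  set w : Ico (0 : ℝ) 1 := ⟨1 / ((N : ℝ) + 2), by positivity, by
    have : (0 : ℝ) ≤ N := Nat.cast_nonneg N
    rw [div_lt_one (by positivity)]
    linarith⟩ with hw
  let m : MeasurableSpace (Ico (0 : ℝ) 1) :=
    { MeasurableSet' := fun s => z ∈ s ↔ w ∈ s
      measurableSet_empty := by simp
      measurableSet_compl := fun s hs => not_congr hs
      measurableSet_iUnion := fun s hs => by simp only [mem_iUnion, hs] }
  have hle : ⨆ j ∈ J, j.sigmaAlgebra ≤ m := by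
    refine iSup₂_le fun j hj => MeasurableSpace.generateFrom_le ?_
    rintro _ ⟨k, rfl⟩
    change (0 : ℝ) ∈ j.cell k ↔ 1 / ((N : ℝ) + 2) ∈ j.cell k
    have hn : (0 : ℝ) < j.n := by exact_mod_cast j.n_pos
    have hnN : (j.n : ℝ) + 1 ≤ N := by exact_mod_cast hlt j hj
    have hw0 : 0 < 1 / ((N : ℝ) + 2) := by positivity
    have hw1 : 1 / ((N : ℝ) + 2) < 1 / j.n := by gcongr; linarith
    have h0 : (0 : ℝ) ∈ j.cell ⟨0, j.n_pos⟩ := by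
      rw [cell, hJ.1 j hj, hJ.1 j hj]
      simp [hn]
    have h1 : 1 / ((N : ℝ) + 2) ∈ j.cell ⟨0, j.n_pos⟩ := by
      rw [cell, hJ.1 j hj, hJ.1 j hj]
      refine ⟨?_, ?_⟩
      · simpa using hw0.le
      · simpa using hw1
    constructor
    · intro h
      rwa [j.eq_of_mem_cell h h0]
    · intro h
      rwa [j.eq_of_mem_cell h h1]
  rw [hJ.2.2] at hle
  have hs : MeasurableSet[borel (Ico (0 : ℝ) 1)] {z}ᶜ :=
    MeasurableSpace.measurableSet_generateFrom (isOpen_compl_singleton (x := z))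
  have h1 : z ∈ ({z}ᶜ : Set (Ico (0 : ℝ) 1)) ↔ w ∈ ({z}ᶜ : Set (Ico (0 : ℝ) 1)) := hle _ hs
  have h2 : w = z := by
    by_contra h
    exact (h1.2 h) rfl
  have h3 : 1 / ((N : ℝ) + 2) = 0 := congrArg Subtype.val h2
  have : (0 : ℝ) < 1 / ((N : ℝ) + 2) := by positivity
  linarith

end UnitPartition

/-! ### Approximation of the initial condition -/

section Initial

variable {D : ℕ} {ψ : PathSpace D → ℝ} {p C : ℝ}

theorem abs_sub_le_of_eLpNorm
    (hψ : ∀ μ ∈ pathCone D, ∀ ν ∈ pathCone D,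
      |ψ μ - ψ ν| ≤ C * (eLpNorm (fun s => μ s - ν s) (ENNReal.ofReal p) unitMeasure).toReal)
    {μ ν : PathSpace D} (hμ : μ ∈ pathCone D) (hν : ν ∈ pathCone D) :
    |ψ μ - ψ ν| ≤ C * (eLpNorm (μ - ν : PathSpace D) (ENNReal.ofReal p) unitMeasure).toReal := by
  rw [eLpNorm_congr_ae (Lp.coeFn_sub μ ν)]
  exact hψ μ hμ ν hν

theorem incrementBound_lipConst (hp2 : p < 2) (hC : 0 < C)
    (hψ : ∀ μ ∈ pathCone D, ∀ ν ∈ pathCone D,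
      |ψ μ - ψ ν| ≤ C * (eLpNorm (fun s => μ s - ν s) (ENNReal.ofReal p) unitMeasure).toReal) :
    lipConst (pathCone D) ψ ≠ ∞ ∧ IncrementBound ψ 0 (lipConst (pathCone D) ψ).toReal := by
  have hfin : lipConst (pathCone D) ψ ≠ ∞ := by
    refine ne_top_of_le_ne_top ENNReal.ofReal_ne_top (lipConst_le (c := C) fun μ hμ ν hν => ?_)
    refine (abs_sub_le_of_eLpNorm hψ hμ hν).trans (mul_le_mul_of_nonneg_left ?_ hC.le)
    rw [dist_eq_norm (E := PathSpace D)]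
    exact toReal_eLpNorm_le_norm _ hp2
  refine ⟨hfin, le_rfl, ENNReal.toReal_nonneg, fun μ hμ ν hν => ?_⟩
  have := abs_sub_le_lipConst_mul hfin hμ hν fun h => by rw [dist_eq_zero.1 h]
  rw [dist_eq_norm (E := PathSpace D)] at this
  rw [zero_mul, zero_add]
  exact (le_abs_self _).trans this

theorem sub_le_interpolation (hp1 : 1 ≤ p) (hp2 : p < 2) (hC : 0 < C)
    (hψ : ∀ μ ∈ pathCone D, ∀ ν ∈ pathCone D,
      |ψ μ - ψ ν| ≤ C * (eLpNorm (fun s => μ s - ν s) (ENNReal.ofReal p) unitMeasure).toReal)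
    {μ ν : PathSpace D} (hμ : μ ∈ pathCone D) (hν : ν ∈ pathCone D) :
    |ψ μ - ψ ν| ≤ C * (pathNormL1 (μ - ν) ^ ((2 - p) / p) * ‖μ - ν‖ ^ (1 - (2 - p) / p)) :=
  (abs_sub_le_of_eLpNorm hψ hμ hν).trans
    (mul_le_mul_of_nonneg_left (toReal_eLpNorm_le _ hp1 hp2) hC.le)

/-- The constant in the approximation of the initial condition by averaging. -/
noncomputable def initialConst (D : ℕ) (p C : ℝ) : ℝ :=
  C * (approxConst D ^ ((2 - p) / p) * 2 ^ (1 - (2 - p) / p))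

theorem initialConst_pos (D : ℕ) (p : ℝ) {C : ℝ} (hC : 0 < C) : 0 < initialConst D p C :=
  mul_pos hC (mul_pos (Real.rpow_pos_of_pos (approxConst_pos D) _)
    (Real.rpow_pos_of_pos two_pos _))

/-- The `L¹` rate `n^(-1/2)` enters with the interpolation power `θ = (2 - p) / p`, the `L²` norm
being merely bounded; hence the exponent `θ / 2`. -/
theorem abs_average_sub_le (hp1 : 1 ≤ p) (hp2 : p < 2) (hC : 0 < C)
    (hψ : ∀ μ ∈ pathCone D, ∀ ν ∈ pathCone D,
      |ψ μ - ψ ν| ≤ C * (eLpNorm (fun s => μ s - ν s) (ENNReal.ofReal p) unitMeasure).toReal)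
    {j : UnitPartition} (hj : j.IsUniform) {μ : PathSpace D} (hμ : μ ∈ pathCone D) :
    |ψ (pathLift j (pathProj j μ)) - ψ μ| ≤
      initialConst D p C * (j.n : ℝ) ^ (-((2 - p) / (2 * p))) * ‖μ‖ := by
  have hp0 : 0 < p := by linarith
  have hn : (0 : ℝ) < j.n := by exact_mod_cast j.n_pos
  set θ := (2 - p) / p with hθ
  have hθ0 : 0 ≤ θ := div_nonneg (by linarith) hp0.le
  have hθ1 : 0 ≤ 1 - θ := by rw [sub_nonneg, hθ, div_le_one hp0]; linarith
  rw [abs_sub_comm]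
  refine (sub_le_interpolation hp1 hp2 hC hψ hμ
    (pathLift_mem_pathCone (pathProj_mem_stepCone j hμ))).trans ?_
  have h1 : pathNormL1 (μ - pathLift j (pathProj j μ)) ^ θ ≤
      (approxConst D * (√(j.n : ℝ))⁻¹ * ‖μ‖) ^ θ :=
    Real.rpow_le_rpow (pathNormL1_nonneg _) (pathNormL1_sub_le hj hμ) hθ0
  have h2 : ‖μ - pathLift j (pathProj j μ)‖ ^ (1 - θ) ≤ (2 * ‖μ‖) ^ (1 - θ) :=
    Real.rpow_le_rpow (norm_nonneg (μ - pathLift j (pathProj j μ))) (norm_sub_pathLift_pathProj_le j μ) hθ1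
  have hcD := approxConst_pos D
  have hμ0 : 0 ≤ ‖μ‖ := norm_nonneg μ
  have h3 : (approxConst D * (√(j.n : ℝ))⁻¹ * ‖μ‖) ^ θ * (2 * ‖μ‖) ^ (1 - θ) =
      approxConst D ^ θ * 2 ^ (1 - θ) * (j.n : ℝ) ^ (-((2 - p) / (2 * p))) * ‖μ‖ := by
    rw [Real.mul_rpow (by positivity) hμ0, Real.mul_rpow hcD.le (by positivity),
      Real.mul_rpow two_pos.le hμ0]
    have e1 : ((√(j.n : ℝ))⁻¹) ^ θ = (j.n : ℝ) ^ (-((2 - p) / (2 * p))) := by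
      rw [Real.sqrt_eq_rpow, ← Real.rpow_neg hn.le, ← Real.rpow_mul hn.le, hθ]
      congr 1
      field_simp
    have e2 : ‖μ‖ ^ θ * ‖μ‖ ^ (1 - θ) = ‖μ‖ := by
      rw [← Real.rpow_add_of_nonneg hμ0 hθ0 hθ1, add_sub_cancel, Real.rpow_one]
    rw [e1]
    linear_combination approxConst D ^ θ * 2 ^ (1 - θ) *
      (j.n : ℝ) ^ (-((2 - p) / (2 * p))) * e2
  calc _ ≤ C * ((approxConst D * (√(j.n : ℝ))⁻¹ * ‖μ‖) ^ θ * (2 * ‖μ‖) ^ (1 - θ)) := by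
        refine mul_le_mul_of_nonneg_left (mul_le_mul h1 h2 ?_ ?_) hC.le
        · exact Real.rpow_nonneg (norm_nonneg (μ - pathLift j (pathProj j μ))) _
        · exact Real.rpow_nonneg (by positivity) _
    _ = _ := by rw [h3, initialConst]; ring

end Initial

/-! ### Limits of nets of approximate solutions -/

section Limit

variable {D : ℕ} {H ψ : PathSpace D → ℝ} {p C : ℝ}

theorem LocallyLipschitz.exists_gradSet_bounds (hH : LocallyLipschitz H)
    (hK : TotallyBounded (gradSet ψ)) :
    ∃ r > 0, ∃ Λ ≥ 0, ∃ M ≥ 0, (∀ q ∈ gradSet ψ, |H q| ≤ M) ∧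
      ∀ q ∈ gradSet ψ, ∀ ρ, ‖ρ‖ ≤ r → |H (q + ρ) - H q| ≤ Λ * ‖ρ‖ := by
  have hcpt : IsCompact (closure (gradSet ψ)) :=
    hK.closure.isCompact_of_isClosed isClosed_closure
  obtain ⟨r, hr, Λ, hΛ, h⟩ := hH.exists_bound_of_isCompact hcpt
  obtain ⟨M, hM⟩ := hcpt.exists_bound_of_continuousOn hH.continuous.continuousOn
  exact ⟨r, hr, Λ, hΛ, |M|, abs_nonneg M,
    fun q hq => (hM q (subset_closure hq)).trans (le_abs_self M),
    fun q hq => h q (subset_closure hq)⟩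

/-- The quantitative comparison of two levels. -/
theorem exists_levels_bound (hH : LocallyLipschitz H)
    (hHinc : ConeIncreasingOn (dualCone (pathCone D)) univ H)
    (hp1 : 1 ≤ p) (hp2 : p < 2) (hC : 0 < C)
    (hψ : ∀ μ ∈ pathCone D, ∀ ν ∈ pathCone D,
      |ψ μ - ψ ν| ≤ C * (eLpNorm (fun s => μ s - ν s) (ENNReal.ofReal p) unitMeasure).toReal)
    (hK : TotallyBounded (gradSet ψ)) {L : ℝ} (hL : IncrementBound ψ 0 L) :
    ∃ K : ℝ, 0 ≤ K ∧ ∀ j j' : UnitPartition, j.IsUniform → j'.IsUniform → j ≤ j' →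
      ∀ (u : ℝ → StepSpace D j → ℝ) (v : ℝ → StepSpace D j' → ℝ),
      IsApproximateSolution H ψ j u → IsApproximateSolution H ψ j' v →
      ∀ t, 0 ≤ t → ∀ x ∈ stepCone D j',
        |u t (pathProj j (pathLift j' x)) - v t x| ≤
          K * (j.n : ℝ) ^ (-((2 - p) / (2 * p))) * (t + ‖x‖) := by
  obtain ⟨r, hr, Λ, hΛ, M, hM, hHM, hHΛ⟩ := hH.exists_gradSet_bounds hK
  set C₀ := initialConst D p C with hC₀
  have hC₀0 : 0 < C₀ := initialConst_pos D p hC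
  -- The part `1 + Λ` serves when the averaging error is below the radius `r` on which `H` is
  -- controlled. For coarser partitions the growth bounds suffice, and `2 * M / r` turns `2 * M`
  -- into a multiple of that error.
  refine ⟨C₀ * (1 + Λ + 2 * M / r), by positivity, ?_⟩
  intro j j' hj hj' hjj' u v hu hv t ht x hx
  set R := (j.n : ℝ) ^ (-((2 - p) / (2 * p))) with hR
  have hR0 : 0 ≤ R := Real.rpow_nonneg (Nat.cast_nonneg _) _
  have hψκ : ∀ μ ∈ pathCone D, |ψ (pathLift j (pathProj j μ)) - ψ μ| ≤ C₀ * R * ‖μ‖ :=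
    fun μ hμ => abs_average_sub_le hp1 hp2 hC hψ hj hμ
  have hκ : 0 ≤ C₀ * R := by positivity
  have hx0 := norm_nonneg x
  rcases lt_or_ge (C₀ * R) r with h | h
  · refine (hu.abs_sub_le_of_levels hjj' hH.continuous hHinc hv hL hκ hΛ hHΛ h hψκ ht hx).trans ?_
    have h1 : 0 ≤ C₀ * R * (t + Λ * ‖x‖ + 2 * M / r * (t + ‖x‖)) := by positivity
    linarith
  · have h1 := hu.abs_sub_initial_le hH.continuous hL hHM ht
      (pathProj_mem_stepCone j (pathLift_mem_pathCone hx))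
    have h2 := hv.abs_sub_initial_le hH.continuous hL hHM ht hx
    have h3 := hψκ _ (pathLift_mem_pathCone hx)
    rw [norm_pathLift] at h3
    rw [hu.initial _ (pathProj_mem_stepCone j (pathLift_mem_pathCone hx))] at h1
    rw [hv.initial _ hx] at h2
    have h4 : 2 * M * t ≤ C₀ * R * (2 * M / r) * t := by
      have : 2 * M ≤ C₀ * R * (2 * M / r) := by
        rw [mul_div_assoc', le_div_iff₀ hr]
        nlinarith
      exact mul_le_mul_of_nonneg_right this ht
    have h5 : |u t (pathProj j (pathLift j' x)) - v t x| ≤ 2 * M * t + C₀ * R * ‖x‖ := by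
      rw [abs_le] at *
      constructor <;> linarith
    have h6 : 0 ≤ C₀ * R * ((1 + Λ) * t + (Λ + 2 * M / r) * ‖x‖) := by positivity
    linarith

/-- A directed family which is Cauchy with explicit errors has a limit. -/
theorem exists_limit_of_directed {X : Type*} {J : Set UnitPartition} (hne : J.Nonempty)
    (hdir : ∀ j ∈ J, ∀ j' ∈ J, ∃ j'' ∈ J, j ≤ j'' ∧ j' ≤ j'') {S : Set X}
    {g e : UnitPartition → X → ℝ}
    (h : ∀ j ∈ J, ∀ j' ∈ J, j ≤ j' → ∀ x ∈ S, |g j x - g j' x| ≤ e j x) :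
    ∃ F : X → ℝ, ∀ j ∈ J, ∀ x ∈ S, |g j x - F x| ≤ e j x := by
  have : Nonempty J := hne.to_subtype
  -- By directedness every lower bound `g i - e i` lies below every upper bound `g j + e j`, so this
  -- infimum lies in all the error bands.
  refine ⟨fun x => ⨅ j : J, (g j x + e j x), fun i hi x hx => ?_⟩
  have key : ∀ i ∈ J, ∀ j ∈ J, g i x - e i x ≤ g j x + e j x := by
    intro i hi j hj
    obtain ⟨k, hk, hik, hjk⟩ := hdir i hi j hj
    linarith [(abs_le.1 (h i hi k hk hik x hx)).2, (abs_le.1 (h j hj k hk hjk x hx)).1]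
  have h1 : g i x - e i x ≤ ⨅ j : J, (g j x + e j x) := le_ciInf fun j => key i hi j j.2
  have h2 : ⨅ j : J, (g j x + e j x) ≤ g i x + e i x :=
    ciInf_le ⟨g i x - e i x, by rintro _ ⟨j, rfl⟩; exact key i hi j j.2⟩ (⟨i, hi⟩ : J)
  rw [abs_le]
  constructor <;> linarith

theorem UnitPartition.IsGood.exists_error_le {J : Set UnitPartition} (hJ : UnitPartition.IsGood J)
    (hp1 : 1 ≤ p) (hp2 : p < 2) (B : ℝ) {ε : ℝ} (hε : 0 < ε) :
    ∃ j₀ ∈ J, ∀ j, j₀ ≤ j → |B| * (j.n : ℝ) ^ (-((2 - p) / (2 * p))) ≤ ε := by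
  have hα : 0 < (2 - p) / (2 * p) := div_pos (by linarith) (by linarith)
  have h1 : Tendsto (fun n : ℕ => |B| * (n : ℝ) ^ (-((2 - p) / (2 * p)))) atTop (𝓝 0) := by
    simpa using ((tendsto_rpow_neg_atTop hα).comp tendsto_natCast_atTop_atTop).const_mul |B|
  obtain ⟨N, hN⟩ := eventually_atTop.1 (h1.eventually_le_const hε)
  obtain ⟨j₀, hj₀, hn⟩ := hJ.exists_n_ge N
  exact ⟨j₀, hj₀, fun j hj => hN j.n (hn.trans (UnitPartition.n_le_of_le hj))⟩

theorem le_of_forall_good {J : Set UnitPartition} (hJ : UnitPartition.IsGood J)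
    (hp1 : 1 ≤ p) (hp2 : p < 2) {a b B : ℝ}
    (h : ∀ j ∈ J, a ≤ b + B * (j.n : ℝ) ^ (-((2 - p) / (2 * p)))) : a ≤ b := by
  refine le_of_forall_pos_le_add fun ε hε => ?_
  obtain ⟨j, hj, hjε⟩ := hJ.exists_error_le hp1 hp2 B hε
  have h1 := hjε j (Subset.refl (range j.t))
  have h2 := mul_le_mul_of_nonneg_right (le_abs_self B)
    (Real.rpow_nonneg (Nat.cast_nonneg j.n) (-((2 - p) / (2 * p))))
  linarith [h j hj]

end Limit

/-! ### Convergence of the net and bounds for its limit -/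

theorem propositionp (D : ℕ) (hD : 0 < D)
    (H : PathSpace D → ℝ) (hH : LocallyLipschitz H)
    (hHinc : ConeIncreasingOn (dualCone (pathCone D)) univ H)
    (ψ : PathSpace D → ℝ)
    (hψinc : ConeIncreasingOn (dualCone (pathCone D)) (pathCone D) ψ)
    (p C : ℝ) (hp1 : 1 ≤ p) (hp2 : p < 2) (hC : 0 < C)
    (hψ : ∀ μ ∈ pathCone D, ∀ ν ∈ pathCone D,
      |ψ μ - ψ ν| ≤ C * (eLpNorm (fun s => μ s - ν s) (ENNReal.ofReal p) unitMeasure).toReal) :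
    -- convergence along any good collection of partitions, and bounds for the limit
    (∀ J : Set UnitPartition, UnitPartition.IsGood J →
      ∀ f : (j : UnitPartition) → ℝ → StepSpace D j → ℝ,
      (∀ j ∈ J, IsApproximateSolution H ψ j (f j)) →
      ∃ F : ℝ → PathSpace D → ℝ,
        UnitPartition.TendstoLocalUniform J (Ici (0 : ℝ) ×ˢ pathCone D)
          (fun j z => f j z.1 (pathProj j z.2)) (fun z => F z.1 z.2) ∧
        (∃ K : ℝ≥0, LipschitzOnWith K (fun z : ℝ × PathSpace D => F z.1 z.2)
          (Ici (0 : ℝ) ×ˢ pathCone D)) ∧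
        (∀ μ ∈ pathCone D, F 0 μ = ψ μ) ∧
        (⨆ t ∈ Ici (0 : ℝ), lipConst (pathCone D) (F t)) ≤ lipConst (pathCone D) ψ ∧
        (⨆ μ ∈ pathCone D, lipConst (Ici (0 : ℝ)) (fun t => F t μ)) ≤
          ⨆ (ι : PathSpace D) (_ : ‖ι‖ₑ ≤ lipConst (pathCone D) ψ), ‖H ι‖ₑ) ∧
    -- quantitative comparison of two approximations, with a constant independent of the partitions
    (∃ K : ℝ, ∀ j j' : UnitPartition, j.IsUniform → j'.IsUniform → j ≤ j' →
      ∀ (u : ℝ → StepSpace D j → ℝ) (v : ℝ → StepSpace D j' → ℝ),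
      IsApproximateSolution H ψ j u → IsApproximateSolution H ψ j' v →
      ∀ t, 0 ≤ t → ∀ x ∈ stepCone D j',
        |u t (pathProj j (pathLift j' x)) - v t x| ≤
          K * (j.n : ℝ) ^ (-((2 - p) / (2 * p))) * (t + ‖x‖)) := by
  obtain ⟨hfin, hL⟩ := incrementBound_lipConst hp2 hC hψ
  set L := (lipConst (pathCone D) ψ).toReal with hLdef
  have hp0 : 0 < p := by linarith
  have hK : TotallyBounded (gradSet ψ) := totallyBounded_gradSet hL fun b hb =>
    exists_incrementBound hC (div_pos (by linarith) hp0) ((div_le_one hp0).2 (by linarith))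
      (fun μ hμ ν hν => (le_abs_self _).trans (sub_le_interpolation hp1 hp2 hC hψ hμ hν)) hb
  obtain ⟨K, hK0, hlevels⟩ := exists_levels_bound hH hHinc hp1 hp2 hC hψ hK hL
  refine ⟨fun J hJ f hf => ?_, K, hlevels⟩
  have hHc := hH.continuous
  have hne : J.Nonempty := by
    obtain ⟨j, hj, -⟩ := hJ.exists_n_ge 0
    exact ⟨j, hj⟩
  -- The comparison at level `j'` is used at the projection of `μ`: averaging twice is averaging
  -- over the coarser cells, and contractivity makes the error independent of `j'`.
  obtain ⟨F', hF'⟩ := exists_limit_of_directed (X := ℝ × PathSpace D) hne hJ.2.1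
    (S := Ici (0 : ℝ) ×ˢ pathCone D) (g := fun j z => f j z.1 (pathProj j z.2))
    (e := fun j z => K * (j.n : ℝ) ^ (-((2 - p) / (2 * p))) * (z.1 + ‖z.2‖)) (by
      rintro j hj j' hj' hjj' ⟨t, μ⟩ ⟨ht, hμ⟩
      have h := hlevels j j' (hJ.1 j hj) (hJ.1 j' hj') hjj' _ _ (hf j hj) (hf j' hj') t ht _
        (pathProj_mem_stepCone j' hμ)
      rw [pathProj_pathLift_pathProj hjj'] at h
      refine h.trans (mul_le_mul_of_nonneg_left ?_ ?_)
      · exact add_le_add le_rfl (norm_pathProj_le j' μ)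
      · exact mul_nonneg hK0 (Real.rpow_nonneg (Nat.cast_nonneg _) _))
  have hF : ∀ j ∈ J, ∀ t, 0 ≤ t → ∀ μ ∈ pathCone D, |f j t (pathProj j μ) - F' (t, μ)| ≤
      K * (j.n : ℝ) ^ (-((2 - p) / (2 * p))) * (t + ‖μ‖) :=
    fun j hj t ht μ hμ => hF' j hj (t, μ) ⟨ht, hμ⟩
  have hspace : ∀ t, 0 ≤ t → ∀ μ ∈ pathCone D, ∀ ν ∈ pathCone D,
      F' (t, μ) - F' (t, ν) ≤ L * ‖μ - ν‖ := by
    intro t ht μ hμ ν hν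
    refine le_of_forall_good hJ hp1 hp2 (B := K * (t + ‖μ‖) + K * (t + ‖ν‖)) fun j hj => ?_
    have h1 := (abs_le.1 (hF j hj t ht μ hμ)).1
    have h2 := (abs_le.1 (hF j hj t ht ν hν)).2
    have h3 := (hf j hj).norm_sub_le hHc hL ht (pathProj_mem_stepCone j hμ)
      (pathProj_mem_stepCone j hν)
    rw [← pathProj_sub] at h3
    have h4 := mul_le_mul_of_nonneg_left (norm_pathProj_le j (μ - ν)) hL.right_nonneg
    linarith
  -- `M` is left free: compactness supplies a finite value for the joint Lipschitz bound, while the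
  -- supremum of `|H|` over the ball gives the stated time constant.
  have htime : ∀ M, 0 ≤ M → (∀ q ∈ gradSet ψ, |H q| ≤ M) → ∀ μ ∈ pathCone D,
      ∀ t, 0 ≤ t → ∀ s, 0 ≤ s → |F' (t, μ) - F' (s, μ)| ≤ M * |t - s| := by
    intro M hM0 hM μ hμ
    have key : ∀ t, 0 ≤ t → ∀ h, 0 ≤ h → |F' (t + h, μ) - F' (t, μ)| ≤ M * h := by
      intro t ht h hh
      refine le_of_forall_good hJ hp1 hp2 (B := K * (t + h + ‖μ‖) + K * (t + ‖μ‖)) fun j hj => ?_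
      have h1 := hF j hj (t + h) (add_nonneg ht hh) μ hμ
      have h2 := hF j hj t ht μ hμ
      have h3 := (hf j hj).abs_time_sub_le hHc hL hM0 hM ht hh (pathProj_mem_stepCone j hμ)
      rw [abs_le] at *
      constructor <;> linarith
    intro t ht s hs
    rcases le_total s t with hst | hst
    · have := key s hs (t - s) (sub_nonneg.2 hst)
      rwa [add_sub_cancel, ← abs_of_nonneg (sub_nonneg.2 hst)] at this
    · have := key t ht (s - t) (sub_nonneg.2 hst)
      rwa [add_sub_cancel, ← abs_of_nonneg (sub_nonneg.2 hst), abs_sub_comm, abs_sub_comm s] at this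
  have hspace' : ∀ t, 0 ≤ t → ∀ μ ∈ pathCone D, ∀ ν ∈ pathCone D,
      |F' (t, μ) - F' (t, ν)| ≤ L * dist μ ν := by
    intro t ht μ hμ ν hν
    have h1 := hspace t ht μ hμ ν hν
    have h2 := hspace t ht ν hν μ hμ
    rw [norm_sub_rev (E := PathSpace D)] at h2
    rw [dist_eq_norm (E := PathSpace D), abs_le]
    constructor <;> linarith
  refine ⟨fun t μ => F' (t, μ), ?_, ?_, ?_, ?_, ?_⟩
  · rintro ⟨t₀, μ₀⟩ ⟨ht₀, -⟩ r ε hε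
    obtain ⟨j₀, hj₀, hj₀ε⟩ := hJ.exists_error_le hp1 hp2 (K * (t₀ + r + (‖μ₀‖ + r))) hε
    refine ⟨j₀, hj₀, fun j hj hjj => ?_⟩
    rintro ⟨t, μ⟩ ⟨⟨ht, hμ⟩, hball⟩
    refine (hF j hj t ht μ hμ).trans (le_trans ?_ (hj₀ε j hjj))
    rw [Metric.mem_closedBall, Prod.dist_eq, max_le_iff] at hball
    have h1 : t ≤ t₀ + r := by
      have := (abs_le.1 (Real.dist_eq t t₀ ▸ hball.1)).2
      linarith
    have h2 : ‖μ‖ ≤ ‖μ₀‖ + r := by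
      have h3 := hball.2
      rw [dist_eq_norm (E := PathSpace D)] at h3
      have := norm_sub_norm_le μ μ₀
      linarith
    rw [mul_right_comm]
    refine mul_le_mul_of_nonneg_right ?_ (Real.rpow_nonneg (Nat.cast_nonneg _) _)
    refine (mul_le_mul_of_nonneg_left ?_ hK0).trans (le_abs_self _)
    exact add_le_add h1 h2
  · obtain ⟨-, -, -, -, M, hM0, hM, -⟩ := hH.exists_gradSet_bounds hK
    refine ⟨(M + L).toNNReal, LipschitzOnWith.of_dist_le_mul (α := ℝ × PathSpace D) (β := ℝ) ?_⟩
    rintro ⟨t, μ⟩ ⟨ht, hμ⟩ ⟨s, ν⟩ ⟨hs, hν⟩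
    rw [Real.coe_toNNReal _ (add_nonneg hM0 hL.right_nonneg)]
    have h1 := htime M hM0 hM μ hμ t ht s hs
    have h2 := hspace' s hs μ hμ ν hν
    have h3 : |t - s| ≤ dist ((t, μ) : ℝ × PathSpace D) (s, ν) := le_max_left _ _
    have h4 : dist μ ν ≤ dist ((t, μ) : ℝ × PathSpace D) (s, ν) := le_max_right _ _
    have h5 := mul_le_mul_of_nonneg_left h3 hM0
    have h6 := mul_le_mul_of_nonneg_left h4 hL.right_nonneg
    rw [Real.dist_eq]
    calc |F' (t, μ) - F' (s, ν)| ≤ |F' (t, μ) - F' (s, μ)| + |F' (s, μ) - F' (s, ν)| :=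
          abs_sub_le _ _ _
      _ ≤ _ := by rw [add_mul]; linarith
  · intro μ hμ
    have key : |F' (0, μ) - ψ μ| ≤ 0 := by
      refine le_of_forall_good hJ hp1 hp2 (B := K * ‖μ‖ + initialConst D p C * ‖μ‖)
        fun j hj => ?_
      have h1 := hF j hj 0 le_rfl μ hμ
      have h2 := abs_average_sub_le hp1 hp2 hC hψ (hJ.1 j hj) hμ
      rw [(hf j hj).initial _ (pathProj_mem_stepCone j hμ)] at h1
      rw [abs_le] at *
      constructor <;> linarith
    exact sub_eq_zero.1 (abs_nonpos_iff.1 key)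
  · refine iSup₂_le fun t ht => ?_
    refine (lipConst_le (c := L) (hspace' t ht)).trans_eq ?_
    rw [hLdef, ENNReal.ofReal_toReal hfin]
  · refine iSup₂_le fun μ hμ => ?_
    set S := ⨆ (ι : PathSpace D) (_ : ‖ι‖ₑ ≤ lipConst (pathCone D) ψ), ‖H ι‖ₑ with hS
    -- A locally Lipschitz `H` may be unbounded on a ball of path space, in which case the bound is
    -- trivial.
    rcases eq_or_ne S ∞ with h | h
    · rw [h]; exact le_top
    have hM : ∀ q ∈ gradSet ψ, |H q| ≤ S.toReal := by
      intro q hq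
      have h1 : ‖q‖ₑ ≤ lipConst (pathCone D) ψ := by
        rw [← ofReal_norm (E := PathSpace D), ← ENNReal.ofReal_toReal hfin]
        exact ENNReal.ofReal_le_ofReal (norm_le_of_mem_gradSet hL hq)
      have h2 : ‖H q‖ₑ ≤ S := le_iSup₂_of_le q h1 le_rfl
      have h3 := ENNReal.toReal_mono h h2
      rwa [toReal_enorm, Real.norm_eq_abs] at h3
    refine (lipConst_le (c := S.toReal) fun t ht s hs => ?_).trans_eq (ENNReal.ofReal_toReal h)
    rw [Real.dist_eq]
    exact htime _ ENNReal.toReal_nonneg hM μ hμ t ht s hs
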